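/- Let $d\ge 1$, let $\|\cdot\|$ be the Euclidean norm on $\mathbb R^d$, let $|V^d|$ be the volume of the unit ball and $\sigma$ the surface measure on the unit sphere $S^{d-1}$. Let $P,Q$ be probability measures on $\mathbb R^d$ carried by a set $\mathcal X$, and let $\kappa(x,dy)$ be a Markov kernel from $\mathbb R^d$ to $\mathbb R$, the common conditional distribution of $Y$ given $X=x$ and of $Y^*$ given $X^*=x$, where $X\sim P$ and $X^*\sim Q$. Let $h:\mathbb R^d\times\mathbb R\to\mathbb R$ be measurable with $h(X,Y)$ and $h(X^*,Y^*)$ integrable, and put $$e(h)=\mathbb E[h(X^*,Y^*)],\qquad \Delta(x,u)=\int h(x,y)\,\kappa(u,dy)=\mathbb E[h(x,Y)\mid X=u],\qquad g(x)=\Delta(x,x)=\mathbb E[h(X,Y)\mid X=x].$$ **Data and estimators.** Let $(X_i,Y_i)_{i\ge1}$ be i.i.d. copies of $(X,Y)$ and, independently of them, $(X_j^*)_{j\ge1}$ i.i.d. with law $Q$. For $1\le k\le n$ let $\hat\tau_k(x)$ be the $k$-th order statistic of $(\|X_i-x\|)_{1\le i\le n}$. For $m\ge1$ let $\hat Y_1^*,\dots,\hat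 Y_m^*$ be random variables which, conditionally on $X_1,Y_1,\dots,X_n,Y_n,X_1^*,\dots,X_m^*$, are independent, $\hat Y_j^*$ having conditional law $k^{-1}\sum_{i=1}^n\mathbf 1\{\|X_i-X_j^*\|\le\hat\tau_k(X_j^*)\}\,\delta_{Y_i}$. Define $$\hat e_1(h)=\frac1m\sum_{j=1}^m h(X_j^*,\hat Y_j^*),\qquad \hat e_2(h)=\frac1n\sum_{i=1}^n\frac{nM_k^*(X_i)}{mk}h(X_i,Y_i),\qquad M_k^*(x)=\sum_{j=1}^m\mathbf 1\{\|x-X_j^*\|\le\hat\tau_k(X_j^*)\},$$ and $B_{i,n}=\mathbb E[\hat e_i(h)\mid X_1,\dots,X_n]-e(h)$ for $i=1,2$ ($\hat e_1(h)$ being assumed integrable when $i=1$). **Assumptions.** Let $U\supseteq\mathcal X$ be open, convex and bounded, and let $\mathrm{co}(\mathcal X)$ be the convex hull of $\mathcal X$. 1. $\mathcal X$ is compact, and there is $c>0$ such that $|B(x,r)\cap\mathcal X|\ge c\,|B(x,r)|$ for all $x\in\mathcal X$ and $0\le r\le\mathrm{diam}(\mathcal X)$, where $B(x,r)$ is the closed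 ball and $|\cdot|$ is Lebesgue measure. 2. $P$ and $Q$ have Lebesgue densities $p$ and $q$, and there are $\underline p,\overline q>0$ with $p\ge\underline p$ and $q\le\overline q$ on $\mathcal X$. 3. $g$ and $p$ are Lipschitz on $\mathcal X$. 4. $p$ is the restriction to $\mathcal X$ of some $\overline p\in C^1(U)$ whose gradient is $\eta$-Hölder on $\mathrm{co}(\mathcal X)$ for some $\eta\in(0,1)$. 5. The support of $Q$ lies in the interior of $\mathcal X$. 6. If $i=1$: for each $x\in\mathcal X$, $\Delta(x,\cdot)$ is the restriction to $\mathcal X$ of a $C^2$ function on $U$ (still denoted $\Delta(x,\cdot)$), with $\sup_{x\in\mathcal X,\,y\in\mathrm{co}(\mathcal X)}\{\|\nabla_2\Delta(x,y)\|+\|\nabla_2^2\Delta(x,y)\|\}<\infty$ and, for some $\beta\in(0,1)$, $\sup_{x\in\mathcal X;\,y\ne z\in\mathrm{co}(\mathcal X)}\|\nabla_2^2\Delta(x,y)-\nabla_2^2\Delta(x,z)\|/\|y-z\|^\beta<\infty$. Here $\nabla_2,\nabla_2^2$ are the gradient and Hessian in the second argument. If $i=2$: $g$ is the restriction to $\mathcal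 X$ of a $C^2$ function on $U$ whose Hessian is $\beta$-Hölder on $\mathrm{co}(\mathcal X)$ for some $\beta\in(0,1)$. 7. $k=k_n$ and $m=m_n$ depend on $n$, with $1\le k_n\le n$, $m_n\ge1$, and $k_n^{d+1}=o(n)$ as $n\to\infty$ (nothing else is assumed on $m_n$). **Conclusion.** For $i\in\{1,2\}$, under the assumptions for that $i$, $B_{i,n}$ is square integrable for every $n\ge 1$, and as $n\to\infty$, with $k=k_n$, $$\mathbb E[B_{i,n}]=C_i(k,P,Q,h)\,n^{-2/d}+o\big((k/n)^{2/d}\big),$$ where $$C_i(k,P,Q,h)=\frac1k\sum_{\ell=1}^k\frac{\Gamma(\ell+2/d)}{\Gamma(\ell)}\int_{\mathcal X}(p(x)|V^d|)^{-2/d}\,\Psi_i(x)\,dQ(x),$$ $$\Psi_1(x)=\frac1{\sigma(S^{d-1})}\int_{S^{d-1}}\theta^\top\Big(\frac{\nabla_2\Delta(x,x)\,\nabla p(x)^\top}{p(x)}+\frac{\nabla_2^2\Delta(x,x)}2\Big)\theta\,d\sigma(\theta),$$ $$\Psi_2(x)=\frac1{\sigma(S^{d-1})}\int_{S^{d-1}}\theta^\top\Big(\frac{\nabla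 g(x)\,\nabla p(x)^\top}{p(x)}+\frac{\nabla^2g(x)}2\Big)\theta\,d\sigma(\theta)$$ (gradients are column vectors). If moreover $d>2$, then for $i\in\{1,2\}$, under the assumptions for that $i$, $$\mathbb E[B_{i,n}^2]=C_i(k,P,Q,h)^2\,n^{-4/d}+o\big((k/n)^{4/d}\big).$$ -/

import Mathlib

open MeasureTheory ProbabilityTheory Filter Asymptotics
open scoped NNReal ENNReal Topology RealInnerProductSpace

namespace KNNMatching

noncomputable section

/-- `ℝ^d` with the Euclidean norm. -/
abbrev E (d : ℕ) : Type := EuclideanSpace ℝ (Fin d)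

/-! ### Domain, densities and smoothness -/

/-- Balls centred in `S` with radius at most `diam S` meet `S` in a fixed proportion of their
volume. -/
def BallProportion {d : ℕ} (S : Set (E d)) : Prop :=
  ∃ c : ℝ, 0 < c ∧ ∀ x ∈ S, ∀ r : ℝ, 0 ≤ r → r ≤ Metric.diam S →
    ENNReal.ofReal c * volume (Metric.closedBall x r) ≤ volume (Metric.closedBall x r ∩ S)

/-- `P` is carried by `S` and has density `p` with respect to Lebesgue measure. -/
structure HasDensityOn {d : ℕ} (S : Set (E d)) (P : Measure (E d)) (p : E d → ℝ) : Prop where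
  measurable : Measurable p
  nonneg : ∀ x, 0 ≤ p x
  eq_withDensity : P = volume.withDensity (fun x => ENNReal.ofReal (p x))
  compl_null : P Sᶜ = 0

/-- The Hessian as a bilinear form `∇²f(x)(u, v) = uᵀ ∇²f(x) v`; its norm is the Euclidean operator
norm of the Hessian matrix. -/
def hess {d : ℕ} (f : E d → ℝ) (x : E d) : E d →L[ℝ] E d →L[ℝ] ℝ :=
  fderiv ℝ (fderiv ℝ f) x

/-- `p` is the restriction to `S` of a `C¹` function on `U` whose gradient is `η`-Hölder on the
convex hull of `S`, for some `η ∈ (0,1)`. -/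
def DensitySmooth {d : ℕ} (S U : Set (E d)) (p : E d → ℝ) : Prop :=
  ∃ pbar : E d → ℝ, Set.EqOn p pbar S ∧ ContDiffOn ℝ 1 pbar U ∧
    ∃ η : ℝ≥0, 0 < η ∧ η < 1 ∧ ∃ L : ℝ≥0,
      HolderOnWith L η (fderiv ℝ pbar) (convexHull ℝ S)

/-- `g` is the restriction to `S` of a `C²` function on `U` whose Hessian is `β`-Hölder on the
convex hull of `S`, for some `β ∈ (0,1)`. -/
def RegressionSmooth {d : ℕ} (S U : Set (E d)) (g : E d → ℝ) : Prop :=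
  ∃ gbar : E d → ℝ, Set.EqOn g gbar S ∧ ContDiffOn ℝ 2 gbar U ∧
    ∃ β : ℝ≥0, 0 < β ∧ β < 1 ∧ ∃ L : ℝ≥0,
      HolderOnWith L β (hess gbar) (convexHull ℝ S)

/-- For every `x ∈ S`, `D x` is the restriction to `S` of a `C²` function on `U`; its first two
derivatives are bounded, and its Hessian is `β`-Hölder for some `β ∈ (0,1)`, on the convex hull of
`S`, uniformly in `x ∈ S`. -/
def CrossRegressionSmooth {d : ℕ} (S U : Set (E d)) (D : E d → E d → ℝ) : Prop :=
  ∃ Dbar : E d → E d → ℝ, (∀ x ∈ S, Set.EqOn (D x) (Dbar x) S) ∧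
    (∀ x ∈ S, ContDiffOn ℝ 2 (Dbar x) U) ∧
    (∃ M : ℝ, ∀ x ∈ S, ∀ y ∈ convexHull ℝ S,
      ‖fderiv ℝ (Dbar x) y‖ + ‖hess (Dbar x) y‖ ≤ M) ∧
    ∃ β : ℝ≥0, 0 < β ∧ β < 1 ∧ ∃ L : ℝ≥0, ∀ x ∈ S,
      HolderOnWith L β (hess (Dbar x)) (convexHull ℝ S)

/-! ### The statistical model

`κ` is the common conditional distribution of the label given the covariate: `(X, Y)` has law
`P ⊗ₘ κ` and `(X*, Y*)` has law `Q ⊗ₘ κ`. -/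

/-- `Δ(x, u) = E[h(x, Y) | X = u]`. -/
def crossRegression {d : ℕ} (κ : Kernel (E d) ℝ) (h : E d × ℝ → ℝ) (x u : E d) : ℝ :=
  ∫ y, h (x, y) ∂(κ u)

/-- `g(x) = E[h(X, Y) | X = x]`. -/
def regression {d : ℕ} (κ : Kernel (E d) ℝ) (h : E d × ℝ → ℝ) (x : E d) : ℝ :=
  ∫ y, h (x, y) ∂(κ x)

/-- The target `e(h) = E[h(X*, Y*)]`. -/
def target {d : ℕ} (Q : Measure (E d)) (κ : Kernel (E d) ℝ) (h : E d × ℝ → ℝ) : ℝ :=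
  ∫ z, h z ∂(Q ⊗ₘ κ)

variable {d : ℕ} {Ω : Type*} [MeasurableSpace Ω]

/-- `(X i, Y i)` are i.i.d. with law `P ⊗ₘ κ`, `Xs j` are i.i.d. with law `Q`, and the two families
are independent. -/
structure IsSample (μ : Measure Ω) (P Q : Measure (E d)) (κ : Kernel (E d) ℝ)
    (X : ℕ → Ω → E d) (Y : ℕ → Ω → ℝ) (Xs : ℕ → Ω → E d) : Prop where
  measurable_X : ∀ i, Measurable (X i)
  measurable_Y : ∀ i, Measurable (Y i)
  measurable_Xs : ∀ j, Measurable (Xs j)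
  law_XY : ∀ i, μ.map (fun ω => (X i ω, Y i ω)) = P ⊗ₘ κ
  law_Xs : ∀ j, μ.map (Xs j) = Q
  indep_XY : iIndepFun (fun i ω => (X i ω, Y i ω)) μ
  indep_Xs : iIndepFun Xs μ
  indep : IndepFun (fun ω (i : ℕ) => (X i ω, Y i ω)) (fun ω (j : ℕ) => Xs j ω) μ

/-- The `k`-nearest neighbour radius at `z`: for `1 ≤ k ≤ n` this is the `k`-th order statistic of
`‖x i - z‖`, `i < n`, that is, the least `r` such that at least `k` of these numbers are `≤ r`. -/
def knnRadius (n k : ℕ) (x : ℕ → E d) (z : E d) : ℝ :=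
  sInf {r : ℝ | k ≤ ((Finset.range n).filter (fun i => ‖x i - z‖ ≤ r)).card}

/-- The `σ`-algebra generated by `X i`, `i < n`. -/
abbrev sigmaX (n : ℕ) (X : ℕ → Ω → E d) : MeasurableSpace Ω :=
  MeasurableSpace.comap (fun ω (i : Fin n) => X i ω) inferInstance

/-- The `σ`-algebra generated by `X i`, `Y i`, `i < n`, and `Xs j`, `j < m`. -/
abbrev sigmaAll (n m : ℕ) (X : ℕ → Ω → E d) (Y : ℕ → Ω → ℝ) (Xs : ℕ → Ω → E d) :
    MeasurableSpace Ω :=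
  MeasurableSpace.comap
    (fun ω => ((fun i : Fin n => (X i ω, Y i ω)), (fun j : Fin m => Xs j ω))) inferInstance

/-- The mass which the `k`-nearest neighbour conditional distribution
`k⁻¹ ∑_{i < n} 1{‖x i - z‖ ≤ τ(z)} δ_{y i}` at `z` gives to `A`. -/
def knnLaw (n k : ℕ) (x : ℕ → E d) (y : ℕ → ℝ) (z : E d) (A : Set ℝ) : ℝ :=
  (k : ℝ)⁻¹ * ∑ i ∈ Finset.range n,
    Set.indicator {w : E d | ‖w - z‖ ≤ knnRadius n k x z} 1 (x i) * Set.indicator A 1 (y i)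

/-- The imputed labels `Yhat j`, `j < m`: given all the data they are independent and `Yhat j`
has the `k`-nearest neighbour conditional distribution at `Xs j`. -/
structure IsImputation (μ : Measure Ω) (n k m : ℕ) (X : ℕ → Ω → E d) (Y : ℕ → Ω → ℝ)
    (Xs : ℕ → Ω → E d) (Yhat : Fin m → Ω → ℝ) : Prop where
  measurable : ∀ j, Measurable (Yhat j)
  cond_law : ∀ A : Fin m → Set ℝ, (∀ j, MeasurableSet (A j)) →
    μ[Set.indicator (⋂ j, Yhat j ⁻¹' A j) (fun _ => (1 : ℝ)) | sigmaAll n m X Y Xs]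
      =ᵐ[μ] fun ω => ∏ j : Fin m,
        knnLaw n k (fun i => X i ω) (fun i => Y i ω) (Xs j ω) (A j)

/-- First estimator: the mean of `h(X*_j, Yhat_j)`. -/
def estimatorOne (m : ℕ) (h : E d × ℝ → ℝ) (Xs : ℕ → Ω → E d) (Yhat : Fin m → Ω → ℝ)
    (ω : Ω) : ℝ :=
  (m : ℝ)⁻¹ * ∑ j : Fin m, h (Xs j ω, Yhat j ω)

/-- `M(z)`: the number of `j < m` for which `z` lies within the `k`-nearest neighbour radius
of `xs j`. -/
def matchCount (n k m : ℕ) (x xs : ℕ → E d) (z : E d) : ℕ :=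
  ((Finset.range m).filter (fun j => ‖z - xs j‖ ≤ knnRadius n k x (xs j))).card

/-- Second estimator: the mean over `i < n` of `(n M(X_i) / (m k)) h(X_i, Y_i)`. -/
def estimatorTwo (n k m : ℕ) (h : E d × ℝ → ℝ) (X : ℕ → Ω → E d) (Y : ℕ → Ω → ℝ)
    (Xs : ℕ → Ω → E d) (ω : Ω) : ℝ :=
  (n : ℝ)⁻¹ * ∑ i ∈ Finset.range n,
    ((n : ℝ) * (matchCount n k m (fun a => X a ω) (fun j => Xs j ω) (X i ω) : ℝ) /
      ((m : ℝ) * (k : ℝ))) * h (X i ω, Y i ω)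

/-- The conditional bias `E[est | X_0, …, X_{n-1}] - e`. -/
def condBias (μ : Measure Ω) (n : ℕ) (X : ℕ → Ω → E d) (est : Ω → ℝ) (e : ℝ) (ω : Ω) : ℝ :=
  (μ[est | sigmaX n X]) ω - e

/-! ### The leading constant -/

/-- The spherical mean
`σ(S^{d-1})⁻¹ ∫ θᵀ (∇f(x) ∇p(x)ᵀ / p(x) + ∇²f(x) / 2) θ dσ(θ)`. -/
def sphereMean (p f : E d → ℝ) (x : E d) : ℝ :=
  ((volume : Measure (E d)).toSphere.real Set.univ)⁻¹ *
    ∫ θ : Metric.sphere (0 : E d) 1,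
      (⟪gradient f x, (θ : E d)⟫ * ⟪gradient p x, (θ : E d)⟫ / p x +
        hess f x (θ : E d) (θ : E d) / 2) ∂(volume : Measure (E d)).toSphere

/-- `k⁻¹ ∑_{ℓ=1}^k Γ(ℓ + 2/d) / Γ(ℓ) ∫_S (p(x) |V|)^{-2/d} Ψ(x) dQ(x)`, where `|V|` is the volume
of the unit ball and `Ψ(x)` is the spherical mean at `x` for the function `F x`. -/
def biasCoef (k : ℕ) (S : Set (E d)) (p : E d → ℝ) (Q : Measure (E d)) (F : E d → E d → ℝ) : ℝ :=
  (k : ℝ)⁻¹ * ∑ l ∈ Finset.Icc 1 k,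
    Real.Gamma ((l : ℝ) + 2 / (d : ℝ)) / Real.Gamma (l : ℝ) *
      ∫ x in S, (p x * (volume : Measure (E d)).real (Metric.closedBall 0 1)) ^ (-(2 / (d : ℝ))) *
        sphereMean p (F x) x ∂Q

/-- For the conditional biases `B n`: `E[B n] = C n · n^{-2/d} + o((k n / n)^{2/d})`, and if `d > 2`
then also `E[(B n)²] = (C n)² n^{-4/d} + o((k n / n)^{4/d})`; the moments involved are finite. -/
def HasBiasExpansion (d : ℕ) (μ : Measure Ω) (k : ℕ → ℕ) (B : ℕ → Ω → ℝ) (C : ℕ → ℝ) : Prop :=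
  (∀ n, 1 ≤ n → MemLp (B n) 2 μ) ∧
  (fun n : ℕ => (∫ ω, B n ω ∂μ) - C n * (n : ℝ) ^ (-(2 / (d : ℝ))))
    =o[atTop] (fun n : ℕ => ((k n : ℝ) / (n : ℝ)) ^ (2 / (d : ℝ))) ∧
  (2 < d →
    (fun n : ℕ => (∫ ω, (B n ω) ^ 2 ∂μ) - (C n) ^ 2 * (n : ℝ) ^ (-(4 / (d : ℝ))))
      =o[atTop] (fun n : ℕ => ((k n : ℝ) / (n : ℝ)) ^ (4 / (d : ℝ))))

end

end KNNMatching

/-! Both estimators average `h` over pairs formed by a target covariate `z` and one of its `k`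
nearest sample points. Given the covariates `X_i`, the labels are independent with laws `κ(X_i)` and
the targets are i.i.d. with law `Q`. Hence both conditional biases have the form `B = ∫ k⁻¹ ∑_{i
among the k nearest to z} φ(z, X_i) dQ(z)`, with `φ(z, y) = F(z, y) - F(z, z)`, where `F(z, y) =
Δ(z, y)` for the first estimator and `F(z, y) = g(y)` for the second (`nnBias`,
`BiasSetting.condBias_estimatorOne`, `BiasSetting.condBias_estimatorTwo`). The target sample size
has dropped out, and a single analysis in terms of `F` serves both cases.

Mean. A sample point at `y` is among the `k` nearest to `z` iff fewer than `k` of the other `n - 1`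
points fall in the ball about `z` through `y`. So `E[B]` is the integral of `φ` against the weight
`(n/k) Pr(Bin(n-1, G(‖y - z‖)) < k)`, where `G(r)` is the `P`-mass of the ball of radius `r` about
`z` (`integral_sum_lowRank`). As `G(‖X - z‖)` is uniform on `[0,1]`, the moments of `G` against this
weight are Beta integrals that depend neither on `z` nor on `P`; this is the source of the factors
`Γ(ℓ + 2/d)/Γ(ℓ)` and, through `Γ(n+1)/Γ(n+1+2/d)`, of `n^(-2/d)` (`tailMoment_eq`,
`isLittleO_tailMoment_sub`). It therefore suffices to compare `φ(z, ·)` with a multiple of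
`G^(2/d)`. After multiplication by the density `p`, a Taylor expansion at `z` leaves a linear form,
which is odd and vanishes against the radial weight, and a quadratic form, which may be replaced by
its spherical mean times `‖v‖²`; finally `‖v‖²` is asymptotic to `(p(z)|V|)^(-2/d) G^(2/d)`
(`second_order_remainder_isLittleO`, `abs_integral_mul_nnWeight_le`). Points outside a fixed ball
are controlled by the third moment of `G`, of order `(k/n)^3`. The support of `Q` has positive
distance to the complement of `S`, so the bounds are uniform in `z` and dominated convergence gives
the expansion of `E[B]`.

Second moment. By the Efron–Stein inequality (`variance_pi_le_sum`) the variance of `B` is at most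
the sum over `i` of the mean squared effect of deleting `X_i`. Deletion changes the average at `z`
only if `X_i` is one of the `k` nearest neighbours of `z`, and then by `O(R(z)/k)`, where `R(z)`
bounds the distance to the `(k+1)`-st neighbour. Two points `z, w` sharing the neighbour `X_i` are
within `2 max(R(z), R(w))`, each `z` has `k` neighbours, and `Q` has bounded density, so the sum is
`O(k⁻¹ ∫ R^(d+2) dQ)`. Since `E[R^(d+2)]` is of order `(k/n)^(1+2/d)`, the variance is `O(n⁻¹
(k/n)^(2/d))`, which is `o((k/n)^(4/d))` exactly because `d > 2` makes `n⁻¹ = o(n^(-2/d))`. -/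

namespace KNNMatching

/-! ### Combinatorics of the `k` smallest values of a finite family -/

section LowRank

variable {ι : Type*} [DecidableEq ι]

/-- The indices in `s` at which fewer than `k` of the values `r j`, `j ∈ s`, are smaller. -/
noncomputable def lowRank (s : Finset ι) (k : ℕ) (r : ι → ℝ) : Finset ι :=
  s.filter (fun i => (s.filter (fun j => r j < r i)).card < k)

omit [DecidableEq ι] in
theorem mem_lowRank {s : Finset ι} {k : ℕ} {r : ι → ℝ} {i : ι} :
    i ∈ lowRank s k r ↔ i ∈ s ∧ (s.filter (fun j => r j < r i)).card < k := by
  simp [lowRank]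

omit [DecidableEq ι] in
theorem lowRank_subset (s : Finset ι) (k : ℕ) (r : ι → ℝ) : lowRank s k r ⊆ s :=
  Finset.filter_subset _ _

omit [DecidableEq ι] in
theorem lowRank_mono (s : Finset ι) {k l : ℕ} (hkl : k ≤ l) (r : ι → ℝ) :
    lowRank s k r ⊆ lowRank s l r := by
  intro i hi
  rw [mem_lowRank] at hi ⊢
  exact ⟨hi.1, hi.2.trans_le hkl⟩

/-- If `r j < r i`, then `j` and the at least `k` indices below it all lie below `i`, which gives `k
+ 1` of them. Ties are harmless here. -/
theorem lt_of_mem_lowRank_of_notMem {s : Finset ι} {k : ℕ} {r : ι → ℝ} {i j : ι}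
    (hi : i ∈ lowRank s (k + 1) r) (hjs : j ∈ s) (hj : j ∉ lowRank s k r) : r i ≤ r j := by
  by_contra! hlt
  rw [mem_lowRank] at hi hj
  have hj' : k ≤ (s.filter (fun l => r l < r j)).card := by
    by_contra! h; exact hj ⟨hjs, h⟩
  have hsub : insert j (s.filter (fun l => r l < r j)) ⊆ s.filter (fun l => r l < r i) := by
    intro l hl
    rcases Finset.mem_insert.1 hl with rfl | hl
    · simp [hjs, hlt]
    · rw [Finset.mem_filter] at hl ⊢
      exact ⟨hl.1, hl.2.trans hlt⟩
  have hc := Finset.card_le_card hsub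
  rw [Finset.card_insert_of_notMem (by simp)] at hc
  omega

theorem lowRank_succ_eq_union {s : Finset ι} {k : ℕ} {r : ι → ℝ} (hr : Set.InjOn r s)
    (hk : k + 1 ≤ s.card) (hc : (lowRank s k r).card = k) :
    ∃ l ∈ s, l ∉ lowRank s k r ∧ lowRank s (k + 1) r = insert l (lowRank s k r) := by
  have hne : (s \ lowRank s k r).Nonempty := by
    rw [← Finset.card_pos, Finset.card_sdiff_of_subset (lowRank_subset s k r)]
    omega
  -- The new index is a minimiser of `r` outside the first `k`: everything below it already has rank
  -- at most `k`. Injectivity makes it unique.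
  obtain ⟨l, hl, hmin⟩ := Finset.exists_min_image _ r hne
  rw [Finset.mem_sdiff] at hl
  have hlmem : l ∈ lowRank s (k + 1) r := by
    rw [mem_lowRank]
    refine ⟨hl.1, ?_⟩
    have : s.filter (fun j => r j < r l) ⊆ lowRank s k r := by
      intro j hj
      rw [Finset.mem_filter] at hj
      by_contra hjn
      exact absurd (hmin j (Finset.mem_sdiff.2 ⟨hj.1, hjn⟩)) (not_le.2 hj.2)
    have := Finset.card_le_card this
    omega
  refine ⟨l, hl.1, hl.2, Finset.Subset.antisymm ?_ ?_⟩
  · intro i hi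
    rw [Finset.mem_insert]
    by_contra! h
    have hi_s := lowRank_subset _ _ _ hi
    have h1 := lt_of_mem_lowRank_of_notMem hi hl.1 hl.2
    have h2 := lt_of_mem_lowRank_of_notMem hlmem hi_s h.2
    exact h.1 (hr hi_s hl.1 (le_antisymm h1 h2))
  · rw [Finset.insert_subset_iff]
    exact ⟨hlmem, lowRank_mono s (Nat.le_succ k) r⟩

theorem card_lowRank {s : Finset ι} {k : ℕ} {r : ι → ℝ} (hr : Set.InjOn r s)
    (hk : k ≤ s.card) : (lowRank s k r).card = k := by
  induction k with
  | zero => simp [lowRank]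
  | succ k ih =>
    obtain ⟨l, -, hl, h⟩ := lowRank_succ_eq_union hr hk (ih (by omega))
    rw [h, Finset.card_insert_of_notMem hl, ih (by omega)]

omit [DecidableEq ι] in
theorem card_lowRank_le [DecidableEq ι] {s : Finset ι} {k : ℕ} {r : ι → ℝ}
    (hr : Set.InjOn r s) : (lowRank s k r).card ≤ k := by
  rcases le_or_gt k s.card with h | h
  · exact (card_lowRank hr h).le
  · exact (Finset.card_le_card (lowRank_subset s k r)).trans h.le

/-- An index above `i` has the `k` indices below `i` beneath it even after `i` is deleted, so it
stays excluded; the counts of the other indices do not involve `i`. -/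
theorem lowRank_erase_of_notMem {s : Finset ι} {k : ℕ} {r : ι → ℝ} {i : ι} (his : i ∈ s)
    (hi : i ∉ lowRank s k r) : lowRank (s.erase i) k r = lowRank s k r := by
  have hi' : k ≤ (s.filter (fun j => r j < r i)).card := by
    by_contra! h; exact hi (mem_lowRank.2 ⟨his, h⟩)
  ext l
  rw [mem_lowRank, mem_lowRank, Finset.filter_erase, Finset.mem_erase]
  by_cases hli : l = i
  · subst hli
    simp only [ne_eq, not_true_eq_false, false_and, false_iff, not_and, not_lt]
    exact fun _ => hi'
  · by_cases hlt : r i < r l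
    · have hcard : k ≤ ((s.filter (fun j => r j < r l)).erase i).card := by
        refine hi'.trans (Finset.card_le_card ?_)
        intro j hj
        rw [Finset.mem_filter] at hj
        rw [Finset.mem_erase, Finset.mem_filter]
        exact ⟨fun h => by simp [h] at hj, hj.1, hj.2.trans hlt⟩
      have hcard2 := hcard.trans (Finset.card_le_card (Finset.erase_subset _ _))
      constructor
      · rintro ⟨-, h⟩; omega
      · rintro ⟨-, h⟩; omega
    · rw [Finset.erase_eq_of_notMem (by simp [hlt])]
      simp [hli]

/-- Deleting one of the first `k` indices promotes the index of rank `k + 1` and nothing else. One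
inclusion together with equality of cardinalities suffices. -/
theorem lowRank_erase_of_mem {s : Finset ι} {k : ℕ} {r : ι → ℝ} {i : ι} (hr : Set.InjOn r s)
    (hk : k + 1 ≤ s.card) (hi : i ∈ lowRank s k r) :
    lowRank (s.erase i) k r = (lowRank s (k + 1) r).erase i := by
  have his := lowRank_subset _ _ _ hi
  have hcards : (s.erase i).card = s.card - 1 := Finset.card_erase_of_mem his
  symm
  apply Finset.eq_of_subset_of_card_le
  · intro l hl
    rw [Finset.mem_erase] at hl
    have hls := lowRank_subset _ _ _ hl.2
    rw [mem_lowRank, Finset.mem_erase, Finset.filter_erase]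
    refine ⟨⟨hl.1, hls⟩, ?_⟩
    rcases lt_or_ge (r i) (r l) with hlt | hge
    · rw [Finset.card_erase_of_mem (by simp [his, hlt])]
      have := (mem_lowRank.1 hl.2).2
      have h0 : 0 < (s.filter (fun j => r j < r l)).card :=
        Finset.card_pos.2 ⟨i, by simp [his, hlt]⟩
      omega
    · have hlt : r l < r i := lt_of_le_of_ne hge fun h => hl.1 (hr hls his h)
      rw [Finset.erase_eq_of_notMem (by simp [hge])]
      refine (Finset.card_le_card ?_).trans_lt (mem_lowRank.1 hi).2
      intro j hj
      rw [Finset.mem_filter] at hj ⊢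
      exact ⟨hj.1, hj.2.trans hlt⟩
  · rw [card_lowRank (hr.mono (by simp)) (by omega), Finset.card_erase_of_mem
      (lowRank_mono s (Nat.le_succ k) r hi), card_lowRank hr hk]
    omega

/-- Deleting one index changes a sum over the `k` lowest-ranked indices by the difference of two
terms of rank at most `k + 1`. -/
theorem abs_sum_lowRank_sub_sum_erase_le {s : Finset ι} {k : ℕ} {r : ι → ℝ} {i : ι}
    (hr : Set.InjOn r s) (hk : k + 1 ≤ s.card) (his : i ∈ s) (f : ι → ℝ) {C : ℝ}
    (hf : ∀ l ∈ lowRank s (k + 1) r, |f l| ≤ C) :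
    |∑ l ∈ lowRank s k r, f l - ∑ l ∈ lowRank (s.erase i) k r, f l|
      ≤ if i ∈ lowRank s k r then 2 * C else 0 := by
  split_ifs with hi
  · obtain ⟨l, hls, hl, hu⟩ := lowRank_succ_eq_union hr hk (card_lowRank hr (by omega))
    rw [lowRank_erase_of_mem hr hk hi]
    have hi' := lowRank_mono s (Nat.le_succ k) r hi
    have h1 := Finset.sum_erase_add (lowRank s (k + 1) r) f hi'
    have h2 : ∑ l ∈ lowRank s (k + 1) r, f l = f l + ∑ l ∈ lowRank s k r, f l := by
      rw [hu, Finset.sum_insert hl]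
    have h3 := hf i hi'
    have h4 := hf l (by rw [hu]; exact Finset.mem_insert_self _ _)
    have : ∑ l ∈ lowRank s k r, f l - ∑ l ∈ (lowRank s (k + 1) r).erase i, f l = f i - f l := by
      linarith
    rw [this]
    refine (abs_sub _ _).trans ?_
    linarith
  · rw [lowRank_erase_of_notMem his hi]
    simp

/-- A value of rank at most `k + 1` is dominated by the mean of the values of rank
`k + 1, …, 2 k`. -/
theorem mul_le_sum_lowRank_two_mul {s : Finset ι} {k : ℕ} {r : ι → ℝ} {i : ι}
    (hr : Set.InjOn r s) (hk : 2 * k ≤ s.card) (hi : i ∈ lowRank s (k + 1) r)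
    {φ : ℝ → ℝ} (hφ : MonotoneOn φ (Set.Ici 0)) (hφ0 : ∀ x, 0 ≤ x → 0 ≤ φ x) (hr0 : ∀ j, 0 ≤ r j) :
    k * φ (r i) ≤ ∑ j ∈ lowRank s (2 * k) r, φ (r j) := by
  have hsub : lowRank s k r ⊆ lowRank s (2 * k) r := lowRank_mono s (by omega) r
  have hcard : (lowRank s (2 * k) r \ lowRank s k r).card = k := by
    rw [Finset.card_sdiff_of_subset hsub, card_lowRank hr hk, card_lowRank hr (by omega)]
    omega
  calc (k : ℝ) * φ (r i) = ∑ j ∈ lowRank s (2 * k) r \ lowRank s k r, φ (r i) := by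
        rw [Finset.sum_const, hcard, nsmul_eq_mul]
    _ ≤ ∑ j ∈ lowRank s (2 * k) r \ lowRank s k r, φ (r j) := by
        refine Finset.sum_le_sum fun j hj => hφ (hr0 i) (hr0 j) ?_
        rw [Finset.mem_sdiff] at hj
        exact lt_of_mem_lowRank_of_notMem hi (lowRank_subset _ _ _ hj.1) hj.2
    _ ≤ _ := Finset.sum_le_sum_of_subset_of_nonneg Finset.sdiff_subset
        fun j _ _ => hφ0 _ (hr0 j)

omit [DecidableEq ι] in
-- Translates the order-statistic radius into ranks. No injectivity is needed: tied indices are kept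
-- or dropped together on both sides.
theorem le_sInf_iff_mem_lowRank {s : Finset ι} {k : ℕ} {r : ι → ℝ} (hk : 1 ≤ k)
    (hks : k ≤ s.card) {i : ι} (hi : i ∈ s) :
    r i ≤ sInf {t : ℝ | k ≤ (s.filter (fun j => r j ≤ t)).card} ↔ i ∈ lowRank s k r := by
  have hsne : s.Nonempty := Finset.card_pos.1 (by omega)
  have hne : {t : ℝ | k ≤ (s.filter (fun j => r j ≤ t)).card}.Nonempty := by
    refine ⟨s.sup' hsne r, ?_⟩
    rw [Set.mem_ofPred_eq, Finset.filter_true_of_mem]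
    · exact hks
    · exact fun j hj => Finset.le_sup' r hj
  have hbdd : BddBelow {t : ℝ | k ≤ (s.filter (fun j => r j ≤ t)).card} := by
    refine ⟨s.inf' hsne r, fun t ht => ?_⟩
    have hc : 0 < (s.filter (fun j => r j ≤ t)).card := lt_of_lt_of_le hk ht
    obtain ⟨j, hj⟩ := Finset.card_pos.1 hc
    rw [Finset.mem_filter] at hj
    exact (Finset.inf'_le r hj.1).trans hj.2
  rw [le_csInf_iff hbdd hne, mem_lowRank]
  constructor
  · intro h
    refine ⟨hi, ?_⟩
    by_contra! hc
    have hne' : (s.filter (fun j => r j < r i)).Nonempty := Finset.card_pos.1 (by omega)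
    -- If `k` values were below `r i`, their maximum would be an admissible threshold strictly
    -- smaller than `r i`.
    have := h ((s.filter (fun j => r j < r i)).sup' hne' r) (by
      rw [Set.mem_ofPred_eq]
      refine hc.trans (Finset.card_le_card ?_)
      intro j hj
      rw [Finset.mem_filter]
      exact ⟨(Finset.mem_filter.1 hj).1, Finset.le_sup' r hj⟩)
    refine absurd this (not_le.2 ?_)
    rw [Finset.sup'_lt_iff]
    exact fun j hj => (Finset.mem_filter.1 hj).2
  · rintro ⟨-, h⟩ t ht
    by_contra! hlt
    have : k ≤ (s.filter (fun j => r j < r i)).card := by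
      refine le_trans ht (Finset.card_le_card ?_)
      intro j hj
      rw [Finset.mem_filter] at hj ⊢
      exact ⟨hj.1, hj.2.trans_lt hlt⟩
    omega

end LowRank

/-! ### Binomial tails, their moments and Gamma function asymptotics -/

/-- The probability that a binomial variable with parameters `N` and `u` is less than `k`. -/
noncomputable def binTail (N k : ℕ) (u : ℝ) : ℝ :=
  ∑ l ∈ Finset.range k, (N.choose l : ℝ) * u ^ l * (1 - u) ^ (N - l)

theorem continuous_binTail (N k : ℕ) : Continuous (binTail N k) := by
  unfold binTail; fun_prop

theorem binTail_nonneg (N k : ℕ) {u : ℝ} (h0 : 0 ≤ u) (h1 : u ≤ 1) : 0 ≤ binTail N k u :=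
  Finset.sum_nonneg fun l _ => by have := sub_nonneg.2 h1; positivity

/-- The `s`-th moment of the density proportional to `binTail N k` on `[0, 1]`. -/
noncomputable def tailMoment (N k : ℕ) (s : ℝ) : ℝ :=
  ((N + 1 : ℕ) : ℝ) / k * ∫ u in (0 : ℝ)..1, u ^ s * binTail N k u

/-- The mean over `1 ≤ l ≤ k` of `Γ(l + s) / Γ(l)`. -/
noncomputable def gammaMean (k : ℕ) (s : ℝ) : ℝ :=
  (k : ℝ)⁻¹ * ∑ l ∈ Finset.Icc 1 k, Real.Gamma ((l : ℝ) + s) / Real.Gamma (l : ℝ)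

theorem integral_rpow_mul_one_sub_rpow {α β : ℝ} (hα : 0 < α) (hβ : 0 < β) :
    ∫ u in (0 : ℝ)..1, u ^ (α - 1) * (1 - u) ^ (β - 1) = beta α β := by
  rw [beta_eq_betaIntegralReal _ _ hα hβ, Complex.betaIntegral,
    intervalIntegral.integral_of_le zero_le_one, intervalIntegral.integral_of_le zero_le_one,
    ← RCLike.re_to_complex, ← integral_re]
  · refine setIntegral_congr_fun measurableSet_Ioc fun x ⟨hx1, hx2⟩ ↦ ?_
    norm_cast
    rw [← Complex.ofReal_cpow, ← Complex.ofReal_cpow, RCLike.re_to_complex,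
      Complex.re_mul_ofReal, Complex.ofReal_re]
    all_goals linarith
  · have := Complex.betaIntegral_convergent (u := (α : ℂ)) (v := (β : ℂ)) (by simpa) (by simpa)
    rwa [intervalIntegrable_iff_integrableOn_Ioc_of_le zero_le_one, IntegrableOn] at this

theorem integral_rpow_mul_pow_mul_one_sub_pow {s : ℝ} (hs : 0 ≤ s) (a b : ℕ) :
    ∫ u in (0 : ℝ)..1, u ^ s * (u ^ a * (1 - u) ^ b) = beta (a + 1 + s) (b + 1) := by
  rw [← integral_rpow_mul_one_sub_rpow (by positivity) (by positivity),
    intervalIntegral.integral_of_le zero_le_one, intervalIntegral.integral_of_le zero_le_one]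
  refine setIntegral_congr_fun measurableSet_Ioc fun x ⟨hx1, hx2⟩ ↦ ?_
  rw [add_sub_cancel_right, Real.rpow_natCast, ← mul_assoc,
    ← Real.rpow_natCast x a, ← Real.rpow_add hx1]
  congr 2
  ring

theorem intervalIntegrable_rpow_mul_binTail (N k : ℕ) {s : ℝ} (hs : 0 ≤ s) :
    IntervalIntegrable (fun u => u ^ s * binTail N k u) volume 0 1 :=
  Continuous.intervalIntegrable
    ((Real.continuous_rpow_const hs).mul (continuous_binTail N k)) _ _

/-- Each binomial term integrates to a Beta function. In `Γ(l+1+s) Γ(N-l+1) / Γ(N+2+s)` the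
denominator is the same for all `l`, and the binomial coefficient turns the rest into
`Γ(l+1+s)/Γ(l+1)`; shifting `l` by one gives `gammaMean`. The condition `k ≤ N + 1` ensures `l ≤ N`
in every term. -/
theorem tailMoment_eq {N k : ℕ} (hk : k ≤ N + 1) {s : ℝ} (hs : 0 ≤ s) :
    tailMoment N k s =
      gammaMean k s * (Real.Gamma ((N + 1 : ℕ) + 1) / Real.Gamma ((N + 1 : ℕ) + 1 + s)) := by
  have hint : ∫ u in (0 : ℝ)..1, u ^ s * binTail N k u
      = ∑ l ∈ Finset.range k, (N.choose l : ℝ) * beta (l + 1 + s) ((N - l : ℕ) + 1) := by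
    simp_rw [binTail, Finset.mul_sum]
    rw [intervalIntegral.integral_finsetSum]
    · refine Finset.sum_congr rfl fun l _ => ?_
      rw [← integral_rpow_mul_pow_mul_one_sub_pow hs, ← intervalIntegral.integral_const_mul]
      congr 1; ext u; ring
    · intro l _
      apply Continuous.intervalIntegrable
      exact (Real.continuous_rpow_const hs).mul (by fun_prop)
  rw [tailMoment, hint, gammaMean, div_eq_inv_mul, mul_assoc, mul_assoc, Finset.mul_sum,
    Finset.sum_mul]
  congr 1
  rw [Finset.range_eq_Ico]
  refine Eq.trans ?_ (Finset.sum_Ico_add' (fun l : ℕ => Real.Gamma ((l : ℝ) + s) /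
    Real.Gamma (l : ℝ) * (Real.Gamma ((N + 1 : ℕ) + 1) / Real.Gamma ((N + 1 : ℕ) + 1 + s))) 0 k 1)
  refine Finset.sum_congr rfl fun l hl => ?_
  have hlN : l ≤ N := by have := (Finset.mem_Ico.1 hl).2; omega
  have hfac := Nat.choose_mul_factorial_mul_factorial hlN
  have hfac' : (N.choose l : ℝ) * (l.factorial : ℝ) * ((N - l).factorial : ℝ) = N.factorial := by
    exact_mod_cast hfac
  have hsum : ((l : ℝ) + 1 + s + ((N - l : ℕ) + 1)) = ((N + 1 : ℕ) : ℝ) + 1 + s := by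
    push_cast [Nat.cast_sub hlN]; ring
  rw [beta, hsum, Real.Gamma_nat_eq_factorial, Real.Gamma_nat_eq_factorial, Nat.cast_add_one l,
    Real.Gamma_nat_eq_factorial, Nat.factorial_succ, Nat.cast_mul, ← hfac']
  have : (l.factorial : ℝ) ≠ 0 := by positivity
  have : Real.Gamma (((N + 1 : ℕ) : ℝ) + 1 + s) ≠ 0 := (Real.Gamma_pos_of_pos (by positivity)).ne'
  field_simp

theorem Gamma_add_three {x : ℝ} (hx : 0 < x) :
    Real.Gamma (x + 3) = x * (x + 1) * (x + 2) * Real.Gamma x := by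
  rw [show x + 3 = x + 1 + 1 + 1 by ring, Real.Gamma_add_one (by positivity),
    Real.Gamma_add_one (by positivity), Real.Gamma_add_one hx.ne']
  ring

theorem gammaMean_zero {k : ℕ} (hk : 1 ≤ k) : gammaMean k 0 = 1 := by
  rw [gammaMean, Finset.sum_congr rfl (g := fun _ => (1 : ℝ))]
  · have : (k : ℝ) ≠ 0 := by positivity
    simp [this]
  · intro l hl
    have : (0 : ℝ) < l := by exact_mod_cast (Finset.mem_Icc.1 hl).1
    rw [add_zero, div_self (Real.Gamma_pos_of_pos this).ne']

theorem tailMoment_zero {N k : ℕ} (hk : 1 ≤ k) (hkN : k ≤ N + 1) : tailMoment N k 0 = 1 := by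
  rw [tailMoment_eq hkN le_rfl, gammaMean_zero hk, add_zero, div_self, one_mul]
  exact (Real.Gamma_pos_of_pos (by positivity)).ne'

theorem tailMoment_three_le {N k : ℕ} (hk : 1 ≤ k) (hkN : k ≤ N + 1) :
    tailMoment N k 3 ≤ 6 * ((k : ℝ) / (N + 1 : ℕ)) ^ 3 := by
  rw [tailMoment_eq hkN (by norm_num)]
  set n : ℝ := ((N + 1 : ℕ) : ℝ) with hn
  have hn0 : 0 < n := by positivity
  have hk1 : (1 : ℝ) ≤ k := by exact_mod_cast hk
  have h1 : gammaMean k 3 ≤ 6 * (k : ℝ) ^ 3 := by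
    rw [gammaMean, inv_mul_le_iff₀ (by positivity)]
    calc _ ≤ ∑ l ∈ Finset.Icc 1 k, 6 * (k : ℝ) ^ 3 := by
          refine Finset.sum_le_sum fun l hl => ?_
          -- The constant `6` is `1 · 2 · 3`, from `l (l+1) (l+2) ≤ k · 2k · 3k`.
          obtain ⟨hl1, hl2⟩ := Finset.mem_Icc.1 hl
          have hl0 : (0 : ℝ) < l := by exact_mod_cast hl1
          have hlk : (l : ℝ) ≤ k := by exact_mod_cast hl2
          rw [Gamma_add_three hl0, mul_div_cancel_right₀ _ (Real.Gamma_pos_of_pos hl0).ne']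
          have : (l : ℝ) * (l + 1) * (l + 2) ≤ k * (2 * k) * (3 * k) := by
            gcongr <;> linarith
          linarith [this]
      _ = _ := by simp
  have h2 : Real.Gamma (n + 1) / Real.Gamma (n + 1 + 3) ≤ (n ^ 3)⁻¹ := by
    have hG := Real.Gamma_pos_of_pos (show 0 < n + 1 by linarith)
    rw [Gamma_add_three (by positivity), div_le_iff₀ (by positivity), ← mul_assoc]
    refine le_mul_of_one_le_left hG.le ?_
    rw [inv_mul_eq_div, one_le_div (by positivity)]
    calc n ^ 3 = n * n * n := by ring
      _ ≤ _ := by gcongr <;> linarith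
  calc _ ≤ 6 * (k : ℝ) ^ 3 * (n ^ 3)⁻¹ := by
        gcongr
    _ = _ := by rw [div_pow]; ring

/-- Interpolation between the exponents `0` and `3`: below the threshold `t` the first term
dominates, above it the second. -/
theorem rpow_le_rpow_add_rpow {s t u : ℝ} (hs : 0 ≤ s) (hs3 : s ≤ 3) (ht : 0 < t) (hu : 0 ≤ u) :
    u ^ s ≤ t ^ s * u ^ (0 : ℝ) + t ^ (s - 3) * u ^ (3 : ℝ) := by
  rw [Real.rpow_zero, mul_one]
  rcases le_total u t with h | h
  · have := Real.rpow_le_rpow hu h hs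
    have : 0 ≤ t ^ (s - 3) * u ^ (3 : ℝ) := by positivity
    linarith
  · have hu0 : 0 < u := ht.trans_le h
    have h1 : u ^ (s - 3) ≤ t ^ (s - 3) :=
      Real.rpow_le_rpow_of_nonpos ht h (by linarith)
    have h2 : u ^ s = u ^ (s - 3) * u ^ (3 : ℝ) := by
      rw [← Real.rpow_add hu0]; congr 1; ring
    have : u ^ (s - 3) * u ^ (3 : ℝ) ≤ t ^ (s - 3) * u ^ (3 : ℝ) := by gcongr
    have : 0 ≤ t ^ s := by positivity
    linarith

/-- Interpolation with threshold `t = k / (N+1)` between total mass `1` and third moment at most `6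
t ^ 3`; hence the constant `7 = 1 + 6`. The range of exponents up to `3` covers `1 + 2 / d` for
every `d ≥ 1`, as the variance bound requires. -/
theorem tailMoment_le {N k : ℕ} (hk : 1 ≤ k) (hkN : k ≤ N + 1) {s : ℝ} (hs : 0 ≤ s)
    (hs3 : s ≤ 3) : tailMoment N k s ≤ 7 * ((k : ℝ) / (N + 1 : ℕ)) ^ s := by
  set t : ℝ := (k : ℝ) / (N + 1 : ℕ) with ht
  have ht0 : 0 < t := by positivity
  have hle : tailMoment N k s ≤ t ^ s * tailMoment N k 0 + t ^ (s - 3) * tailMoment N k 3 := by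
    have h3 : (0 : ℝ) ≤ 3 := by norm_num
    have : ∫ u in (0 : ℝ)..1, u ^ s * binTail N k u ≤
        ∫ u in (0 : ℝ)..1, (t ^ s * (u ^ (0 : ℝ) * binTail N k u) +
          t ^ (s - 3) * (u ^ (3 : ℝ) * binTail N k u)) := by
      refine intervalIntegral.integral_mono_on zero_le_one
        (intervalIntegrable_rpow_mul_binTail N k hs)
        (((intervalIntegrable_rpow_mul_binTail N k le_rfl).const_mul _).add
          ((intervalIntegrable_rpow_mul_binTail N k h3).const_mul _)) fun u hu => ?_
      have := mul_le_mul_of_nonneg_right (rpow_le_rpow_add_rpow hs hs3 ht0 hu.1)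
        (binTail_nonneg N k hu.1 hu.2)
      linarith
    rw [intervalIntegral.integral_add
      ((intervalIntegrable_rpow_mul_binTail N k le_rfl).const_mul _)
      ((intervalIntegrable_rpow_mul_binTail N k h3).const_mul _),
      intervalIntegral.integral_const_mul, intervalIntegral.integral_const_mul] at this
    have hc : (0 : ℝ) ≤ ((N + 1 : ℕ) : ℝ) / k := by positivity
    have := mul_le_mul_of_nonneg_left this hc
    unfold tailMoment
    linarith
  rw [tailMoment_zero hk hkN] at hle
  have h3 : t ^ (s - 3) * tailMoment N k 3 ≤ t ^ (s - 3) * (6 * t ^ 3) := by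
    gcongr; exact tailMoment_three_le hk hkN
  have h4 : t ^ (s - 3) * t ^ 3 = t ^ s := by
    rw [← Real.rpow_natCast t 3, ← Real.rpow_add ht0]; congr 1; push_cast; ring
  linarith

theorem tailMoment_nonneg (N k : ℕ) (s : ℝ) : 0 ≤ tailMoment N k s := by
  refine mul_nonneg (by positivity) (intervalIntegral.integral_nonneg zero_le_one fun u hu => ?_)
  exact mul_nonneg (Real.rpow_nonneg hu.1 _) (binTail_nonneg N k hu.1 hu.2)

theorem prod_add_mul_Gamma {s : ℝ} (hs : 0 < s) (m : ℕ) :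
    (∏ j ∈ Finset.range m, (s + j)) * Real.Gamma s = Real.Gamma (s + m) := by
  induction m with
  | zero => simp
  | succ m ih =>
    rw [Finset.prod_range_succ, mul_right_comm, ih, Nat.cast_succ, ← add_assoc,
      Real.Gamma_add_one (by positivity), mul_comm]

/-- This is Euler's limit formula for `Γ(s)`, divided by `Γ(s)`. -/
theorem tendsto_rpow_mul_Gamma_div_Gamma {s : ℝ} (hs : 0 < s) :
    Tendsto (fun n : ℕ => (n : ℝ) ^ s * (Real.Gamma ((n : ℝ) + 1) / Real.Gamma ((n : ℝ) + 1 + s)))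
      atTop (𝓝 1) := by
  have hG := Real.Gamma_pos_of_pos hs
  have := (Real.GammaSeq_tendsto_Gamma s).div_const (Real.Gamma s)
  rw [div_self hG.ne'] at this
  refine this.congr fun n => ?_
  have h1 : Real.Gamma ((n : ℝ) + 1 + s) = (∏ j ∈ Finset.range (n + 1), (s + j)) * Real.Gamma s := by
    rw [prod_add_mul_Gamma hs]; congr 1; push_cast; ring
  rw [h1, Real.GammaSeq, Real.Gamma_nat_eq_factorial]
  have : ∏ j ∈ Finset.range (n + 1), (s + j) ≠ 0 :=
    (Finset.prod_pos fun j _ => by positivity).ne'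
  field_simp

theorem gammaMean_nonneg (k : ℕ) {s : ℝ} (hs : 0 ≤ s) : 0 ≤ gammaMean k s := by
  refine mul_nonneg (by positivity) (Finset.sum_nonneg fun l _ => ?_)
  exact div_nonneg (Real.Gamma_nonneg_of_nonneg (by positivity))
    (Real.Gamma_nonneg_of_nonneg (by positivity))

/-- With `k` fixed, let the sample size tend to infinity in `tailMoment_le`; the ratio of Gamma
functions tends to one and only `gammaMean` remains. -/
theorem gammaMean_le {k : ℕ} (hk : 1 ≤ k) {s : ℝ} (hs : 0 < s) (hs3 : s ≤ 3) :
    gammaMean k s ≤ 7 * (k : ℝ) ^ s := by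
  have h := (tendsto_rpow_mul_Gamma_div_Gamma hs).const_mul (gammaMean k s)
  rw [mul_one] at h
  refine le_of_tendsto h ?_
  filter_upwards [eventually_ge_atTop k] with n hn
  obtain ⟨N, rfl⟩ : ∃ N, n = N + 1 := ⟨n - 1, by omega⟩
  have h1 := tailMoment_le hk hn hs.le hs3
  rw [tailMoment_eq hn hs.le, Real.div_rpow (by positivity) (by positivity),
    ← mul_div_assoc (7 : ℝ), le_div_iff₀ (by positivity)] at h1
  linarith

/-- The moments of the truncated binomial density agree with their Gamma-function asymptotics. -/
theorem isLittleO_tailMoment_sub {k : ℕ → ℕ} (hk : ∀ n, 1 ≤ n → 1 ≤ k n ∧ k n ≤ n) {s : ℝ}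
    (hs : 0 < s) (hs3 : s ≤ 3) :
    (fun n : ℕ => tailMoment (n - 1) (k n) s - gammaMean (k n) s * (n : ℝ) ^ (-s)) =o[atTop]
      (fun n : ℕ => ((k n : ℝ) / n) ^ s) := by
  -- The relative error is a function of `n` alone, hence small whatever the sequence `k` is.
  have h0 : (fun n : ℕ => (n : ℝ) ^ s *
      (Real.Gamma ((n : ℝ) + 1) / Real.Gamma ((n : ℝ) + 1 + s)) - 1) =o[atTop]
      (fun _ : ℕ => (1 : ℝ)) := by
    rw [isLittleO_one_iff]
    simpa using (tendsto_rpow_mul_Gamma_div_Gamma hs).sub_const 1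
  have h1 : (fun n : ℕ => gammaMean (k n) s * (n : ℝ) ^ (-s)) =O[atTop]
      (fun n : ℕ => ((k n : ℝ) / n) ^ s) := by
    refine IsBigO.of_bound 7 ?_
    filter_upwards [eventually_ge_atTop 1] with n hn
    rw [Real.norm_of_nonneg (mul_nonneg (gammaMean_nonneg _ hs.le) (by positivity)),
      Real.norm_of_nonneg (by positivity), Real.div_rpow (by positivity) (by positivity),
      Real.rpow_neg (by positivity), div_eq_mul_inv, ← mul_assoc]
    gcongr
    exact gammaMean_le (hk n hn).1 hs hs3
  have h2 := h1.mul_isLittleO h0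
  simp only [mul_one] at h2
  refine h2.congr' ?_ EventuallyEq.rfl
  filter_upwards [eventually_ge_atTop 1] with n hn
  obtain ⟨N, rfl⟩ : ∃ N, n = N + 1 := ⟨n - 1, by omega⟩
  rw [Nat.add_sub_cancel, tailMoment_eq (hk _ hn).2 hs.le, Real.rpow_neg (by positivity)]
  have : ((N + 1 : ℕ) : ℝ) ^ s ≠ 0 := by positivity
  field_simp

/-! ### The probability integral transform -/

theorem continuous_cdf (ν : Measure ℝ) [IsProbabilityMeasure ν] [NullSingletonClass ν] :
    Continuous (cdf ν) := by
  rw [continuous_iff_continuousAt]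
  intro x
  rw [(cdf ν).mono.continuousAt_iff_leftLim_eq_rightLim, StieltjesFunction.rightLim_eq]
  have h := (cdf ν).measure_singleton x
  rw [measure_cdf, measure_singleton] at h
  have h1 := ENNReal.ofReal_eq_zero.1 h.symm
  exact le_antisymm ((cdf ν).mono.leftLim_le le_rfl) (by linarith)

theorem map_cdf_eq_volume (ν : Measure ℝ) [IsProbabilityMeasure ν] [NullSingletonClass ν] :
    ν.map (cdf ν) = volume.restrict (Set.Ioc 0 1) := by
  have hcont := continuous_cdf ν
  have : IsProbabilityMeasure (ν.map (cdf ν)) :=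
    Measure.isProbabilityMeasure_map hcont.measurable.aemeasurable
  refine Measure.ext_of_Iic _ _ fun u => ?_
  rw [Measure.map_apply hcont.measurable measurableSet_Iic, Measure.restrict_apply measurableSet_Iic]
  rcases lt_or_ge u 0 with hu0 | hu0
  · have h1 : cdf ν ⁻¹' Set.Iic u = ∅ := by
      ext r
      simp only [Set.mem_preimage, Set.mem_Iic, Set.mem_empty_iff_false, iff_false, not_le]
      exact hu0.trans_le (cdf_nonneg ν r)
    have h2 : Set.Iic u ∩ Set.Ioc (0 : ℝ) 1 = ∅ := by
      ext r
      simp only [Set.mem_inter_iff, Set.mem_Iic, Set.mem_Ioc, Set.mem_empty_iff_false, iff_false]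
      intro h; linarith [h.1, h.2.1]
    rw [h1, h2, measure_empty, measure_empty]
  rcases le_or_gt 1 u with hu1 | hu1
  · have h1 : cdf ν ⁻¹' Set.Iic u = Set.univ := by
      ext r
      simpa using (cdf_le_one ν r).trans hu1
    have h2 : Set.Iic u ∩ Set.Ioc (0 : ℝ) 1 = Set.Ioc 0 1 :=
      Set.inter_eq_right.2 fun r hr => hr.2.trans hu1
    rw [h1, h2, measure_univ, Real.volume_Ioc]; simp
  have h2 : Set.Iic u ∩ Set.Ioc (0 : ℝ) 1 = Set.Ioc 0 u := by
    ext r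
    simp only [Set.mem_inter_iff, Set.mem_Iic, Set.mem_Ioc]
    constructor
    · rintro ⟨h, h', -⟩; exact ⟨h', h⟩
    · rintro ⟨h', h⟩; exact ⟨h, h', by linarith⟩
  rw [h2, Real.volume_Ioc, sub_zero]
  -- For `0 ≤ u < 1` the sublevel set of the distribution function is either empty, which forces `u
  -- = 0` because the function tends to `0` at `-∞`, or a half-line `Iic r`; by continuity its
  -- endpoint satisfies `cdf ν r = u`.
  rcases (cdf ν ⁻¹' Set.Iic u).eq_empty_or_nonempty with he | hne
  · have : u ≤ 0 := by
      refine ge_of_tendsto (tendsto_cdf_atBot ν) (Eventually.of_forall fun r => ?_)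
      by_contra! h
      have : r ∈ cdf ν ⁻¹' Set.Iic u := h.le
      rw [he] at this; exact this
    rw [he, measure_empty, ENNReal.ofReal_of_nonpos this]
  · obtain ⟨M, hM⟩ := ((tendsto_cdf_atTop ν).eventually (lt_mem_nhds hu1)).exists
    have hbdd : BddAbove (cdf ν ⁻¹' Set.Iic u) := by
      refine ⟨M, fun r hr => ?_⟩
      by_contra! h
      exact absurd ((monotone_cdf ν) h.le) (not_le.2 (lt_of_le_of_lt hr hM))
    have hclosed : IsClosed (cdf ν ⁻¹' Set.Iic u) := isClosed_Iic.preimage hcont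
    set r := sSup (cdf ν ⁻¹' Set.Iic u) with hr
    have hmem : cdf ν r ≤ u := hclosed.csSup_mem hne hbdd
    have hset : cdf ν ⁻¹' Set.Iic u = Set.Iic r := by
      ext t
      constructor
      · intro ht; exact le_csSup hbdd ht
      · intro ht; exact ((monotone_cdf ν) ht).trans hmem
    have hge : u ≤ cdf ν r := by
      refine ge_of_tendsto (hcont.continuousAt.tendsto.mono_left
        (nhdsWithin_le_nhds (s := Set.Ioi r))) ?_
      filter_upwards [self_mem_nhdsWithin] with t ht
      by_contra! h
      exact absurd (le_csSup hbdd (show t ∈ cdf ν ⁻¹' Set.Iic u from h.le)) (not_le.2 ht)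
    rw [hset, ← ofReal_cdf, le_antisymm hmem hge]

/-! ### Distances to a fixed point -/

section Dist

variable {d : ℕ}

theorem nontrivial_E (hd : 1 ≤ d) : Nontrivial (E d) := by
  have : Nonempty (Fin d) := ⟨⟨0, hd⟩⟩
  infer_instance

theorem measure_norm_sub_eq_zero (hd : 1 ≤ d) {P : Measure (E d)} (hP : P ≪ volume) (z : E d)
    (r : ℝ) : P {y | ‖y - z‖ = r} = 0 := by
  have := nontrivial_E hd
  have h := Measure.addHaar_sphere (volume : Measure (E d)) z r
  refine hP ?_
  convert! h using 2

/-- The mass that `P` gives to the open ball of radius `r` centred at `z`. -/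
noncomputable def ballMass (P : Measure (E d)) (z : E d) (r : ℝ) : ℝ := P.real (Metric.ball z r)

variable {P : Measure (E d)} [IsProbabilityMeasure P]

theorem ballMass_nonneg (P : Measure (E d)) (z : E d) (r : ℝ) : 0 ≤ ballMass P z r :=
  measureReal_nonneg

theorem ballMass_le_one (z : E d) (r : ℝ) : ballMass P z r ≤ 1 := measureReal_le_one

theorem ballMass_mono (z : E d) : Monotone (ballMass P z) := fun _ _ h =>
  measureReal_mono (Metric.ball_subset_ball h)

theorem isProbabilityMeasure_map_norm_sub (z : E d) :
    IsProbabilityMeasure (P.map (fun y => ‖y - z‖)) :=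
  Measure.isProbabilityMeasure_map (by fun_prop)

omit [IsProbabilityMeasure P] in
theorem nullSingletonClass_map_norm_sub (hd : 1 ≤ d) (hP : P ≪ volume) (z : E d) :
    NullSingletonClass (P.map (fun y => ‖y - z‖)) := by
  refine ⟨fun r => ?_⟩
  rw [Measure.map_apply (by fun_prop) (measurableSet_singleton r)]
  exact measure_norm_sub_eq_zero hd hP z r

theorem ballMass_eq_cdf (hd : 1 ≤ d) (hP : P ≪ volume) (z : E d) :
    ballMass P z = cdf (P.map (fun y => ‖y - z‖)) := by
  have := isProbabilityMeasure_map_norm_sub (P := P) z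
  have := nullSingletonClass_map_norm_sub hd hP z
  ext r
  rw [cdf_eq_real, ballMass, measureReal_def, measureReal_def, ← Iio_ae_eq_Iic.measure_eq,
    Measure.map_apply (by fun_prop) measurableSet_Iio]
  congr 2

/-- Spheres are null, so the ball mass is the continuous distribution function of the distance to
`z`, and the probability integral transform applies. This frees the moment computations from the
shape of `P`. -/
theorem map_ballMass_norm_sub (hd : 1 ≤ d) (hP : P ≪ volume) (z : E d) :
    P.map (fun y => ballMass P z ‖y - z‖) = volume.restrict (Set.Ioc 0 1) := by
  have := isProbabilityMeasure_map_norm_sub (P := P) z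
  have := nullSingletonClass_map_norm_sub hd hP z
  rw [ballMass_eq_cdf hd hP, ← map_cdf_eq_volume (P.map (fun y => ‖y - z‖)),
    Measure.map_map (monotone_cdf _).measurable (by fun_prop)]
  rfl

theorem measurable_ballMass_norm_sub (z : E d) : Measurable (fun y => ballMass P z ‖y - z‖) :=
  (ballMass_mono z).measurable.comp (by fun_prop)

theorem integral_comp_ballMass (hd : 1 ≤ d) (hP : P ≪ volume) (z : E d) {f : ℝ → ℝ}
    (hf : Continuous f) :
    ∫ y, f (ballMass P z ‖y - z‖) ∂P = ∫ u in (0 : ℝ)..1, f u := by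
  rw [intervalIntegral.integral_of_le zero_le_one, ← map_ballMass_norm_sub hd hP z,
    integral_map (measurable_ballMass_norm_sub z).aemeasurable hf.aestronglyMeasurable]

/-- The weight of a point at `y` in the expected mean over the `k` nearest neighbours of `z` in a
sample of size `N + 1`. -/
noncomputable def nnWeight (P : Measure (E d)) (N k : ℕ) (z y : E d) : ℝ :=
  ((N + 1 : ℕ) : ℝ) / k * binTail N k (ballMass P z ‖y - z‖)

theorem nnWeight_nonneg (N k : ℕ) (z y : E d) : 0 ≤ nnWeight P N k z y :=
  mul_nonneg (by positivity) (binTail_nonneg _ _ (ballMass_nonneg _ _ _) (ballMass_le_one _ _))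

theorem measurable_nnWeight (N k : ℕ) (z : E d) : Measurable (nnWeight P N k z) :=
  ((continuous_binTail N k).measurable.comp (measurable_ballMass_norm_sub z)).const_mul _

theorem exists_nnWeight_le (P : Measure (E d)) [IsProbabilityMeasure P] (N k : ℕ) :
    ∃ C, ∀ z y : E d, nnWeight P N k z y ≤ C := by
  obtain ⟨C, hC⟩ := isCompact_Icc.exists_bound_of_continuousOn (s := Set.Icc (0 : ℝ) 1)
    (continuous_binTail N k).continuousOn
  refine ⟨((N + 1 : ℕ) : ℝ) / k * C, fun z y => ?_⟩
  unfold nnWeight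
  gcongr
  exact (le_abs_self _).trans (hC _ ⟨ballMass_nonneg _ _ _, ballMass_le_one _ _⟩)

theorem integral_rpow_ballMass_mul_nnWeight (hd : 1 ≤ d) (hP : P ≪ volume) (N k : ℕ) (z : E d)
    {s : ℝ} (hs : 0 ≤ s) :
    ∫ y, ballMass P z ‖y - z‖ ^ s * nnWeight P N k z y ∂P = tailMoment N k s := by
  rw [tailMoment, ← integral_comp_ballMass hd hP z (f := fun u => u ^ s * binTail N k u)
    ((Real.continuous_rpow_const hs).mul (continuous_binTail N k)), ← integral_const_mul]
  congr 1; ext y; rw [nnWeight]; ring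

end Dist

/-! ### Nearest neighbours in an i.i.d. sample -/

theorem measurableSet_mem_lowRank {α ι : Type*} [MeasurableSpace α] (s : Finset ι) (k : ℕ)
    {r : α → ι → ℝ} (hr : ∀ j, Measurable fun a => r a j) (i : ι) :
    MeasurableSet {a | i ∈ lowRank s k (r a)} := by
  classical
  have h1 : Measurable fun a => (s.filter (fun j => r a j < r a i)).card := by
    simp_rw [Finset.card_filter]
    refine Finset.measurable_sum _ fun j _ => ?_
    exact Measurable.ite (measurableSet_lt (hr j) (hr i)) measurable_const measurable_const
  by_cases hi : i ∈ s
  · have : {a | i ∈ lowRank s k (r a)} = (fun a => (s.filter (fun j => r a j < r a i)).card) ⁻¹'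
        Set.Iio k := by
      ext a; simp [mem_lowRank, hi]
    rw [this]
    exact h1 measurableSet_Iio
  · have : {a | i ∈ lowRank s k (r a)} = ∅ := by
      ext a; simp [mem_lowRank, hi]
    rw [this]; exact MeasurableSet.empty

/-- The event is the disjoint union, over index sets `T` with fewer than `k` elements, of the boxes
on which `p` holds exactly at the indices in `T`; the mass of a box depends only on the cardinality
of `T`. -/
theorem measureReal_pi_card_lt {α : Type*} [MeasurableSpace α] (P : Measure α)
    [IsProbabilityMeasure P] (N k : ℕ) {p : α → Prop} [DecidablePred p] (hp : MeasurableSet {a | p a}) :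
    (Measure.pi fun _ : Fin N => P).real {x | (Finset.univ.filter (fun j => p (x j))).card < k} =
      binTail N k (P.real {a | p a}) := by
  set A := {a | p a} with hAdef
  set B : Finset (Fin N) → Set (Fin N → α) := fun T => Set.pi Set.univ
    (fun j => if j ∈ T then A else Aᶜ) with hB
  have hmemB : ∀ T x, x ∈ B T ↔ Finset.univ.filter (fun j => p (x j)) = T := by
    intro T x
    simp only [hB, Set.mem_pi, Set.mem_univ, forall_true_left, Finset.ext_iff, Finset.mem_filter,
      Finset.mem_univ, true_and]
    refine forall_congr' fun j => ?_
    split_ifs with h <;> simp [h, hAdef]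
  have hset : {x : Fin N → α | (Finset.univ.filter (fun j => p (x j))).card < k} =
      ⋃ T ∈ Finset.univ.filter (fun T : Finset (Fin N) => T.card < k), B T := by
    ext x
    simp [hmemB]
  rw [hset, measureReal_biUnion_finset]
  · have h1 : ∀ T, (Measure.pi fun _ : Fin N => P).real (B T) =
        P.real A ^ T.card * (1 - P.real A) ^ (N - T.card) := by
      intro T
      rw [measureReal_def, hB, Measure.pi_pi, ENNReal.toReal_prod]
      have : ∀ j, (P (if j ∈ T then A else Aᶜ)).toReal =
          if j ∈ T then P.real A else 1 - P.real A := by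
        intro j
        split_ifs
        · rfl
        · exact probReal_compl_eq_one_sub hp
      simp_rw [this]
      rw [Finset.prod_ite, Finset.prod_const, Finset.prod_const]
      congr 2
      · simp
      · rw [Finset.filter_not, Finset.card_sdiff_of_subset (Finset.filter_subset _ _)]; simp
    simp_rw [h1]
    rw [Finset.sum_filter, ← Finset.powerset_univ, Finset.sum_powerset_apply_card
      (fun m => if m < k then P.real A ^ m * (1 - P.real A) ^ (N - m) else 0), binTail]
    simp only [Finset.card_univ, Fintype.card_fin, nsmul_eq_mul, mul_ite, mul_zero]
    rw [← Finset.sum_filter]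
    -- The two ranges of summation differ only by exponents above `N`, where the binomial
    -- coefficient vanishes.
    have : Finset.filter (fun m => m < k) (Finset.range (N + 1)) =
        Finset.filter (fun m => m < N + 1) (Finset.range k) := by
      ext m; simp [and_comm]
    rw [this, Finset.sum_filter]
    refine Finset.sum_congr rfl fun l _ => ?_
    split_ifs with h
    · ring
    · rw [Nat.choose_eq_zero_of_lt (by omega)]; simp
  · intro T _ T' _ hne
    rw [Function.onFun, Set.disjoint_left]
    intro x hx hx'
    rw [hmemB] at hx hx'
    exact hne (hx.symm.trans hx')
  · intro T _
    refine MeasurableSet.univ_pi fun j => ?_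
    split_ifs
    exacts [hp, hp.compl]

section Sample

variable {d : ℕ} {P : Measure (E d)} [IsProbabilityMeasure P]

omit [IsProbabilityMeasure P] in
theorem mem_lowRank_insertNth {N k : ℕ} (i : Fin (N + 1)) (x : Fin (N + 1) → E d) (z : E d) :
    i ∈ lowRank Finset.univ k (fun j => ‖x j - z‖) ↔
      (Finset.univ.filter (fun j : Fin N => ‖x (i.succAbove j) - z‖ < ‖x i - z‖)).card
        < k := by
  rw [mem_lowRank]
  simp only [Finset.mem_univ, true_and, Finset.card_filter]
  rw [Fin.sum_univ_succAbove _ i]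
  simp

/-- Split off the `i`-th point, located at `y`. It is among the `k` nearest iff fewer than `k` of
the `N` remaining independent points lie in the open ball about `z` through `y`, an event of
probability `binTail N k`. -/
theorem integral_ite_mem_lowRank {N k : ℕ} (z : E d) (φ : E d → ℝ)
    (hφ : Integrable φ P) (i : Fin (N + 1)) :
    ∫ x, (if i ∈ lowRank Finset.univ k (fun j => ‖x j - z‖) then φ (x i) else 0)
        ∂(Measure.pi fun _ : Fin (N + 1) => P) =
      ∫ y, φ y * binTail N k (ballMass P z ‖y - z‖) ∂P := by
  have hmp := measurePreserving_piFinSuccAbove (fun _ : Fin (N + 1) => P) i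
  have hDm : MeasurableSet {q : E d × (Fin N → E d) | (Finset.univ.filter
      (fun j : Fin N => ‖q.2 j - z‖ < ‖q.1 - z‖)).card < k} := by
    have : Measurable fun q : E d × (Fin N → E d) => (Finset.univ.filter
        (fun j : Fin N => ‖q.2 j - z‖ < ‖q.1 - z‖)).card := by
      simp_rw [Finset.card_filter]
      refine Finset.measurable_sum _ fun j _ => ?_
      refine Measurable.ite ?_ measurable_const measurable_const
      exact measurableSet_lt (by fun_prop) (by fun_prop)
    exact this measurableSet_Iio
  obtain ⟨D, hD⟩ : ∃ D : Set (E d × (Fin N → E d)), D = {q | (Finset.univ.filter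
    (fun j : Fin N => ‖q.2 j - z‖ < ‖q.1 - z‖)).card < k} := ⟨_, rfl⟩
  rw [← hD] at hDm
  have hint : Integrable (D.indicator fun q => φ q.1)
      (P.prod (Measure.pi fun _ : Fin N => P)) :=
    (hφ.comp_fst _).indicator hDm
  have h1 : ∀ x : Fin (N + 1) → E d,
      (if i ∈ lowRank Finset.univ k (fun j => ‖x j - z‖) then φ (x i) else 0) =
      D.indicator (fun q => φ q.1) (MeasurableEquiv.piFinSuccAbove (fun _ => E d) i x) := by
    intro x
    have hmem : MeasurableEquiv.piFinSuccAbove (fun _ => E d) i x ∈ D ↔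
        i ∈ lowRank Finset.univ k (fun j => ‖x j - z‖) := by
      rw [mem_lowRank_insertNth, hD]; rfl
    by_cases h : i ∈ lowRank Finset.univ k (fun j => ‖x j - z‖)
    · rw [if_pos h, Set.indicator_of_mem (hmem.2 h)]; rfl
    · rw [if_neg h, Set.indicator_of_notMem (mt hmem.1 h)]
  have h2 : ∫ x, D.indicator (fun q => φ q.1) (MeasurableEquiv.piFinSuccAbove (fun _ => E d) i x)
      ∂(Measure.pi fun _ : Fin (N + 1) => P) =
      ∫ q, D.indicator (fun q => φ q.1) q ∂(P.prod (Measure.pi fun _ : Fin N => P)) :=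
    hmp.integral_comp' _
  simp_rw [h1]
  rw [h2, integral_prod _ hint]
  refine integral_congr_ae (Eventually.of_forall fun y => ?_)
  have hm : MeasurableSet {rest : Fin N → E d | (y, rest) ∈ D} :=
    hDm.preimage (measurable_prodMk_left (x := y))
  have h3 : ∀ rest, D.indicator (fun q => φ q.1) (y, rest) =
      {rest : Fin N → E d | (y, rest) ∈ D}.indicator (fun _ => φ y) rest := fun rest => rfl
  simp only [h3]
  rw [integral_indicator_const _ hm, hD]
  have h4 := measureReal_pi_card_lt P N k (p := fun w => ‖w - z‖ < ‖y - z‖)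
    (measurableSet_lt (by fun_prop) measurable_const)
  have h5 : {a | ‖a - z‖ < ‖y - z‖} = Metric.ball z ‖y - z‖ := by
    ext w; simp [dist_eq_norm]
  rw [h5] at h4
  rw [smul_eq_mul, mul_comm, ballMass, ← h4]
  rfl

theorem integrable_ite_mem_lowRank {N k : ℕ} (z : E d) (φ : E d → ℝ)
    (hφ : Integrable φ P) (i : Fin (N + 1)) :
    Integrable (fun x => if i ∈ lowRank Finset.univ k (fun j => ‖x j - z‖) then φ (x i) else 0)
      (Measure.pi fun _ : Fin (N + 1) => P) := by
  have h1 : Integrable (fun x : Fin (N + 1) → E d => φ (x i))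
      (Measure.pi fun _ : Fin (N + 1) => P) :=
    (measurePreserving_eval (fun _ : Fin (N + 1) => P) i).integrable_comp_of_integrable hφ
  refine (h1.indicator (measurableSet_mem_lowRank Finset.univ k
    (r := fun x : Fin (N + 1) → E d => fun j => ‖x j - z‖) (fun j => by fun_prop) i)).congr
    (Eventually.of_forall fun x => ?_)
  simp only [Set.indicator_apply]; rfl

/-- The expected mean of `φ` over the `k` nearest neighbours of `z`. -/
theorem integral_sum_lowRank {N k : ℕ} (hk : 1 ≤ k) (z : E d) (φ : E d → ℝ)
    (hφ : Integrable φ P) :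
    ∫ x, (k : ℝ)⁻¹ * ∑ i ∈ lowRank Finset.univ k (fun j => ‖x j - z‖), φ (x i)
        ∂(Measure.pi fun _ : Fin (N + 1) => P) =
      ∫ y, φ y * nnWeight P N k z y ∂P := by
  classical
  have h : ∀ x : Fin (N + 1) → E d, ∑ i ∈ lowRank Finset.univ k (fun j => ‖x j - z‖), φ (x i) =
      ∑ i, if i ∈ lowRank Finset.univ k (fun j => ‖x j - z‖) then φ (x i) else 0 := by
    intro x
    rw [← Finset.sum_filter]; congr 1; ext; simp
  simp_rw [h]
  rw [integral_const_mul, integral_finsetSum _ fun i _ => integrable_ite_mem_lowRank z φ hφ i]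
  simp_rw [integral_ite_mem_lowRank z φ hφ]
  rw [Finset.sum_const, Finset.card_univ, Fintype.card_fin, nsmul_eq_mul, ← integral_const_mul,
    ← integral_const_mul]
  congr 1; ext y
  rw [nnWeight]; field_simp

/-- Almost surely no two sample points are at the same distance from `z`. -/
theorem ae_injective_norm_sub (hd : 1 ≤ d) (hP : P ≪ volume) (n : ℕ) (z : E d) :
    ∀ᵐ x ∂(Measure.pi fun _ : Fin n => P), Function.Injective (fun j => ‖x j - z‖) := by
  cases n with
  | zero => exact Eventually.of_forall fun x i => i.elim0
  | succ N =>
    have h : ∀ i : Fin (N + 1), ∀ᵐ x ∂(Measure.pi fun _ : Fin (N + 1) => P),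
        ∀ j : Fin N, ‖x (i.succAbove j) - z‖ ≠ ‖x i - z‖ := by
      intro i
      have hmp := measurePreserving_piFinSuccAbove (fun _ : Fin (N + 1) => P) i
      have : ∀ᵐ q ∂(P.prod (Measure.pi fun _ : Fin N => P)), ∀ j, ‖q.2 j - z‖ ≠ ‖q.1 - z‖ := by
        rw [ae_all_iff]
        intro j
        rw [Measure.ae_prod_iff_ae_ae]
        · refine Eventually.of_forall fun y => ?_
          have h0 : ∀ᵐ w ∂P, ‖w - z‖ ≠ ‖y - z‖ := by
            rw [ae_iff]; simpa using measure_norm_sub_eq_zero hd hP z ‖y - z‖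
          exact (measurePreserving_eval (fun _ : Fin N => P) j).quasiMeasurePreserving.ae h0
        · exact (measurableSet_eq_fun (by fun_prop) (by fun_prop)).compl
      exact hmp.quasiMeasurePreserving.ae this
    filter_upwards [ae_all_iff.2 h] with x hx i j hij
    by_contra hne
    obtain ⟨l, hl⟩ := Fin.exists_succAbove_eq hne
    exact hx j l (by rw [hl]; exact hij)

end Sample

/-! ### The Efron–Stein inequality -/

section EfronStein

variable {α : Type*} [MeasurableSpace α]

theorem integrable_of_bounded {β : Type*} [MeasurableSpace β] {ν : Measure β} [IsFiniteMeasure ν]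
    {f : β → ℝ} (hf : Measurable f) {C : ℝ} (hC : ∀ x, |f x| ≤ C) : Integrable f ν :=
  Integrable.of_bound hf.aestronglyMeasurable C (Eventually.of_forall hC)

theorem sq_integral_le {β : Type*} [MeasurableSpace β] {ν : Measure β} [IsProbabilityMeasure ν]
    {f : β → ℝ} (hf : Measurable f) {C : ℝ} (hC : ∀ x, |f x| ≤ C) :
    (∫ x, f x ∂ν) ^ 2 ≤ ∫ x, f x ^ 2 ∂ν := by
  have hm : MemLp f 2 ν := MemLp.of_bound hf.aestronglyMeasurable C (Eventually.of_forall hC)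
  have h := variance_nonneg f ν
  rw [variance_eq_sub hm] at h
  simpa using h

theorem integral_sq_sub_sq_integral_le {β : Type*} [MeasurableSpace β] {ν : Measure β}
    [IsProbabilityMeasure ν] {f : β → ℝ} (hf : Measurable f) {C : ℝ} (hC : ∀ x, |f x| ≤ C)
    (c : ℝ) : (∫ x, f x ^ 2 ∂ν) - (∫ x, f x ∂ν) ^ 2 ≤ ∫ x, (f x - c) ^ 2 ∂ν := by
  have h1 : Integrable (fun x => f x) ν := integrable_of_bounded hf hC
  have h2 : Integrable (fun x => f x ^ 2) ν :=
    integrable_of_bounded (hf.pow_const 2) (C := C ^ 2) fun x => by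
      rw [abs_pow]; exact pow_le_pow_left₀ (abs_nonneg _) (hC x) 2
  have h3 : ∫ x, (f x - c) ^ 2 ∂ν = (∫ x, f x ^ 2 ∂ν) - 2 * c * (∫ x, f x ∂ν) + c ^ 2 := by
    have : ∀ x, (f x - c) ^ 2 = f x ^ 2 - 2 * c * f x + c ^ 2 := fun x => by ring
    simp_rw [this]
    have h4 : Integrable (fun x => f x ^ 2 - 2 * c * f x) ν := h2.sub (h1.const_mul _)
    rw [integral_add h4 (integrable_const _), integral_sub h2 (h1.const_mul _),
      integral_const_mul]
    simp
  rw [h3]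
  nlinarith [sq_nonneg ((∫ x, f x ∂ν) - c)]

theorem integral_pi_succ (P : Measure α) [IsProbabilityMeasure P] {n : ℕ}
    {f : (Fin (n + 1) → α) → ℝ} (hf : Measurable f) {C : ℝ} (hC : ∀ x, |f x| ≤ C) :
    ∫ x, f x ∂(Measure.pi fun _ : Fin (n + 1) => P) =
      ∫ a, ∫ x, f (Fin.cons a x) ∂(Measure.pi fun _ : Fin n => P) ∂P := by
  have hmp := (measurePreserving_piFinSuccAbove (fun _ : Fin (n + 1) => P) 0).symm
  rw [← hmp.integral_comp']
  have h : ∀ q : α × (Fin n → α), (MeasurableEquiv.piFinSuccAbove (fun _ => α) 0).symm q =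
      Fin.cons q.1 q.2 := by
    intro q
    simp [MeasurableEquiv.piFinSuccAbove_symm_apply, Fin.insertNthEquiv]
  have hi : Integrable (fun q : α × (Fin n → α) =>
      f ((MeasurableEquiv.piFinSuccAbove (fun _ => α) 0).symm q))
      (P.prod (Measure.pi fun _ : Fin n => P)) :=
    integrable_of_bounded (hf.comp (MeasurableEquiv.measurable _)) fun q => hC _
  rw [integral_prod _ hi]
  simp_rw [h]

theorem measurable_finCons {n : ℕ} :
    Measurable fun q : α × (Fin n → α) => (Fin.cons q.1 q.2 : Fin (n + 1) → α) := by
  rw [measurable_pi_iff]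
  intro i
  refine Fin.cases ?_ (fun j => ?_) i
  · simpa using measurable_fst
  · simp only [Fin.cons_succ]; fun_prop

/-- The Efron–Stein inequality: the variance of a function of independent variables is at most the
sum of the mean squared distances to functions which do not depend on the `i`-th variable. -/
theorem variance_pi_le_sum (P : Measure α) [IsProbabilityMeasure P] {n : ℕ}
    (f : (Fin n → α) → ℝ) (g : Fin n → (Fin n → α) → ℝ) (hf : Measurable f)
    (hg : ∀ i, Measurable (g i)) {C : ℝ} (hfC : ∀ x, |f x| ≤ C) (hgC : ∀ i x, |g i x| ≤ C)
    (hgi : ∀ i x y, (∀ j, j ≠ i → x j = y j) → g i x = g i y) :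
    (∫ x, f x ^ 2 ∂(Measure.pi fun _ : Fin n => P)) -
        (∫ x, f x ∂(Measure.pi fun _ : Fin n => P)) ^ 2 ≤
      ∑ i, ∫ x, (f x - g i x) ^ 2 ∂(Measure.pi fun _ : Fin n => P) := by
  induction n with
  | zero =>
    have h : ∀ u : (Fin 0 → α) → ℝ, ∫ x, u x ∂(Measure.pi fun _ : Fin 0 => P) = u default := by
      intro u
      rw [Measure.pi_of_empty, integral_dirac]
      congr 1
    simp [h]
  | succ n ih =>
    set μn := Measure.pi fun _ : Fin n => P with hμn
    have hsq : ∀ {u v : ℝ}, |u| ≤ C → |v| ≤ C → |(u - v) ^ 2| ≤ (2 * C) ^ 2 := by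
      intro u v hu hv
      rw [abs_pow]
      refine pow_le_pow_left₀ (abs_nonneg _) ?_ 2
      exact (abs_sub _ _).trans (by linarith)
    have hsq' : ∀ {u : ℝ}, |u| ≤ C → |u ^ 2| ≤ C ^ 2 := by
      intro u hu
      rw [abs_pow]; exact pow_le_pow_left₀ (abs_nonneg _) hu 2
    have hcm : ∀ a : α, Measurable fun x : Fin n → α => (Fin.cons a x : Fin (n + 1) → α) :=
      fun a => measurable_finCons.comp measurable_prodMk_left
    have hfm : Measurable fun q : α × (Fin n → α) => f (Fin.cons q.1 q.2) :=
      hf.comp measurable_finCons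
    have hgm : ∀ i, Measurable fun q : α × (Fin n → α) => g i (Fin.cons q.1 q.2) :=
      fun i => (hg i).comp measurable_finCons
    have hmeas : ∀ {u : α × (Fin n → α) → ℝ}, Measurable u →
        Measurable fun a => ∫ x, u (a, x) ∂μn := fun {u} hu =>
      (hu.stronglyMeasurable.integral_prod_right').measurable
    have hbd : ∀ {u : (Fin n → α) → ℝ} {K : ℝ}, (∀ x, |u x| ≤ K) → |∫ x, u x ∂μn| ≤ K := by
      intro u K hu
      have := norm_integral_le_of_norm_le_const (μ := μn) (f := u) (Eventually.of_forall hu)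
      simpa using this
    -- Law of total variance with respect to the first coordinate: the induction hypothesis bounds
    -- the variance given `a`, and the variance of the conditional mean `F` is bounded separately.
    set F : α → ℝ := fun a => ∫ x, f (Fin.cons a x) ∂μn with hF
    have hFm : Measurable F := hmeas hfm
    have hFC : ∀ a, |F a| ≤ C := fun a => hbd fun x => hfC _
    have hV : ∀ a, (∫ x, f (Fin.cons a x) ^ 2 ∂μn) - F a ^ 2 ≤
        ∑ i : Fin n, ∫ x, (f (Fin.cons a x) - g i.succ (Fin.cons a x)) ^ 2 ∂μn := by
      intro a
      refine ih (fun x => f (Fin.cons a x)) (fun i x => g i.succ (Fin.cons a x))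
        (hf.comp (hcm a)) (fun i => (hg _).comp (hcm a)) (fun x => hfC _) (fun i x => hgC _ _) ?_
      intro i x y hxy
      refine hgi _ _ _ fun j => ?_
      refine Fin.cases (by simp) (fun l hl => ?_) j
      simpa using hxy l (fun h => hl (by rw [h]))
    have h0 : (∫ a, F a ^ 2 ∂P) - (∫ a, F a ∂P) ^ 2 ≤
        ∫ a, ∫ x, (f (Fin.cons a x) - g 0 (Fin.cons a x)) ^ 2 ∂μn ∂P := by
      rcases isEmpty_or_nonempty α with he | ⟨⟨a₀⟩⟩
      · simp [integral_of_isEmpty]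
      refine (integral_sq_sub_sq_integral_le hFm hFC
        (∫ x, g 0 (Fin.cons a₀ x) ∂μn)).trans ?_
      refine integral_mono_of_nonneg (Eventually.of_forall fun a => sq_nonneg _)
        (integrable_of_bounded (hmeas ((hfm.sub (hgm 0)).pow_const 2)) (C := (2 * C) ^ 2)
          fun a => hbd fun x => hsq (hfC _) (hgC _ _)) (Eventually.of_forall fun a => ?_)
      -- `g 0` does not see the first coordinate, so its integral over the others is a constant and
      -- may serve as the centre in the bound for the variance of `F`; Jensen's inequality then
      -- moves the square inside.
      have h1 : ∀ x, g 0 (Fin.cons a₀ x) = g 0 (Fin.cons a x) := by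
        intro x
        refine hgi _ _ _ fun j => Fin.cases (by simp) (fun l _ => by simp) j
      simp only [hF, h1]
      have i1 : Integrable (fun x => f (Fin.cons a x)) μn :=
        integrable_of_bounded (hf.comp (hcm a)) fun x => hfC _
      have i2 : Integrable (fun x => g 0 (Fin.cons a x)) μn :=
        integrable_of_bounded ((hg 0).comp (hcm a)) fun x => hgC _ _
      rw [← integral_sub i1 i2]
      exact sq_integral_le (C := 2 * C) ((hf.comp (hcm a)).sub ((hg 0).comp (hcm a)))
        fun x => (abs_sub _ _).trans (by linarith [hfC (Fin.cons a x), hgC 0 (Fin.cons a x)])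
    have hI2 : Integrable (fun a => ∫ x, f (Fin.cons a x) ^ 2 ∂μn) P :=
      integrable_of_bounded (hmeas (hfm.pow_const 2)) fun a => hbd fun x => hsq' (hfC _)
    have hIF : Integrable (fun a => F a ^ 2) P :=
      integrable_of_bounded (hFm.pow_const 2) fun a => hsq' (hFC a)
    have hIg : ∀ i, Integrable
        (fun a => ∫ x, (f (Fin.cons a x) - g i (Fin.cons a x)) ^ 2 ∂μn) P := fun i =>
      integrable_of_bounded (hmeas ((hfm.sub (hgm i)).pow_const 2))
        fun a => hbd fun x => hsq (hfC _) (hgC _ _)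
    have hsum : (∫ a, ∫ x, f (Fin.cons a x) ^ 2 ∂μn ∂P) - ∫ a, F a ^ 2 ∂P ≤
        ∑ i : Fin n, ∫ a, ∫ x, (f (Fin.cons a x) - g i.succ (Fin.cons a x)) ^ 2 ∂μn ∂P := by
      rw [← integral_sub hI2 hIF, ← integral_finsetSum _ fun i _ => hIg _]
      exact integral_mono (hI2.sub hIF) (integrable_finsetSum _ fun i _ => hIg _) hV
    rw [integral_pi_succ P (hf.pow_const 2) fun x => hsq' (hfC x), integral_pi_succ P hf hfC,
      Fin.sum_univ_succ]
    have h3 : ∀ i, ∫ x, (f x - g i x) ^ 2 ∂(Measure.pi fun _ : Fin (n + 1) => P) =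
        ∫ a, ∫ x, (f (Fin.cons a x) - g i (Fin.cons a x)) ^ 2 ∂μn ∂P := fun i =>
      integral_pi_succ P ((hf.sub (hg i)).pow_const 2) (C := (2 * C) ^ 2)
        fun x => hsq (hfC x) (hgC i x)
    simp only [h3]
    linarith

end EfronStein

/-! ### Taylor expansions -/

section Taylor

variable {d : ℕ}

theorem contDiffAt_two_hasFDerivAt_fderiv {f : E d → ℝ} {z : E d} (hf : ContDiffAt ℝ 2 f z) :
    HasFDerivAt (fderiv ℝ f) (hess f z) z := by
  have h : ContDiffAt ℝ 1 (fderiv ℝ f) z := hf.fderiv_right (m := 1) (by norm_num)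
  exact (h.differentiableAt (by norm_num)).hasFDerivAt

theorem eventually_differentiableAt {f : E d → ℝ} {z : E d} (hf : ContDiffAt ℝ 2 f z) :
    ∀ᶠ y in 𝓝 z, DifferentiableAt ℝ f y := by
  filter_upwards [hf.eventually (by simp)] with y hy using hy.differentiableAt (by norm_num)

/-- Apply the mean value inequality on `[0,1]` to `t ↦ f(z + t v) - t f'(z) v - t²/2 f''(z)(v,v)`.
Its derivative is `(f'(z + t v) - f'(z) - f''(z)(t v)) v`, which is `o(‖v‖²)` by differentiability
of `f'` at `z`. -/
theorem taylor_two_isLittleO {f : E d → ℝ} {z : E d} (hf : ContDiffAt ℝ 2 f z) :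
    (fun v : E d => f (z + v) - f z - fderiv ℝ f z v - hess f z v v / 2) =o[𝓝 0]
      (fun v : E d => ‖v‖ ^ 2) := by
  rw [isLittleO_iff]
  intro ε hε
  have h1 := (hasFDerivAt_iff_isLittleO_nhds_zero.1 (contDiffAt_two_hasFDerivAt_fderiv hf)).def hε
  have h2 : ∀ᶠ v in 𝓝 (0 : E d), DifferentiableAt ℝ f (z + v) := by
    have : Tendsto (fun v : E d => z + v) (𝓝 0) (𝓝 z) := by
      have : Continuous fun v : E d => z + v := by fun_prop
      simpa using this.tendsto 0
    exact this.eventually (eventually_differentiableAt hf)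
  obtain ⟨δ, hδ, hball⟩ := Metric.eventually_nhds_iff_ball.1 (h1.and h2)
  filter_upwards [Metric.ball_mem_nhds 0 hδ] with v hv
  have hmem : ∀ t ∈ Set.Icc (0 : ℝ) 1, t • v ∈ Metric.ball (0 : E d) δ := by
    intro t ht
    rw [mem_ball_zero_iff] at hv ⊢
    rw [norm_smul, Real.norm_of_nonneg ht.1]
    exact (mul_le_of_le_one_left (norm_nonneg _) ht.2).trans_lt hv
  set g : ℝ → ℝ := fun t => f (z + t • v) - t * fderiv ℝ f z v - t ^ 2 / 2 * hess f z v v with hg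
  have hderiv : ∀ t ∈ Set.Icc (0 : ℝ) 1, HasDerivWithinAt g
      (fderiv ℝ f (z + t • v) v - 1 * fderiv ℝ f z v - t * hess f z v v) (Set.Icc 0 1) t := by
    intro t ht
    have hd := (hball _ (hmem t ht)).2.hasFDerivAt
    have hl : HasDerivAt (fun t : ℝ => z + t • v) v t := by
      simpa using ((hasDerivAt_id t).smul_const v).const_add z
    have h3 : HasDerivAt (fun t : ℝ => t ^ 2 / 2 * hess f z v v) (t * hess f z v v) t := by
      have := ((hasDerivAt_pow 2 t).div_const 2).mul_const (hess f z v v)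
      convert! this using 1
      simp
    exact (((hd.comp_hasDerivAt t hl).sub ((hasDerivAt_id t).mul_const _)).sub h3).hasDerivWithinAt
  have hbound : ∀ t ∈ Set.Icc (0 : ℝ) 1,
      ‖fderiv ℝ f (z + t • v) v - 1 * fderiv ℝ f z v - t * hess f z v v‖ ≤ ε * ‖v‖ ^ 2 := by
    intro t ht
    have h3 := (hball _ (hmem t ht)).1
    have h4 : fderiv ℝ f (z + t • v) v - 1 * fderiv ℝ f z v - t * hess f z v v =
        (fderiv ℝ f (z + t • v) - fderiv ℝ f z - hess f z (t • v)) v := by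
      simp
    rw [h4]
    calc _ ≤ ‖fderiv ℝ f (z + t • v) - fderiv ℝ f z - hess f z (t • v)‖ * ‖v‖ :=
          ContinuousLinearMap.le_opNorm _ _
      _ ≤ ε * ‖t • v‖ * ‖v‖ := by gcongr
      _ ≤ ε * ‖v‖ * ‖v‖ := by
          rw [norm_smul, Real.norm_of_nonneg ht.1]
          gcongr
          exact mul_le_of_le_one_left (norm_nonneg _) ht.2
      _ = _ := by ring
  have := (convex_Icc (0 : ℝ) 1).norm_image_sub_le_of_norm_hasDerivWithin_le hderiv hbound
    (Set.left_mem_Icc.2 zero_le_one) (Set.right_mem_Icc.2 zero_le_one)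
  rw [Real.norm_of_nonneg (sq_nonneg ‖v‖)]
  simp only [hg] at this
  convert! this using 1
  · congr 1; simp; ring
  · simp

variable {U K : Set (E d)} {f : E d → ℝ} {M : ℝ}

theorem abs_sub_le_of_norm_fderiv_le (hU : IsOpen U) (hK : Convex ℝ K) (hKU : K ⊆ U)
    (hf : ContDiffOn ℝ 2 f U) (hM : ∀ y ∈ K, ‖fderiv ℝ f y‖ ≤ M) {y z : E d} (hy : y ∈ K)
    (hz : z ∈ K) : |f y - f z| ≤ M * ‖y - z‖ :=
  hK.norm_image_sub_le_of_norm_fderiv_le (𝕜 := ℝ)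
    (fun x hx => ((hf.contDiffAt (hU.mem_nhds (hKU hx))).differentiableAt (by norm_num))) hM hz hy

/-- Two mean value inequalities: `fderiv ℝ f` is `M`-Lipschitz on the convex set `K`, and then `f`
minus its linearisation at `z` has derivative at most `M ‖y - z‖` along the segment. The factor
`1/2` is given up. -/
theorem abs_sub_sub_fderiv_le (hU : IsOpen U) (hK : Convex ℝ K) (hKU : K ⊆ U)
    (hf : ContDiffOn ℝ 2 f U) (hM : ∀ y ∈ K, ‖hess f y‖ ≤ M) {y z : E d} (hy : y ∈ K)
    (hz : z ∈ K) : |f y - f z - fderiv ℝ f z (y - z)| ≤ M * ‖y - z‖ ^ 2 := by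
  have hfa : ∀ x ∈ K, ContDiffAt ℝ 2 f x := fun x hx => hf.contDiffAt (hU.mem_nhds (hKU hx))
  have hM0 : 0 ≤ M := (norm_nonneg (hess f y)).trans (hM y hy)
  have h1 : ∀ x ∈ K, ‖fderiv ℝ f x - fderiv ℝ f z‖ ≤ M * ‖x - z‖ := fun x hx =>
    hK.norm_image_sub_le_of_norm_hasFDerivWithin_le (𝕜 := ℝ)
      (fun w hw => (contDiffAt_two_hasFDerivAt_fderiv (hfa w hw)).hasFDerivWithinAt) hM hz hx
  have hseg : segment ℝ z y ⊆ K := hK.segment_subset hz hy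
  have h2 : ∀ x ∈ segment ℝ z y, ‖fderiv ℝ f x - fderiv ℝ f z‖ ≤ M * ‖y - z‖ := by
    intro x hx
    refine (h1 x (hseg hx)).trans ?_
    gcongr
    have := norm_sub_le_of_mem_segment hx
    exact this
  have := (convex_segment z y).norm_image_sub_le_of_norm_fderiv_le' (𝕜 := ℝ)
    (fun x hx => (hfa x (hseg hx)).differentiableAt (by norm_num)) h2
    (left_mem_segment ℝ z y) (right_mem_segment ℝ z y)
  rw [Real.norm_eq_abs] at this
  calc _ ≤ _ := this
    _ = _ := by ring

end Taylor

/-! ### Radial integrals -/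

section Radial

variable {d : ℕ}

/-- Integration of a radial function times a function which is homogeneous of degree two. -/
theorem integral_radial_mul_homogeneous (hd : 1 ≤ d) (W : ℝ → ℝ) (q : E d → ℝ)
    (hq : ∀ (r : ℝ) (v : E d), q (r • v) = r ^ 2 * q v) :
    ∫ v, W ‖v‖ * q v = (∫ θ : Metric.sphere (0 : E d) 1, q θ ∂(volume : Measure (E d)).toSphere) *
      ∫ r : Set.Ioi (0 : ℝ), W r * (r : ℝ) ^ 2
        ∂(Measure.volumeIoiPow (Module.finrank ℝ (E d) - 1)) := by
  have := nontrivial_E hd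
  have hmp := (volume : Measure (E d)).measurePreserving_homeomorphUnitSphereProd
  calc ∫ v, W ‖v‖ * q v
      = ∫ x : ({(0)}ᶜ : Set (E d)), W ‖x.1‖ * q x.1 
          ∂((volume : Measure (E d)).comap Subtype.val) := by
        rw [integral_subtype_comap (measurableSet_singleton _).compl fun x : E d => W ‖x‖ * q x,
          restrict_compl_singleton]
    _ = ∫ x : Metric.sphere (0 : E d) 1 × Set.Ioi (0 : ℝ), q (x.1 : E d) * (W x.2 * (x.2 : ℝ) ^ 2)
          ∂(volume : Measure (E d)).toSphere.prod
            (.volumeIoiPow (Module.finrank ℝ (E d) - 1)) := by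
        rw [← hmp.integral_comp (Homeomorph.measurableEmbedding _)]
        refine integral_congr_ae (Eventually.of_forall fun x => ?_)
        have hx : (0 : ℝ) < ‖x.1‖ := norm_pos_iff.2 x.2
        have h1 : q x.1 = ‖x.1‖ ^ 2 * q (‖x.1‖⁻¹ • x.1) := by
          rw [← hq, smul_smul, mul_inv_cancel₀ hx.ne', one_smul]
        simp only [homeomorphUnitSphereProd_apply_fst_coe, homeomorphUnitSphereProd_apply_snd_coe]
        rw [h1]; ring
    _ = _ := integral_prod_mul (fun θ : Metric.sphere (0 : E d) 1 => q θ)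
        (fun r : Set.Ioi (0 : ℝ) => W r * (r : ℝ) ^ 2)

/-- The integrand is odd. -/
theorem integral_radial_mul_linear (W : ℝ → ℝ) (L : E d →L[ℝ] ℝ) :
    ∫ v, W ‖v‖ * L v = 0 := by
  have h := integral_neg_eq_self (fun v : E d => W ‖v‖ * L v) volume
  simp only [norm_neg, map_neg, mul_neg] at h
  rw [integral_neg] at h
  linarith

/-- The quadratic form averaged in `sphereMean`. -/
noncomputable def biasForm (p f : E d → ℝ) (x v : E d) : ℝ :=
  ⟪gradient f x, v⟫ * ⟪gradient p x, v⟫ / p x + hess f x v v / 2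

theorem biasForm_smul (p f : E d → ℝ) (x : E d) (r : ℝ) (v : E d) :
    biasForm p f x (r • v) = r ^ 2 * biasForm p f x v := by
  simp only [biasForm, inner_smul_right, map_smul, smul_apply, smul_eq_mul]
  ring

theorem continuous_biasForm (p f : E d → ℝ) (x : E d) : Continuous (biasForm p f x) := by
  unfold biasForm
  fun_prop

theorem biasForm_eq {p f : E d → ℝ} {x : E d} (hp : DifferentiableAt ℝ p x)
    (hf : DifferentiableAt ℝ f x) (v : E d) :
    biasForm p f x v = fderiv ℝ f x v * fderiv ℝ p x v / p x + hess f x v v / 2 := by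
  rw [biasForm, ← InnerProductSpace.toDual_apply_apply, ← InnerProductSpace.toDual_apply_apply,
    ← hp.hasGradientAt.hasFDerivAt.fderiv, ← hf.hasGradientAt.hasFDerivAt.fderiv]

/-- `sphereMean` is the average of `biasForm` over the unit sphere, where `‖θ‖ = 1`. Inserting the
factor `‖θ‖ ^ 2` keeps the difference homogeneous of degree two, so that its integral against any
radial weight vanishes. -/
theorem integral_sphere_biasForm_sub (hd : 1 ≤ d) (p f : E d → ℝ) (x : E d) :
    ∫ θ : Metric.sphere (0 : E d) 1, (biasForm p f x θ - sphereMean p f x * ‖(θ : E d)‖ ^ 2)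
      ∂(volume : Measure (E d)).toSphere = 0 := by
  have := nontrivial_E hd
  have hσ : (volume : Measure (E d)).toSphere.real Set.univ ≠ 0 := by
    rw [measureReal_def, ENNReal.toReal_ne_zero]
    exact ⟨fun h => Measure.toSphere_ne_zero _ (Measure.measure_univ_eq_zero.1 h),
      measure_ne_top _ _⟩
  have hi : Integrable (fun θ : Metric.sphere (0 : E d) 1 => biasForm p f x θ)
      (volume : Measure (E d)).toSphere :=
    ((continuous_biasForm p f x).comp continuous_subtype_val).integrable_of_hasCompactSupport
      (HasCompactSupport.of_compactSpace _)
  have h1 : ∀ θ : Metric.sphere (0 : E d) 1, ‖(θ : E d)‖ = 1 := fun θ => by simp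
  simp only [h1, one_pow, mul_one]
  rw [integral_sub hi (integrable_const _), integral_const, sphereMean, smul_eq_mul,
    ← mul_assoc, mul_inv_cancel₀ hσ, one_mul]
  exact sub_self _

end Radial

/-! ### Local analysis of nearest neighbour means -/

section Local

variable {d : ℕ} {S : Set (E d)} {P : Measure (E d)} {p : E d → ℝ}

theorem HasDensityOn.absolutelyContinuous (hP : HasDensityOn S P p) : P ≪ volume := by
  rw [hP.eq_withDensity]; exact withDensity_absolutelyContinuous _ _

theorem HasDensityOn.ae_mem (hP : HasDensityOn S P p) : ∀ᵐ y ∂P, y ∈ S :=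
  mem_ae_iff.2 hP.compl_null

theorem HasDensityOn.setIntegral_eq (hP : HasDensityOn S P p) {A : Set (E d)}
    (hA : MeasurableSet A) (f : E d → ℝ) : ∫ y in A, f y ∂P = ∫ y in A, p y * f y := by
  conv_lhs => rw [hP.eq_withDensity]
  rw [setIntegral_withDensity_eq_setIntegral_toReal_smul
    hP.measurable.ennreal_ofReal (Eventually.of_forall fun _ => ENNReal.ofReal_lt_top) f hA]
  simp_rw [ENNReal.toReal_ofReal (hP.nonneg _), smul_eq_mul]

/-- The volume of the unit ball. -/
noncomputable abbrev unitVol (d : ℕ) : ℝ := (volume : Measure (E d)).real (Metric.closedBall 0 1)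

theorem unitVol_pos (d : ℕ) : 0 < unitVol d :=
  ENNReal.toReal_pos (Metric.measure_closedBall_pos _ _ one_pos).ne'
    measure_closedBall_lt_top.ne

theorem volumeReal_ball (hd : 1 ≤ d) (z : E d) {r : ℝ} (hr : 0 ≤ r) :
    (volume : Measure (E d)).real (Metric.ball z r) = r ^ d * unitVol d := by
  have := nontrivial_E hd
  rw [measureReal_def, ← Measure.addHaar_closedBall_eq_addHaar_ball, ← measureReal_def,
    Measure.addHaar_real_closedBall _ _ hr, finrank_euclideanSpace_fin, unitVol, measureReal_def,
    measureReal_def, Measure.addHaar_closedBall_eq_addHaar_ball]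

theorem mul_pow_le_ballMass (hd : 1 ≤ d) [IsProbabilityMeasure P] (hP : HasDensityOn S P p) {a : ℝ}
    (ha : 0 ≤ a) {z : E d} {r : ℝ} (hr : 0 ≤ r) (hpa : ∀ y ∈ Metric.ball z r, a ≤ p y) :
    a * unitVol d * r ^ d ≤ ballMass P z r := by
  have h1 : ENNReal.ofReal a * volume (Metric.ball z r) ≤ P (Metric.ball z r) := by
    conv_rhs => rw [hP.eq_withDensity]
    rw [withDensity_apply _ Metric.isOpen_ball.measurableSet]
    calc _ = ∫⁻ _ in Metric.ball z r, ENNReal.ofReal a := by rw [setLIntegral_const]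
      _ ≤ _ := setLIntegral_mono' Metric.isOpen_ball.measurableSet
          fun y hy => ENNReal.ofReal_le_ofReal (hpa y hy)
  have h2 := ENNReal.toReal_mono (measure_ne_top P _) h1
  rw [ENNReal.toReal_mul, ENNReal.toReal_ofReal ha, ← measureReal_def, ← measureReal_def,
    volumeReal_ball hd z hr] at h2
  unfold ballMass
  linarith

theorem ballMass_le_mul_pow (hd : 1 ≤ d) [IsProbabilityMeasure P] (hP : HasDensityOn S P p) {b : ℝ}
    (hb : 0 ≤ b) {z : E d} {r : ℝ} (hr : 0 ≤ r) (hpb : ∀ y ∈ Metric.ball z r, p y ≤ b) :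
    ballMass P z r ≤ b * unitVol d * r ^ d := by
  have h1 : P (Metric.ball z r) ≤ ENNReal.ofReal b * volume (Metric.ball z r) := by
    conv_lhs => rw [hP.eq_withDensity]
    rw [withDensity_apply _ Metric.isOpen_ball.measurableSet]
    calc _ ≤ ∫⁻ _ in Metric.ball z r, ENNReal.ofReal b :=
          setLIntegral_mono' Metric.isOpen_ball.measurableSet
            fun y hy => ENNReal.ofReal_le_ofReal (hpb y hy)
      _ = _ := by rw [setLIntegral_const]
  have h2 := ENNReal.toReal_mono (ENNReal.mul_ne_top ENNReal.ofReal_ne_top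
    measure_ball_lt_top.ne) h1
  rw [ENNReal.toReal_mul, ENNReal.toReal_ofReal hb, ← measureReal_def, ← measureReal_def,
    volumeReal_ball hd z hr] at h2
  unfold ballMass
  linarith

theorem pow_rpow_two_div (hd : 1 ≤ d) {r : ℝ} (hr : 0 ≤ r) :
    (r ^ d) ^ (2 / (d : ℝ)) = r ^ 2 := by
  have : (d : ℝ) ≠ 0 := by positivity
  rw [← Real.rpow_natCast r d, ← Real.rpow_mul hr, mul_div_cancel₀ _ this]
  norm_num

/-- Turns squared distances into the power `2 / d` of the ball mass, whose moments against
`nnWeight` are known exactly. -/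
theorem sq_le_mul_ballMass_rpow (hd : 1 ≤ d) [IsProbabilityMeasure P] (hP : HasDensityOn S P p)
    {a : ℝ} (ha : 0 < a) {z : E d} {r : ℝ} (hr : 0 ≤ r) (hpa : ∀ y ∈ Metric.ball z r, a ≤ p y) :
    r ^ 2 ≤ (a * unitVol d) ^ (-(2 / (d : ℝ))) * ballMass P z r ^ (2 / (d : ℝ)) := by
  have hV := unitVol_pos d
  have h1 := mul_pow_le_ballMass hd hP ha.le hr hpa
  have h2 : (a * unitVol d * r ^ d) ^ (2 / (d : ℝ)) ≤ ballMass P z r ^ (2 / (d : ℝ)) :=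
    Real.rpow_le_rpow (by positivity) h1 (by positivity)
  rw [Real.mul_rpow (by positivity) (by positivity), pow_rpow_two_div hd hr] at h2
  rw [Real.rpow_neg (by positivity), inv_mul_eq_div, le_div_iff₀ (by positivity)]
  linarith

theorem setIntegral_ball_radial (w : ℝ → ℝ) (f : E d → ℝ) (z : E d) (δ : ℝ) :
    ∫ y in Metric.ball z δ, f (y - z) * w ‖y - z‖ =
      ∫ v, (Set.Iio δ).indicator w ‖v‖ * f v := by
  rw [← integral_indicator Metric.isOpen_ball.measurableSet,
    ← integral_sub_right_eq_self (fun v : E d => (Set.Iio δ).indicator w ‖v‖ * f v) z]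
  congr 1; ext y
  by_cases h : ‖y - z‖ < δ
  · rw [Set.indicator_of_mem (by simpa [dist_eq_norm] using h), Set.indicator_of_mem (by exact h),
      mul_comm]
  · rw [Set.indicator_of_notMem (by simpa [dist_eq_norm] using h),
      Set.indicator_of_notMem (by exact h), zero_mul]

/-- A function which is, up to an error of second order, the sum of a linear form and of a
quadratic form with mean zero on the sphere has a small mean over the nearest neighbours of `z`. -/
theorem abs_integral_mul_nnWeight_le (hd : 1 ≤ d) [IsProbabilityMeasure P]
    (hP : HasDensityOn S P p) {a : ℝ} (ha : 0 < a) (hpa : ∀ y ∈ S, a ≤ p y) {z : E d} {δ : ℝ}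
    (hδ : 0 < δ) (hz : Metric.ball z δ ⊆ S) {h : E d → ℝ} (hh : Measurable h) {K : ℝ}
    (hK : ∀ y ∈ S, |h y| ≤ K) (L : E d →L[ℝ] ℝ) {q : E d → ℝ} (hqc : Continuous q)
    (hq : ∀ (r : ℝ) (v : E d), q (r • v) = r ^ 2 * q v)
    (hq0 : ∫ θ : Metric.sphere (0 : E d) 1, q θ ∂(volume : Measure (E d)).toSphere = 0)
    {ε : ℝ} (hε0 : 0 ≤ ε)
    (hε : ∀ y ∈ Metric.ball z δ, |h y * p y - L (y - z) - q (y - z)| ≤ ε * ‖y - z‖ ^ 2)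
    (N k : ℕ) :
    |∫ y, h y * nnWeight P N k z y ∂P| ≤
      ε * a⁻¹ * (a * unitVol d) ^ (-(2 / (d : ℝ))) * tailMoment N k (2 / (d : ℝ)) +
        K / ballMass P z δ ^ 3 * tailMoment N k 3 := by
  have hPac := hP.absolutelyContinuous
  set B := Metric.ball z δ with hB
  have hBm : MeasurableSet B := Metric.isOpen_ball.measurableSet
  obtain ⟨C, hC⟩ := exists_nnWeight_le P N k
  have hw0 := fun y => nnWeight_nonneg (P := P) N k z y
  have hwm := measurable_nnWeight (P := P) N k z
  have hwC : ∀ y, |nnWeight P N k z y| ≤ C := fun y => by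
    rw [abs_of_nonneg (hw0 y)]; exact hC z y
  have hK0 : 0 ≤ K := (abs_nonneg _).trans (hK z (hz (Metric.mem_ball_self hδ)))
  have hC0 : 0 ≤ C := (abs_nonneg _).trans (hwC z)
  have hint : Integrable (fun y => h y * nnWeight P N k z y) P := by
    refine Integrable.of_bound (hh.mul hwm).aestronglyMeasurable (K * C) ?_
    filter_upwards [hP.ae_mem] with y hy
    rw [Real.norm_eq_abs, abs_mul]
    exact mul_le_mul (hK y hy) (hwC y) (abs_nonneg _) hK0
  have hbdd : ∀ {f : E d → ℝ} {M : ℝ}, Measurable f → (∀ y ∈ B, |f y| ≤ M) →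
      IntegrableOn (fun y => f y * nnWeight P N k z y) B := by
    intro f M hf hM
    refine Measure.integrableOn_of_bounded (M := M * C) measure_ball_lt_top.ne
      (hf.mul hwm).aestronglyMeasurable ?_
    filter_upwards [ae_restrict_mem hBm] with y hy
    rw [Real.norm_eq_abs, abs_mul]
    exact mul_le_mul (hM y hy) (hwC y) (abs_nonneg _) ((abs_nonneg _).trans (hM y hy))
  have hsq : ∀ y ∈ B, ‖y - z‖ ^ 2 ≤ δ ^ 2 := fun y hy => by
    rw [hB, Metric.mem_ball, dist_eq_norm] at hy
    gcongr
  -- the linear and quadratic parts integrate to zero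
  have hL0 : ∫ y in B, L (y - z) * nnWeight P N k z y = 0 :=
    (setIntegral_ball_radial (fun r => ((N + 1 : ℕ) : ℝ) / k * binTail N k (ballMass P z r))
      L z δ).trans (integral_radial_mul_linear _ _)
  have hQ0 : ∫ y in B, q (y - z) * nnWeight P N k z y = 0 := by
    refine (setIntegral_ball_radial
      (fun r => ((N + 1 : ℕ) : ℝ) / k * binTail N k (ballMass P z r)) q z δ).trans ?_
    rw [integral_radial_mul_homogeneous hd _ _ hq, hq0, zero_mul]
  have hLi : IntegrableOn (fun y => L (y - z) * nnWeight P N k z y) B := by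
    refine hbdd (M := ‖L‖ * δ) (by fun_prop) fun y hy => ?_
    rw [hB, Metric.mem_ball, dist_eq_norm] at hy
    exact (L.le_opNorm _).trans (by gcongr)
  have hQi : IntegrableOn (fun y => q (y - z) * nnWeight P N k z y) B := by
    obtain ⟨M, hM⟩ := (isCompact_closedBall (0 : E d) δ).exists_bound_of_continuousOn
      hqc.continuousOn
    refine hbdd (M := M) (by fun_prop) fun y hy => hM _ ?_
    rw [hB, Metric.mem_ball, dist_eq_norm] at hy
    simpa using hy.le
  set Θ : E d → ℝ := fun y => h y * p y - L (y - z) - q (y - z) with hΘ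
  have hΘm : Measurable Θ := by
    have := hP.measurable
    have hqm := hqc.measurable
    fun_prop
  have hΘi : IntegrableOn (fun y => Θ y * nnWeight P N k z y) B :=
    hbdd (M := ε * δ ^ 2) hΘm fun y hy => (hε y hy).trans (mul_le_mul_of_nonneg_left (hsq y hy) hε0)
  -- Passing to Lebesgue measure puts the density into the integrand; this is why the expansion is
  -- assumed for `h y * p y` and not for `h y`.
  have hin : ∫ y in B, h y * nnWeight P N k z y ∂P = ∫ y in B, Θ y * nnWeight P N k z y := by
    rw [hP.setIntegral_eq hBm]
    have : ∀ y, p y * (h y * nnWeight P N k z y) = Θ y * nnWeight P N k z y +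
        L (y - z) * nnWeight P N k z y + q (y - z) * nnWeight P N k z y := fun y => by
      simp only [hΘ]; ring
    simp_rw [this]
    rw [integral_add (by exact hΘi.add hLi) hQi, integral_add hΘi hLi, hL0, hQ0, add_zero,
      add_zero]
  -- the error inside the ball
  have hGi : ∀ {s : ℝ}, 0 ≤ s → Integrable (fun y => ballMass P z ‖y - z‖ ^ s *
      nnWeight P N k z y) P := by
    intro s hs
    refine integrable_of_bounded
      (((measurable_ballMass_norm_sub z).pow_const s).mul hwm) (C := 1 * C) fun y => ?_
    rw [abs_mul, abs_of_nonneg (Real.rpow_nonneg (ballMass_nonneg _ _ _) _)]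
    exact mul_le_mul (Real.rpow_le_one (ballMass_nonneg _ _ _) (ballMass_le_one _ _) hs)
      (hwC y) (abs_nonneg _) zero_le_one
  have hG0 : ∀ (s : ℝ) y, 0 ≤ ballMass P z ‖y - z‖ ^ s * nnWeight P N k z y := fun s y =>
    mul_nonneg (Real.rpow_nonneg (ballMass_nonneg _ _ _) _) (hw0 y)
  set c := (a * unitVol d) ^ (-(2 / (d : ℝ))) with hc
  have hc0 : 0 ≤ c := Real.rpow_nonneg (mul_nonneg ha.le (unitVol_pos d).le) _
  have hE1 : |∫ y in B, Θ y * nnWeight P N k z y| ≤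
      ε * a⁻¹ * c * tailMoment N k (2 / (d : ℝ)) := by
    have hd0 : (0 : ℝ) ≤ 2 / (d : ℝ) := by positivity
    have hi1 : IntegrableOn (fun y => ε * (a⁻¹ * p y * ‖y - z‖ ^ 2 * nnWeight P N k z y)) B := by
      have : IntegrableOn (fun y => ‖y - z‖ ^ 2 * nnWeight P N k z y) B P := by
        refine Measure.integrableOn_of_bounded (M := δ ^ 2 * C) (measure_ne_top _ _)
          (by fun_prop) ?_
        filter_upwards [ae_restrict_mem hBm] with y hy
        rw [Real.norm_eq_abs, abs_mul, abs_of_nonneg (sq_nonneg _)]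
        exact mul_le_mul (hsq y hy) (hwC y) (abs_nonneg _) (sq_nonneg _)
      rw [hP.eq_withDensity, IntegrableOn, restrict_withDensity hBm,
        integrable_withDensity_iff_integrable_smul' hP.measurable.ennreal_ofReal
          (Eventually.of_forall fun _ => ENNReal.ofReal_lt_top)] at this
      refine ((this.const_mul a⁻¹).const_mul ε).congr (Eventually.of_forall fun y => ?_)
      simp only [ENNReal.toReal_ofReal (hP.nonneg _), smul_eq_mul]; ring_nf
      rw [← hP.eq_withDensity]
    calc |∫ y in B, Θ y * nnWeight P N k z y|
        ≤ ∫ y in B, |Θ y * nnWeight P N k z y| := abs_integral_le_integral_abs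
      _ ≤ ∫ y in B, ε * (a⁻¹ * p y * ‖y - z‖ ^ 2 * nnWeight P N k z y) := by
          refine setIntegral_mono_on hΘi.abs hi1 hBm fun y hy => ?_
          rw [abs_mul, abs_of_nonneg (hw0 y)]
          -- The factor `a⁻¹ * p y ≥ 1` brings the integral back from Lebesgue measure to `P`.
          have h1 : 1 ≤ a⁻¹ * p y := by
            rw [inv_mul_eq_div, one_le_div ha]; exact hpa y (hz hy)
          have h2 : ε * ‖y - z‖ ^ 2 ≤ ε * (a⁻¹ * p y * ‖y - z‖ ^ 2) := by
            gcongr; exact le_mul_of_one_le_left (sq_nonneg _) h1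
          calc _ ≤ ε * ‖y - z‖ ^ 2 * nnWeight P N k z y := by
                gcongr; exacts [hw0 y, hε y hy]
            _ ≤ ε * (a⁻¹ * p y * ‖y - z‖ ^ 2) * nnWeight P N k z y := by
                gcongr; exact hw0 y
            _ = _ := by ring
      _ = ε * a⁻¹ * ∫ y in B, ‖y - z‖ ^ 2 * nnWeight P N k z y ∂P := by
          rw [hP.setIntegral_eq hBm, ← integral_const_mul]
          congr 1; ext y; ring
      _ ≤ ε * a⁻¹ * ∫ y in B, c * (ballMass P z ‖y - z‖ ^ (2 / (d : ℝ)) *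
            nnWeight P N k z y) ∂P := by
          refine mul_le_mul_of_nonneg_left ?_ (by positivity)
          refine setIntegral_mono_on ?_ ((hGi hd0).const_mul c).integrableOn hBm fun y hy => ?_
          · refine Measure.integrableOn_of_bounded (M := δ ^ 2 * C) (measure_ne_top _ _)
              (by fun_prop) ?_
            filter_upwards [ae_restrict_mem hBm] with y hy
            rw [Real.norm_eq_abs, abs_mul, abs_of_nonneg (sq_nonneg _)]
            exact mul_le_mul (hsq y hy) (hwC y) (abs_nonneg _) (sq_nonneg _)
          · rw [← mul_assoc]
            gcongr
            · exact hw0 y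
            · refine sq_le_mul_ballMass_rpow hd hP ha (norm_nonneg _) fun x hx => hpa x (hz ?_)
              rw [hB, Metric.mem_ball, dist_eq_norm] at hy
              exact Metric.ball_subset_ball hy.le hx
      _ ≤ ε * a⁻¹ * ∫ y, c * (ballMass P z ‖y - z‖ ^ (2 / (d : ℝ)) *
            nnWeight P N k z y) ∂P := by
          refine mul_le_mul_of_nonneg_left ?_ (by positivity)
          exact setIntegral_le_integral ((hGi hd0).const_mul c)
            (Eventually.of_forall fun y => mul_nonneg hc0 (hG0 _ y))
      _ = _ := by
          rw [integral_const_mul, integral_rpow_ballMass_mul_nnWeight hd hPac N k z hd0]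
          ring
  -- the part outside the ball
  have hGδ : 0 < ballMass P z δ :=
    lt_of_lt_of_le (mul_pos (mul_pos ha (unitVol_pos d)) (pow_pos hδ d))
      (mul_pow_le_ballMass hd hP ha.le hδ.le fun y hy => hpa y (hz hy))
  have hE2 : |∫ y in Bᶜ, h y * nnWeight P N k z y ∂P| ≤
      K / ballMass P z δ ^ 3 * tailMoment N k 3 := by
    calc |∫ y in Bᶜ, h y * nnWeight P N k z y ∂P|
        ≤ ∫ y in Bᶜ, |h y * nnWeight P N k z y| ∂P := abs_integral_le_integral_abs
      _ ≤ ∫ y in Bᶜ, K / ballMass P z δ ^ 3 *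
            (ballMass P z ‖y - z‖ ^ (3 : ℝ) * nnWeight P N k z y) ∂P := by
          refine integral_mono_ae hint.abs.integrableOn
            ((hGi (by norm_num)).const_mul _).integrableOn ?_
          filter_upwards [ae_restrict_of_ae hP.ae_mem, ae_restrict_mem hBm.compl] with y hy hyB
          have hle : δ ≤ ‖y - z‖ := by
            simpa [hB, dist_eq_norm] using hyB
          -- Outside the ball the ball mass is at least its value at `δ`, so `1` is at most the cube
          -- of the quotient and the third moment takes over.
          have h1 : ballMass P z δ ^ 3 ≤ ballMass P z ‖y - z‖ ^ (3 : ℝ) := by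
            rw [show (3 : ℝ) = ((3 : ℕ) : ℝ) by norm_num, Real.rpow_natCast]
            exact pow_le_pow_left₀ hGδ.le (ballMass_mono z hle) 3
          rw [abs_mul, abs_of_nonneg (hw0 y), ← mul_assoc]
          gcongr
          · exact hw0 y
          · rw [div_mul_eq_mul_div, le_div_iff₀ (by positivity)]
            exact mul_le_mul (hK y hy) h1 (by positivity) hK0
      _ ≤ ∫ y, K / ballMass P z δ ^ 3 *
            (ballMass P z ‖y - z‖ ^ (3 : ℝ) * nnWeight P N k z y) ∂P :=
          setIntegral_le_integral ((hGi (by norm_num)).const_mul _)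
            (Eventually.of_forall fun y => mul_nonneg (by positivity) (hG0 _ y))
      _ = _ := by
          rw [integral_const_mul,
            integral_rpow_ballMass_mul_nnWeight hd hPac N k z (by norm_num)]
  rw [← integral_add_compl hBm hint, hin]
  exact (abs_add_le _ _).trans (add_le_add hE1 hE2)

end Local

/-! ### Second order expansion at an interior point -/

section Pointwise

variable {d : ℕ} {S : Set (E d)} {P : Measure (E d)} {p : E d → ℝ}

/-- On a small ball the density lies between `p z - η` and `p z + η`, and the ball mass is squeezed
between the corresponding multiples of the volume. The bound `η ≤ p z` keeps the lower density
nonnegative. -/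
theorem tendsto_ballMass_div_pow (hd : 1 ≤ d) [IsProbabilityMeasure P] (hP : HasDensityOn S P p)
    {z : E d} (hpz : ContinuousAt p z) (hpos : 0 < p z) :
    Tendsto (fun v : E d => ballMass P z ‖v‖ / ‖v‖ ^ d) (𝓝[≠] 0) (𝓝 (p z * unitVol d)) := by
  have hV := unitVol_pos d
  rw [Metric.tendsto_nhds]
  intro ε hε
  set η : ℝ := min (ε / (2 * unitVol d)) (p z) with hη
  have hη0 : 0 < η := lt_min (by positivity) hpos
  obtain ⟨r, hr, hball⟩ := Metric.continuousAt_iff.1 hpz η hη0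
  have hnear : ∀ᶠ v in 𝓝[≠] (0 : E d), ‖v‖ < r :=
    nhdsWithin_le_nhds (by
      filter_upwards [Metric.ball_mem_nhds (0 : E d) hr] with v hv
      exact mem_ball_zero_iff.1 hv)
  filter_upwards [hnear, self_mem_nhdsWithin] with v hv hv0
  have hv0' : 0 < ‖v‖ := norm_pos_iff.2 hv0
  have hb : ∀ y ∈ Metric.ball z ‖v‖, |p y - p z| < η := fun y hy => by
    have := hball (x := y) ((Metric.mem_ball.1 hy).trans hv)
    rwa [Real.dist_eq] at this
  have hηp : η ≤ p z := min_le_right _ _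
  have h1 := mul_pow_le_ballMass hd hP (a := p z - η) (by linarith) hv0'.le fun y hy => by linarith [(abs_lt.1 (hb y hy)).1]
  have h2 := ballMass_le_mul_pow hd hP (b := p z + η) (by linarith) hv0'.le
    fun y hy => by linarith [(abs_lt.1 (hb y hy)).2]
  have hηε : η * unitVol d ≤ ε / 2 := by
    calc η * unitVol d ≤ ε / (2 * unitVol d) * unitVol d := by
          gcongr; exact min_le_left _ _
      _ = ε / 2 := by field_simp
  have hpow : 0 < ‖v‖ ^ d := by positivity
  rw [Real.dist_eq, abs_lt]
  constructor
  · have : (p z - η) * unitVol d ≤ ballMass P z ‖v‖ / ‖v‖ ^ d := by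
      rw [le_div_iff₀ hpow]; exact h1
    linarith
  · have : ballMass P z ‖v‖ / ‖v‖ ^ d ≤ (p z + η) * unitVol d := by
      rw [div_le_iff₀ hpow]; exact h2
    linarith

theorem ballMass_zero (z : E d) : ballMass P z 0 = 0 := by simp [ballMass]

theorem ballMass_rpow_sub_isLittleO (hd : 1 ≤ d) [IsProbabilityMeasure P]
    (hP : HasDensityOn S P p) {z : E d} (hpz : ContinuousAt p z) (hpos : 0 < p z) :
    (fun v : E d => ballMass P z ‖v‖ ^ (2 / (d : ℝ)) -
      (p z * unitVol d) ^ (2 / (d : ℝ)) * ‖v‖ ^ 2) =o[𝓝 0] (fun v : E d => ‖v‖ ^ 2) := by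
  have hs : (0 : ℝ) < 2 / (d : ℝ) := by positivity
  have hV := unitVol_pos d
  have ht := (tendsto_ballMass_div_pow hd hP hpz hpos).rpow_const (p := 2 / (d : ℝ))
    (Or.inr hs.le)
  rw [isLittleO_iff]
  intro ε hε
  have h1 := (Metric.tendsto_nhds.1 ht) ε hε
  rw [eventually_nhdsWithin_iff] at h1
  filter_upwards [h1] with v hv
  by_cases hv0 : v = 0
  · subst hv0
    simp [ballMass_zero, Real.zero_rpow hs.ne']
  · have hn : 0 < ‖v‖ := norm_pos_iff.2 hv0
    have h2 := hv hv0
    rw [Real.dist_eq] at h2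
    have h3 : ballMass P z ‖v‖ ^ (2 / (d : ℝ)) =
        (ballMass P z ‖v‖ / ‖v‖ ^ d) ^ (2 / (d : ℝ)) * ‖v‖ ^ 2 := by
      rw [Real.div_rpow (ballMass_nonneg _ _ _) (by positivity), pow_rpow_two_div hd hn.le]
      field_simp
    rw [h3, ← sub_mul, norm_mul, Real.norm_eq_abs]
    gcongr

/-- The constant multiplying the moment `tailMoment N k (2 / d)` in the mean over the nearest
neighbours of `z`. -/
noncomputable def localCoef (p f : E d → ℝ) (z : E d) : ℝ :=
  (p z * unitVol d) ^ (-(2 / (d : ℝ))) * sphereMean p f z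

/-- The product of the expansions of `f` to second order and of `p` to first order has linear part
`p(z) f'(z) v` and quadratic part `p(z) biasForm`. The comparison function `localCoef * ballMass ^
(2/d)` contributes `sphereMean * ‖v‖²`, so what remains is a linear form and a quadratic form of
spherical mean zero. -/
theorem second_order_remainder_isLittleO (hd : 1 ≤ d) [IsProbabilityMeasure P]
    (hP : HasDensityOn S P p) {z : E d} (hpz : DifferentiableAt ℝ p z) (hpos : 0 < p z)
    {f : E d → ℝ} (hf : ContDiffAt ℝ 2 f z) :
    (fun v : E d => (f (z + v) - f z - localCoef p f z * ballMass P z ‖v‖ ^ (2 / (d : ℝ))) *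
        p (z + v) - p z * fderiv ℝ f z v -
        p z * (biasForm p f z v - sphereMean p f z * ‖v‖ ^ 2)) =o[𝓝 0]
      (fun v : E d => ‖v‖ ^ 2) := by
  have hT : Tendsto (fun v : E d => z + v) (𝓝 0) (𝓝 z) := by
    have : Continuous fun v : E d => z + v := by fun_prop
    simpa using this.tendsto 0
  have hpT : Tendsto (fun v : E d => p (z + v)) (𝓝 0) (𝓝 (p z)) := hpz.continuousAt.tendsto.comp hT
  have hp1 : (fun v : E d => p (z + v)) =O[𝓝 0] (fun _ : E d => (1 : ℝ)) := hpT.isBigO_one ℝ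
  have hp0 : (fun v : E d => p (z + v) - p z) =o[𝓝 0] (fun _ : E d => (1 : ℝ)) := by
    rw [isLittleO_one_iff]; simpa using hpT.sub_const (p z)
  have hpd : (fun v : E d => p (z + v) - p z - fderiv ℝ p z v) =o[𝓝 0] (fun v : E d => ‖v‖) :=
    (hasFDerivAt_iff_isLittleO_nhds_zero.1 hpz.hasFDerivAt).norm_right
  have hDf : (fun v : E d => fderiv ℝ f z v) =O[𝓝 0] (fun v : E d => ‖v‖) :=
    ((fderiv ℝ f z).isBigO_id _).norm_right
  have hH : (fun v : E d => hess f z v v / 2) =O[𝓝 0] (fun v : E d => ‖v‖ ^ 2) := by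
    refine IsBigO.of_bound (‖hess f z‖ / 2) (Eventually.of_forall fun v => ?_)
    have h1 := (hess f z).le_opNorm₂ v v
    rw [norm_div, Real.norm_of_nonneg (sq_nonneg ‖v‖)]
    have : ‖(2 : ℝ)‖ = 2 := by norm_num
    rw [this]
    linarith
  have hsq : (fun v : E d => ‖v‖ ^ 2) =O[𝓝 0] (fun v : E d => ‖v‖ ^ 2) := isBigO_refl _ _
  set c := localCoef p f z with hc
  set e := (p z * unitVol d) ^ (2 / (d : ℝ)) with he
  have h1 := (taylor_two_isLittleO hf).mul_isBigO hp1
  have h2 := hDf.mul_isLittleO hpd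
  have h3 := hH.mul_isLittleO hp0
  have h4 := ((ballMass_rpow_sub_isLittleO hd hP hpz.continuousAt hpos).mul_isBigO
    hp1).const_mul_left c
  have h5 := (hsq.mul_isLittleO hp0).const_mul_left (c * e)
  simp only [mul_one] at h1 h3 h4 h5
  have h2' : (fun v : E d => fderiv ℝ f z v * (p (z + v) - p z - fderiv ℝ p z v)) =o[𝓝 0]
      (fun v : E d => ‖v‖ ^ 2) := h2.congr_right fun v => (sq _).symm
  -- The five errors: the Taylor remainder of `f` times `p`; `f'(z) v` times the remainder of `p`;
  -- the Hessian term times `p(z+v) - p(z)`; the error in the ball mass; and `‖v‖²` times `p(z+v) -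
  -- p(z)`.
  refine ((((h1.add h2').add h3).sub h4).sub h5).congr_left fun v => ?_
  have hce : c * e = sphereMean p f z := by
    have hV := unitVol_pos d
    have : (p z * unitVol d) ^ (2 / (d : ℝ)) ≠ 0 := by positivity
    rw [hc, he, localCoef, Real.rpow_neg (by positivity)]
    field_simp
  rw [biasForm_eq hpz (hf.differentiableAt (by norm_num)), ← hce]
  have := hpos.ne'
  field_simp
  ring

/-- Expansion of the mean over the nearest neighbours of an interior point. -/
theorem abs_integral_sub_localCoef_le (hd : 1 ≤ d) [IsProbabilityMeasure P]
    (hP : HasDensityOn S P p) {a : ℝ} (ha : 0 < a) (hpa : ∀ y ∈ S, a ≤ p y) {z : E d}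
    (hz : z ∈ interior S) (hpz : DifferentiableAt ℝ p z) {f : E d → ℝ} (hfm : Measurable f)
    (hf : ContDiffAt ℝ 2 f z) {K : ℝ} (hK : ∀ y ∈ S, |f y - f z| ≤ K) {ε : ℝ} (hε : 0 < ε) :
    ∃ C, ∀ N k : ℕ, 1 ≤ k → k ≤ N + 1 →
      |∫ y, (f y - f z) * nnWeight P N k z y ∂P - localCoef p f z * tailMoment N k (2 / (d : ℝ))| ≤
        ε * tailMoment N k (2 / (d : ℝ)) + C * tailMoment N k 3 := by
  have hPac := hP.absolutelyContinuous
  have hpos : 0 < p z := ha.trans_le (hpa z (interior_subset hz))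
  set c := localCoef p f z with hc
  have hV := unitVol_pos d
  -- `κ` is the factor by which `abs_integral_mul_nnWeight_le` multiplies the local error; the
  -- remainder is therefore taken with constant `ε / κ`.
  set κ := a⁻¹ * (a * unitVol d) ^ (-(2 / (d : ℝ))) with hκ
  have hκ0 : 0 < κ := by positivity
  have hs : (0 : ℝ) ≤ 2 / (d : ℝ) := by positivity
  have hlo := (second_order_remainder_isLittleO hd hP hpz hpos hf).def (div_pos hε hκ0)
  obtain ⟨δ₁, hδ₁, hball₁⟩ := Metric.eventually_nhds_iff_ball.1 hlo
  obtain ⟨δ₂, hδ₂, hball₂⟩ := Metric.isOpen_iff.1 isOpen_interior z hz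
  set δ := min δ₁ δ₂ with hδ
  have hδ0 : 0 < δ := lt_min hδ₁ hδ₂
  have hzS : Metric.ball z δ ⊆ S :=
    ((Metric.ball_subset_ball (min_le_right _ _)).trans hball₂).trans interior_subset
  -- `K + |c|` bounds the difference of the increment and the comparison function on `S`, since the
  -- ball mass is at most one.
  refine ⟨(K + |c|) / ballMass P z δ ^ 3, fun N k hk hkN => ?_⟩
  have hGm : Measurable fun y => ballMass P z ‖y - z‖ ^ (2 / (d : ℝ)) :=
    (measurable_ballMass_norm_sub z).pow_const _
  have hmain := abs_integral_mul_nnWeight_le hd hP ha hpa hδ0 hzS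
    (h := fun y => f y - f z - c * ballMass P z ‖y - z‖ ^ (2 / (d : ℝ)))
    ((hfm.sub_const _).sub (hGm.const_mul c)) (K := K + |c|) ?_ (p z • fderiv ℝ f z)
    (q := fun v => p z * (biasForm p f z v - sphereMean p f z * ‖v‖ ^ 2))
    (by have := continuous_biasForm p f z; fun_prop) ?_ ?_ (ε := ε / κ) (by positivity) ?_ N k
  · obtain ⟨C, hC⟩ := exists_nnWeight_le P N k
    have hwm := measurable_nnWeight (P := P) N k z
    have hwC : ∀ y, |nnWeight P N k z y| ≤ C := fun y => by
      rw [abs_of_nonneg (nnWeight_nonneg _ _ _ _)]; exact hC z y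
    have i1 : Integrable (fun y => (f y - f z) * nnWeight P N k z y) P := by
      refine Integrable.of_bound ((hfm.sub_const _).mul hwm).aestronglyMeasurable (K * C) ?_
      filter_upwards [hP.ae_mem] with y hy
      rw [Real.norm_eq_abs, abs_mul]
      exact mul_le_mul (hK y hy) (hwC y) (abs_nonneg _) ((abs_nonneg _).trans (hK y hy))
    have i2 : Integrable (fun y => c * (ballMass P z ‖y - z‖ ^ (2 / (d : ℝ)) *
        nnWeight P N k z y)) P := by
      refine (integrable_of_bounded (hGm.mul hwm) (C := 1 * C) fun y => ?_).const_mul c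
      rw [Pi.mul_apply, abs_mul, abs_of_nonneg (Real.rpow_nonneg (ballMass_nonneg _ _ _) _)]
      exact mul_le_mul (Real.rpow_le_one (ballMass_nonneg _ _ _) (ballMass_le_one _ _) hs)
        (hwC y) (abs_nonneg _) zero_le_one
    have h1 : ∫ y, (f y - f z - c * ballMass P z ‖y - z‖ ^ (2 / (d : ℝ))) *
        nnWeight P N k z y ∂P =
        ∫ y, (f y - f z) * nnWeight P N k z y ∂P - c * tailMoment N k (2 / (d : ℝ)) := by
      rw [← integral_rpow_ballMass_mul_nnWeight hd hPac N k z hs, ← integral_const_mul,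
        ← integral_sub i1 i2]
      congr 1; ext y; ring
    rw [h1] at hmain
    refine hmain.trans (le_of_eq ?_)
    have : ε / κ * a⁻¹ * (a * unitVol d) ^ (-(2 / (d : ℝ))) = ε := by
      rw [mul_assoc, ← hκ, div_mul_cancel₀ _ hκ0.ne']
    rw [this]
  · intro y hy
    refine (abs_sub _ _).trans (add_le_add (hK y hy) ?_)
    rw [abs_mul, abs_of_nonneg (Real.rpow_nonneg (ballMass_nonneg _ _ _) _)]
    exact mul_le_of_le_one_right (abs_nonneg _)
      (Real.rpow_le_one (ballMass_nonneg _ _ _) (ballMass_le_one _ _) hs)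
  · intro r v
    simp only [biasForm_smul, norm_smul, mul_pow, Real.norm_eq_abs, sq_abs]
    ring
  · rw [integral_const_mul, integral_sphere_biasForm_sub hd, mul_zero]
  · intro y hy
    have := hball₁ (y - z) (by
      rw [mem_ball_zero_iff, ← dist_eq_norm]
      exact (Metric.mem_ball.1 hy).trans_le (min_le_left _ _))
    rw [add_sub_cancel, Real.norm_eq_abs, Real.norm_of_nonneg (sq_nonneg _)] at this
    exact this

/-- A bound for the mean over the nearest neighbours which is uniform in points at distance at
least `δ` from the complement of `S`. -/
theorem abs_integral_nnWeight_le (hd : 1 ≤ d) [IsProbabilityMeasure P]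
    (hP : HasDensityOn S P p) {a : ℝ} (ha : 0 < a) (hpa : ∀ y ∈ S, a ≤ p y) {b : ℝ}
    (hpb : ∀ y ∈ S, p y ≤ b) {Kp : ℝ≥0} (hpL : LipschitzOnWith Kp p S) {z : E d} {δ : ℝ}
    (hδ : 0 < δ) (hz : Metric.ball z δ ⊆ S) {f : E d → ℝ} (hfm : Measurable f) {M K : ℝ}
    (L : E d →L[ℝ] ℝ) (hL : ‖L‖ ≤ M) (hf : ∀ y ∈ S, |f y - f z - L (y - z)| ≤ M * ‖y - z‖ ^ 2)
    (hK : ∀ y ∈ S, |f y - f z| ≤ K) (N k : ℕ) :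
    |∫ y, (f y - f z) * nnWeight P N k z y ∂P| ≤
      (M * b + M * Kp) * a⁻¹ * (a * unitVol d) ^ (-(2 / (d : ℝ))) * tailMoment N k (2 / (d : ℝ)) +
        K / (a * unitVol d * δ ^ d) ^ 3 * tailMoment N k 3 := by
  have hzS : z ∈ S := hz (Metric.mem_ball_self hδ)
  have hM0 : 0 ≤ M := (norm_nonneg L).trans hL
  have hb0 : 0 ≤ b := (ha.le.trans (hpa z hzS)).trans (hpb z hzS)
  have hK0 : 0 ≤ K := (abs_nonneg _).trans (hK z hzS)
  have hV := unitVol_pos d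
  refine (abs_integral_mul_nnWeight_le hd hP ha hpa hδ hz (hfm.sub_const _) hK (p z • L)
    (q := fun _ => 0) continuous_const (by simp) (by simp) (ε := M * b + M * Kp) (by positivity)
    ?_ N k).trans ?_
  · intro y hy
    have hyS := hz hy
    have h1 := hpL.dist_le_mul y hyS z hzS
    rw [Real.dist_eq, dist_eq_norm] at h1
    have h2 : |L (y - z)| ≤ M * ‖y - z‖ :=
      (L.le_opNorm _).trans (by gcongr)
    -- No second order term is extracted here: the Taylor error of `f` costs `M b` and the variation
    -- of `p` along the linear part costs `M Kp`, which explains `M * b + M * Kp`.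
    have h3 : (f y - f z) * p y - (p z • L) (y - z) - 0 =
        (f y - f z - L (y - z)) * p y + L (y - z) * (p y - p z) := by
      simp only [smul_apply, smul_eq_mul]; ring
    rw [h3]
    calc _ ≤ |f y - f z - L (y - z)| * |p y| + |L (y - z)| * |p y - p z| := by
          rw [← abs_mul, ← abs_mul]; exact abs_add_le _ _
      _ ≤ M * ‖y - z‖ ^ 2 * b + M * ‖y - z‖ * (Kp * ‖y - z‖) := by
          rw [abs_of_nonneg (hP.nonneg y)]
          have := hP.nonneg y
          gcongr
          exacts [hf y hyS, hpb y hyS]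
      _ = _ := by ring
  · have h1 := mul_pow_le_ballMass hd hP ha.le hδ.le fun y hy => hpa y (hz hy)
    have h2 := tailMoment_nonneg N k 3
    gcongr

end Pointwise

/-! ### The expected bias -/

/-- The standing assumptions on the domain, the densities and the regression function `F`, in the
form in which the bias computation uses them; `φ z y` is the increment `F z y - F z z`, truncated
to `S`. -/
structure BiasSetting {d : ℕ} (S : Set (E d)) (P Q : Measure (E d)) (p : E d → ℝ)
    (F φ : E d → E d → ℝ) (a b M D δ : ℝ) (Kp : ℝ≥0) : Prop where
  one_le : 1 ≤ d
  density : HasDensityOn S P p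
  a_pos : 0 < a
  le_p : ∀ y ∈ S, a ≤ p y
  p_le : ∀ y ∈ S, p y ≤ b
  p_lip : LipschitzOnWith Kp p S
  p_diff : ∀ z ∈ interior S, DifferentiableAt ℝ p z
  δ_pos : 0 < δ
  ball_subset : ∀ᵐ z ∂Q, Metric.ball z δ ⊆ S
  F_meas : ∀ z, Measurable (F z)
  φ_meas : Measurable fun q : E d × E d => φ q.1 q.2
  φ_eq : ∀ z ∈ S, ∀ y ∈ S, φ z y = F z y - F z z
  contDiffAt : ∀ z ∈ interior S, ContDiffAt ℝ 2 (F z) z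
  taylor : ∀ z ∈ S, ∃ L : E d →L[ℝ] ℝ, ‖L‖ ≤ M ∧
    ∀ y ∈ S, |F z y - F z z - L (y - z)| ≤ M * ‖y - z‖ ^ 2
  φ_lip : ∀ z ∈ S, ∀ y ∈ S, |φ z y| ≤ M * ‖y - z‖
  φ_le : ∀ z y, |φ z y| ≤ M * D
  norm_sub_le : ∀ z ∈ S, ∀ y ∈ S, ‖y - z‖ ≤ D
  Q_le : ∀ A : Set (E d), Q A ≤ ENNReal.ofReal b * volume A

/-- The mean of `φ z` over the law of the `k` nearest neighbours of `z`. -/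
noncomputable def nnMean {d : ℕ} (P : Measure (E d)) (φ : E d → E d → ℝ) (N k : ℕ) (z : E d) : ℝ :=
  ∫ y, φ z y * nnWeight P N k z y ∂P

theorem measurable_nnWeight_prod {d : ℕ} (P : Measure (E d)) [IsProbabilityMeasure P] (N k : ℕ) :
    Measurable fun q : E d × E d => nnWeight P N k q.1 q.2 := by
  have h1 : Measurable fun w : E d × ℝ => ballMass P w.1 w.2 := by
    have hs : MeasurableSet {v : (E d × ℝ) × E d | ‖v.2 - v.1.1‖ < v.1.2} :=
      measurableSet_lt (by fun_prop) (by fun_prop)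
    have := (measurable_measure_prodMk_left (ν := P) hs).ennreal_toReal
    convert! this using 2 with w
  have h2 : Measurable fun q : E d × E d => ballMass P q.1 ‖q.2 - q.1‖ :=
    h1.comp (f := fun q : E d × E d => (q.1, ‖q.2 - q.1‖)) (by fun_prop)
  exact ((continuous_binTail N k).measurable.comp h2).const_mul _

namespace BiasSetting

variable {d : ℕ} {S : Set (E d)} {P Q : Measure (E d)} {p : E d → ℝ} {F φ : E d → E d → ℝ}
  {a b M D δ : ℝ} {Kp : ℝ≥0} [IsProbabilityMeasure P] [IsProbabilityMeasure Q]

omit [IsProbabilityMeasure P] [IsProbabilityMeasure Q] in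
theorem ae_mem_interior (H : BiasSetting S P Q p F φ a b M D δ Kp) :
    ∀ᵐ z ∂Q, z ∈ interior S := by
  filter_upwards [H.ball_subset] with z hz
  exact mem_interior.2 ⟨_, hz, Metric.isOpen_ball, Metric.mem_ball_self H.δ_pos⟩

omit [IsProbabilityMeasure Q] in
theorem measurable_nnMean (H : BiasSetting S P Q p F φ a b M D δ Kp) (N k : ℕ) :
    Measurable (nnMean P φ N k) :=
  ((H.φ_meas.mul (measurable_nnWeight_prod P N k)).stronglyMeasurable.integral_prod_right'
    (ν := P)).measurable

omit [IsProbabilityMeasure P] [IsProbabilityMeasure Q] in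
theorem nnMean_eq (H : BiasSetting S P Q p F φ a b M D δ Kp) (N k : ℕ) {z : E d} (hz : z ∈ S) :
    nnMean P φ N k z = ∫ y, (F z y - F z z) * nnWeight P N k z y ∂P := by
  refine integral_congr_ae ?_
  filter_upwards [H.density.ae_mem] with y hy
  rw [H.φ_eq z hz y hy]

omit [IsProbabilityMeasure P] [IsProbabilityMeasure Q] in
theorem abs_F_sub_le (H : BiasSetting S P Q p F φ a b M D δ Kp) {z : E d} (hz : z ∈ S) :
    ∀ y ∈ S, |F z y - F z z| ≤ M * D := fun y hy => by
  rw [← H.φ_eq z hz y hy]; exact H.φ_le z y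

omit [IsProbabilityMeasure P] in
theorem b_nonneg (H : BiasSetting S P Q p F φ a b M D δ Kp) : 0 ≤ b := by
  obtain ⟨z, hz⟩ := H.ae_mem_interior.exists
  exact (H.a_pos.le.trans (H.le_p z (interior_subset hz))).trans (H.p_le z (interior_subset hz))

omit [IsProbabilityMeasure P] in
theorem M_nonneg (H : BiasSetting S P Q p F φ a b M D δ Kp) : 0 ≤ M := by
  obtain ⟨z, hz⟩ := H.ae_mem_interior.exists
  obtain ⟨L, hL, -⟩ := H.taylor z (interior_subset hz)
  exact (norm_nonneg L).trans hL

omit [IsProbabilityMeasure P] in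
theorem D_nonneg (H : BiasSetting S P Q p F φ a b M D δ Kp) : 0 ≤ D := by
  obtain ⟨z, hz⟩ := H.ae_mem_interior.exists
  exact (norm_nonneg _).trans (H.norm_sub_le z (interior_subset hz) z (interior_subset hz))

omit [IsProbabilityMeasure P] [IsProbabilityMeasure Q] in
theorem two_div_pos (H : BiasSetting S P Q p F φ a b M D δ Kp) : (0 : ℝ) < 2 / (d : ℝ) := by
  have := H.one_le; positivity

omit [IsProbabilityMeasure P] [IsProbabilityMeasure Q] in
theorem two_div_le (H : BiasSetting S P Q p F φ a b M D δ Kp) : (2 : ℝ) / (d : ℝ) ≤ 2 := by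
  have : (1 : ℝ) ≤ d := by exact_mod_cast H.one_le
  exact div_le_self (by norm_num) this

/-- Provides the dominating function. The constants depend on `z` only through `δ`, and `t ^ 3 ≤ t ^
(2/d)` because `t ≤ 1` and `2/d ≤ 2`. -/
theorem exists_abs_nnMean_le (H : BiasSetting S P Q p F φ a b M D δ Kp) :
    ∃ C, 0 ≤ C ∧ ∀ᵐ z ∂Q, ∀ N k : ℕ, 1 ≤ k → k ≤ N + 1 →
      |nnMean P φ N k z| ≤ C * ((k : ℝ) / (N + 1 : ℕ)) ^ (2 / (d : ℝ)) := by
  have hs := H.two_div_pos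
  have hs2 := H.two_div_le
  set C1 := (M * b + M * Kp) * a⁻¹ * (a * unitVol d) ^ (-(2 / (d : ℝ))) with hC1
  set C2 := M * D / (a * unitVol d * δ ^ d) ^ 3 with hC2
  have hM := H.M_nonneg
  have hb := H.b_nonneg
  have hD := H.D_nonneg
  have ha := H.a_pos
  have hδ := H.δ_pos
  have hV := unitVol_pos d
  have h1 : 0 ≤ C1 := by positivity
  have h2 : 0 ≤ C2 := by positivity
  refine ⟨C1 * 7 + C2 * 6, by positivity, ?_⟩
  filter_upwards [H.ball_subset] with z hz N k hk hkN
  have hzS : z ∈ S := hz (Metric.mem_ball_self H.δ_pos)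
  obtain ⟨L, hL, hT⟩ := H.taylor z hzS
  rw [H.nnMean_eq N k hzS]
  refine (abs_integral_nnWeight_le H.one_le H.density ha H.le_p H.p_le H.p_lip hδ hz (H.F_meas z)
    L hL hT (H.abs_F_sub_le hzS) N k).trans ?_
  set t : ℝ := (k : ℝ) / (N + 1 : ℕ) with ht
  have ht0 : 0 < t := by positivity
  have ht1 : t ≤ 1 := by
    rw [ht, div_le_one (by positivity)]; exact_mod_cast hkN
  have h3 := tailMoment_le hk hkN hs.le (by linarith)
  have h4 := tailMoment_three_le hk hkN
  have h5 : t ^ 3 ≤ t ^ (2 / (d : ℝ)) := by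
    rw [← Real.rpow_natCast]
    exact Real.rpow_le_rpow_of_exponent_ge ht0 ht1 (by push_cast; linarith)
  calc _ ≤ C1 * (7 * t ^ (2 / (d : ℝ))) + C2 * (6 * t ^ (2 / (d : ℝ))) := by
        gcongr
        exact h4.trans (by gcongr)
    _ = _ := by ring

omit [IsProbabilityMeasure Q] in
-- First the exact moment is split off, with an error that may contain a third moment; that error is
-- smaller than the main scale by the factor `(k/n) ^ (3 - 2/d)`, whose exponent is positive. Then
-- the moment is replaced by its asymptotic form.
theorem nnMean_sub_isLittleO (H : BiasSetting S P Q p F φ a b M D δ Kp) {z : E d}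
    (hz : z ∈ interior S) {k : ℕ → ℕ} (hk : ∀ n, 1 ≤ n → 1 ≤ k n ∧ k n ≤ n)
    (hkn : Tendsto (fun n => (k n : ℝ) / n) atTop (𝓝 0)) :
    (fun n : ℕ => nnMean P φ (n - 1) (k n) z -
        localCoef p (F z) z * (gammaMean (k n) (2 / (d : ℝ)) * (n : ℝ) ^ (-(2 / (d : ℝ)))))
      =o[atTop] (fun n : ℕ => ((k n : ℝ) / n) ^ (2 / (d : ℝ))) := by
  have hs := H.two_div_pos
  have hs2 := H.two_div_le
  have hzS := interior_subset hz
  have h1 := (isLittleO_tailMoment_sub hk hs (by linarith)).const_mul_left (localCoef p (F z) z)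
  have h2 : (fun n : ℕ => nnMean P φ (n - 1) (k n) z -
      localCoef p (F z) z * tailMoment (n - 1) (k n) (2 / (d : ℝ)))
      =o[atTop] (fun n : ℕ => ((k n : ℝ) / n) ^ (2 / (d : ℝ))) := by
    rw [isLittleO_iff]
    intro ε hε
    -- The moment of order `2/d` is at most `7` times the scale, so `ε / 14` yields `ε / 2`; the
    -- third moment supplies the other half.
    obtain ⟨C, hC⟩ := abs_integral_sub_localCoef_le H.one_le H.density H.a_pos H.le_p hz
      (H.p_diff z hz) (H.F_meas z) (H.contDiffAt z hz) (H.abs_F_sub_le hzS)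
      (ε := ε / 14) (by positivity)
    have h3 : Tendsto (fun n => ((k n : ℝ) / n) ^ (3 - 2 / (d : ℝ))) atTop (𝓝 0) := by
      have := hkn.rpow_const (p := 3 - 2 / (d : ℝ)) (Or.inr (by linarith))
      rwa [Real.zero_rpow (by linarith)] at this
    have h4 : Tendsto (fun n => 6 * |C| * ((k n : ℝ) / n) ^ (3 - 2 / (d : ℝ))) atTop (𝓝 0) := by
      simpa using h3.const_mul (6 * |C|)
    filter_upwards [eventually_ge_atTop 1, h4.eventually (ge_mem_nhds (half_pos hε))] with n hn hn4
    obtain ⟨hk1, hk2⟩ := hk n hn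
    obtain ⟨N, rfl⟩ : ∃ N, n = N + 1 := ⟨n - 1, by omega⟩
    rw [Nat.add_sub_cancel, H.nnMean_eq N _ hzS]
    set t : ℝ := (k (N + 1) : ℝ) / (N + 1 : ℕ) with ht
    have ht0 : 0 < t := by positivity
    rw [Real.norm_eq_abs, Real.norm_of_nonneg (by positivity)]
    refine (hC N _ hk1 hk2).trans ?_
    have h5 := tailMoment_le hk1 hk2 hs.le (by linarith)
    have h6 := tailMoment_three_le hk1 hk2
    have h7 : t ^ 3 = t ^ (3 - 2 / (d : ℝ)) * t ^ (2 / (d : ℝ)) := by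
      rw [← Real.rpow_add ht0, ← Real.rpow_natCast]; congr 1; push_cast; ring
    have h8 : C * tailMoment N (k (N + 1)) 3 ≤ |C| * (6 * t ^ 3) :=
      mul_le_mul (le_abs_self C) h6 (tailMoment_nonneg _ _ _) (abs_nonneg _)
    have h9 : |C| * (6 * t ^ 3) ≤ ε / 2 * t ^ (2 / (d : ℝ)) := by
      rw [h7]
      calc _ = 6 * |C| * t ^ (3 - 2 / (d : ℝ)) * t ^ (2 / (d : ℝ)) := by ring
        _ ≤ _ := by gcongr
    have h10 : ε / 14 * tailMoment N (k (N + 1)) (2 / (d : ℝ)) ≤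
        ε / 14 * (7 * t ^ (2 / (d : ℝ))) := by gcongr
    linarith
  refine (h2.add h1).congr_left fun n => ?_
  ring

theorem gammaMean_mul_rpow_le {k : ℕ → ℕ} (hk : ∀ n, 1 ≤ n → 1 ≤ k n ∧ k n ≤ n) {s : ℝ} (hs : 0 < s)
    (hs3 : s ≤ 3) {n : ℕ} (hn : 1 ≤ n) :
    gammaMean (k n) s * (n : ℝ) ^ (-s) ≤ 7 * ((k n : ℝ) / n) ^ s := by
  rw [Real.div_rpow (by positivity) (by positivity), Real.rpow_neg (by positivity),
    div_eq_mul_inv, ← mul_assoc]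
  gcongr
  exact gammaMean_le (hk n hn).1 hs hs3

omit [IsProbabilityMeasure Q] in
/-- The case of a single neighbour determines the leading constant. -/
theorem tendsto_nnMean_one (H : BiasSetting S P Q p F φ a b M D δ Kp) {z : E d}
    (hz : z ∈ interior S) :
    Tendsto (fun n : ℕ => (gammaMean 1 (2 / (d : ℝ)))⁻¹ * (n : ℝ) ^ (2 / (d : ℝ)) *
      nnMean P φ (n - 1) 1 z) atTop (𝓝 (localCoef p (F z) z)) := by
  have hs := H.two_div_pos
  have hg : 0 < gammaMean 1 (2 / (d : ℝ)) := by
    simp only [gammaMean, Nat.cast_one, inv_one, Finset.Icc_self, Finset.sum_singleton, one_mul]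
    exact div_pos (Real.Gamma_pos_of_pos (by positivity)) (Real.Gamma_pos_of_pos one_pos)
  have hkn : Tendsto (fun n : ℕ => ((1 : ℕ) : ℝ) / n) atTop (𝓝 0) := by
    simpa using tendsto_inv_atTop_nhds_zero_nat (𝕜 := ℝ)
  have h := H.nnMean_sub_isLittleO hz (k := fun _ => 1) (fun n hn => ⟨le_rfl, hn⟩) hkn
  have h1 := (h.tendsto_div_nhds_zero).const_mul (gammaMean 1 (2 / (d : ℝ)))⁻¹
  rw [mul_zero] at h1
  have h2 := h1.add_const (localCoef p (F z) z)
  rw [zero_add] at h2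
  refine h2.congr' ?_
  filter_upwards [eventually_ge_atTop 1] with n hn
  have hn0 : (0 : ℝ) < n := by exact_mod_cast hn
  have h3 : (n : ℝ) ^ (2 / (d : ℝ)) ≠ 0 := by positivity
  rw [Nat.cast_one, one_div, Real.inv_rpow hn0.le, Real.rpow_neg hn0.le]
  field_simp
  ring

omit [IsProbabilityMeasure Q] in
-- `localCoef` involves derivatives of `F z` at the point `z` itself, with the function varying with
-- `z`. Its measurability is obtained by writing it as an almost everywhere limit of normalised
-- one-neighbour means, which are measurable by Fubini.
theorem aestronglyMeasurable_localCoef (H : BiasSetting S P Q p F φ a b M D δ Kp) :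
    AEStronglyMeasurable (fun z => localCoef p (F z) z) Q := by
  refine aestronglyMeasurable_of_tendsto_ae atTop
    (f := fun (n : ℕ) z => (gammaMean 1 (2 / (d : ℝ)))⁻¹ * (n : ℝ) ^ (2 / (d : ℝ)) *
      nnMean P φ (n - 1) 1 z)
    (fun n => ((H.measurable_nnMean _ _).const_mul _).aestronglyMeasurable) ?_
  filter_upwards [H.ae_mem_interior] with z hz using H.tendsto_nnMean_one hz

/-- The uniform bound for the one-neighbour means passes to the same limit. -/
theorem exists_abs_localCoef_le (H : BiasSetting S P Q p F φ a b M D δ Kp) :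
    ∃ C, ∀ᵐ z ∂Q, |localCoef p (F z) z| ≤ C := by
  obtain ⟨C, hC0, hC⟩ := H.exists_abs_nnMean_le
  refine ⟨|(gammaMean 1 (2 / (d : ℝ)))⁻¹| * C, ?_⟩
  filter_upwards [H.ae_mem_interior, hC] with z hz hCz
  refine le_of_tendsto (H.tendsto_nnMean_one hz).abs ?_
  filter_upwards [eventually_ge_atTop 1] with n hn
  obtain ⟨N, rfl⟩ : ∃ N, n = N + 1 := ⟨n - 1, by omega⟩
  have h := hCz N 1 le_rfl (by omega)
  rw [Nat.cast_one, one_div, Real.inv_rpow (by positivity)] at h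
  rw [Nat.add_sub_cancel, abs_mul, abs_mul, abs_of_nonneg (Real.rpow_nonneg (Nat.cast_nonneg _) _),
    mul_assoc]
  gcongr
  calc _ ≤ ((N + 1 : ℕ) : ℝ) ^ (2 / (d : ℝ)) * (C * (((N + 1 : ℕ) : ℝ) ^ (2 / (d : ℝ)))⁻¹) := by
        gcongr
    _ = C := by
        have : ((N + 1 : ℕ) : ℝ) ^ (2 / (d : ℝ)) ≠ 0 := by positivity
        field_simp

/-- The first-order expansion of the mean bias. -/
theorem integral_nnMean_sub_isLittleO (H : BiasSetting S P Q p F φ a b M D δ Kp) {k : ℕ → ℕ}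
    (hk : ∀ n, 1 ≤ n → 1 ≤ k n ∧ k n ≤ n)
    (hkn : Tendsto (fun n => (k n : ℝ) / n) atTop (𝓝 0)) :
    (fun n : ℕ => (∫ z, nnMean P φ (n - 1) (k n) z ∂Q) -
        (gammaMean (k n) (2 / (d : ℝ)) * ∫ z, localCoef p (F z) z ∂Q) *
          (n : ℝ) ^ (-(2 / (d : ℝ))))
      =o[atTop] (fun n : ℕ => ((k n : ℝ) / n) ^ (2 / (d : ℝ))) := by
  have hs := H.two_div_pos
  have hs2 := H.two_div_le
  obtain ⟨C, hC0, hC⟩ := H.exists_abs_nnMean_le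
  obtain ⟨C', hC'⟩ := H.exists_abs_localCoef_le
  have hci : Integrable (fun z => localCoef p (F z) z) Q :=
    Integrable.of_bound H.aestronglyMeasurable_localCoef C' hC'
  have hlam : ∀ n, 1 ≤ n → 0 < ((k n : ℝ) / n) ^ (2 / (d : ℝ)) := fun n hn => by
    have := (hk n hn).1
    positivity
  -- Dominated convergence for the error divided by its scale: it is uniformly bounded almost
  -- everywhere and tends to zero at interior points.
  have hdom : Tendsto (fun n : ℕ => ∫ z, (nnMean P φ (n - 1) (k n) z -
      localCoef p (F z) z * (gammaMean (k n) (2 / (d : ℝ)) * (n : ℝ) ^ (-(2 / (d : ℝ))))) /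
      ((k n : ℝ) / n) ^ (2 / (d : ℝ)) ∂Q) atTop (𝓝 (∫ _, (0 : ℝ) ∂Q)) := by
    refine tendsto_integral_filter_of_dominated_convergence (fun _ => C + C' * 7) ?_ ?_
      (integrable_const _) ?_
    · refine Eventually.of_forall fun n => ?_
      simp_rw [div_eq_mul_inv]
      exact ((H.measurable_nnMean _ _).aestronglyMeasurable.sub
        (H.aestronglyMeasurable_localCoef.mul_const _)).mul_const _
    · filter_upwards [eventually_ge_atTop 1] with n hn
      filter_upwards [hC, hC'] with z hz hz'
      have h0 := hlam n hn
      rw [norm_div, Real.norm_of_nonneg h0.le, div_le_iff₀ h0, Real.norm_eq_abs]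
      have hg := gammaMean_mul_rpow_le hk hs (by linarith) hn
      have hg0 : 0 ≤ gammaMean (k n) (2 / (d : ℝ)) * (n : ℝ) ^ (-(2 / (d : ℝ))) :=
        mul_nonneg (gammaMean_nonneg _ hs.le) (by positivity)
      have h1 : |nnMean P φ (n - 1) (k n) z| ≤ C * ((k n : ℝ) / n) ^ (2 / (d : ℝ)) := by
        have := hz (n - 1) (k n) (hk n hn).1 (by have := (hk n hn).2; omega)
        rwa [Nat.sub_add_cancel hn] at this
      refine (abs_sub _ _).trans ?_
      rw [abs_mul, abs_of_nonneg hg0]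
      have h2 : |localCoef p (F z) z| * (gammaMean (k n) (2 / (d : ℝ)) *
          (n : ℝ) ^ (-(2 / (d : ℝ)))) ≤ C' * (7 * ((k n : ℝ) / n) ^ (2 / (d : ℝ))) :=
        mul_le_mul hz' hg hg0 ((abs_nonneg _).trans hz')
      linarith
    · filter_upwards [H.ae_mem_interior] with z hz
      exact (H.nnMean_sub_isLittleO hz hk hkn).tendsto_div_nhds_zero
  rw [integral_zero] at hdom
  have hne : ∀ᶠ n : ℕ in atTop, ((k n : ℝ) / n) ^ (2 / (d : ℝ)) = 0 →
      (∫ z, nnMean P φ (n - 1) (k n) z ∂Q) -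
        (gammaMean (k n) (2 / (d : ℝ)) * ∫ z, localCoef p (F z) z ∂Q) *
          (n : ℝ) ^ (-(2 / (d : ℝ))) = 0 := by
    filter_upwards [eventually_ge_atTop 1] with n hn h
    exact absurd h (hlam n hn).ne'
  rw [isLittleO_iff_tendsto' hne]
  refine hdom.congr' ?_
  filter_upwards [eventually_ge_atTop 1] with n hn
  have hi : Integrable (nnMean P φ (n - 1) (k n)) Q := by
    refine Integrable.of_bound (H.measurable_nnMean _ _).aestronglyMeasurable
      (C * ((k n : ℝ) / n) ^ (2 / (d : ℝ))) ?_
    filter_upwards [hC] with z hz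
    have := hz (n - 1) (k n) (hk n hn).1 (by have := (hk n hn).2; omega)
    rwa [Nat.sub_add_cancel hn] at this
  rw [integral_div, integral_sub hi (hci.mul_const _), integral_mul_const]
  ring

end BiasSetting

/-! ### The bias as a function of the sample -/

/-- The conditional bias of nearest neighbour matching given the sample `x`. -/
noncomputable def nnBias {d : ℕ} {ι : Type*} (Q : Measure (E d)) (φ : E d → E d → ℝ)
    (s : Finset ι) (k : ℕ) (x : ι → E d) : ℝ :=
  ∫ z, (k : ℝ)⁻¹ * ∑ i ∈ lowRank s k (fun j => ‖x j - z‖), φ z (x i) ∂Q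

section Measurability

variable {d : ℕ} {ι : Type*}

theorem measurable_sum_lowRank (s : Finset ι) (k : ℕ) {φ : E d → E d → ℝ}
    (hφ : Measurable fun q : E d × E d => φ q.1 q.2) :
    Measurable fun w : (ι → E d) × E d =>
      ∑ i ∈ lowRank s k (fun j => ‖w.1 j - w.2‖), φ w.2 (w.1 i) := by
  classical
  have h : ∀ w : (ι → E d) × E d, ∑ i ∈ lowRank s k (fun j => ‖w.1 j - w.2‖), φ w.2 (w.1 i) =
      ∑ i ∈ s, if i ∈ lowRank s k (fun j => ‖w.1 j - w.2‖) then φ w.2 (w.1 i) else 0 := by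
    intro w
    rw [← Finset.sum_filter]
    congr 1
    ext i
    simp only [Finset.mem_filter]
    exact ⟨fun hi => ⟨lowRank_subset _ _ _ hi, hi⟩, fun hi => hi.2⟩
  simp_rw [h]
  refine Finset.measurable_sum _ fun i _ => ?_
  refine Measurable.ite (measurableSet_mem_lowRank s k
    (r := fun w : (ι → E d) × E d => fun j => ‖w.1 j - w.2‖) (fun j => by fun_prop) i) ?_
    measurable_const
  exact hφ.comp (f := fun w : (ι → E d) × E d => (w.2, w.1 i)) (by fun_prop)

theorem measurable_nnBias (Q : Measure (E d)) [SFinite Q] (s : Finset ι) (k : ℕ)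
    {φ : E d → E d → ℝ} (hφ : Measurable fun q : E d × E d => φ q.1 q.2) :
    Measurable (nnBias Q φ s k) :=
  (((measurable_sum_lowRank s k hφ).const_mul _).stronglyMeasurable.integral_prod_right'
    (ν := Q)).measurable

/-- With ties the rank set may have more than `k` elements, so the bound uses the size of `s`. It
holds at every `x` and `z` and serves only for integrability. -/
theorem abs_mean_lowRank_le (s : Finset ι) (k : ℕ) {φ : E d → E d → ℝ} {B : ℝ}
    (hB : ∀ z y, |φ z y| ≤ B) (x : ι → E d) (z : E d) :
    |(k : ℝ)⁻¹ * ∑ i ∈ lowRank s k (fun j => ‖x j - z‖), φ z (x i)| ≤ s.card * B := by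
  have hB0 : 0 ≤ B := (abs_nonneg _).trans (hB 0 0)
  rw [abs_mul, abs_of_nonneg (by positivity)]
  have h1 : |∑ i ∈ lowRank s k (fun j => ‖x j - z‖), φ z (x i)| ≤ s.card * B := by
    refine (Finset.abs_sum_le_sum_abs _ _).trans ?_
    refine (Finset.sum_le_card_nsmul _ _ B fun i _ => hB _ _).trans ?_
    rw [nsmul_eq_mul]
    gcongr
    exact lowRank_subset _ _ _
  refine le_trans (mul_le_of_le_one_left (abs_nonneg _) ?_) h1
  rcases Nat.eq_zero_or_pos k with rfl | hk
  · simp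
  · exact inv_le_one_of_one_le₀ (by exact_mod_cast hk)

theorem abs_nnBias_le (Q : Measure (E d)) [IsProbabilityMeasure Q] (s : Finset ι) (k : ℕ)
    {φ : E d → E d → ℝ} {B : ℝ} (hB : ∀ z y, |φ z y| ≤ B) (x : ι → E d) :
    |nnBias Q φ s k x| ≤ s.card * B := by
  have := norm_integral_le_of_norm_le_const (μ := Q)
    (f := fun z => (k : ℝ)⁻¹ * ∑ i ∈ lowRank s k (fun j => ‖x j - z‖), φ z (x i))
    (Eventually.of_forall fun z => abs_mean_lowRank_le s k hB x z)
  simpa [nnBias] using this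

theorem integral_nnBias (P Q : Measure (E d)) [IsProbabilityMeasure P] [IsProbabilityMeasure Q]
    {N k : ℕ} (hk : 1 ≤ k) {φ : E d → E d → ℝ}
    (hφ : Measurable fun q : E d × E d => φ q.1 q.2) {B : ℝ} (hB : ∀ z y, |φ z y| ≤ B) :
    ∫ x, nnBias Q φ Finset.univ k x ∂(Measure.pi fun _ : Fin (N + 1) => P) =
      ∫ z, nnMean P φ N k z ∂Q := by
  unfold nnBias
  rw [integral_integral_swap]
  · refine integral_congr_ae (Eventually.of_forall fun z => ?_)
    have hz : Measurable (φ z) := hφ.comp measurable_prodMk_left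
    exact integral_sum_lowRank hk z (φ z) (integrable_of_bounded hz (hB z))
  · exact integrable_of_bounded ((measurable_sum_lowRank Finset.univ k hφ).const_mul _)
      fun w => abs_mean_lowRank_le Finset.univ k hB w.1 w.2

end Measurability

/-! ### The variance of the bias -/

theorem lowRank_congr {ι : Type*} {s : Finset ι} {k : ℕ} {r r' : ι → ℝ}
    (h : ∀ j ∈ s, r j = r' j) : lowRank s k r = lowRank s k r' := by
  ext i
  rw [mem_lowRank, mem_lowRank]
  refine and_congr_right fun hi => ?_
  rw [Finset.filter_congr (q := fun j => r' j < r' i) fun j hj => by rw [h j hj, h i hi]]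

section CapRadius

variable {d : ℕ} {ι : Type*} [Fintype ι]

/-- The mean of the truncated `(d + 2)`-nd powers of the distances from `z` to its `2 k` nearest
neighbours, up to a factor two. -/
noncomputable def capMean (D : ℝ) (k : ℕ) (x : ι → E d) (z : E d) : ℝ :=
  (k : ℝ)⁻¹ * ∑ j ∈ lowRank Finset.univ (2 * k) (fun j => ‖x j - z‖), min ‖x j - z‖ D ^ (d + 2)

/-- A measurable upper bound for the distance from `z` to its `(k + 1)`-st nearest neighbour. -/
noncomputable def capRadius (D : ℝ) (k : ℕ) (x : ι → E d) (z : E d) : ℝ :=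
  capMean D k x z ^ (((d + 2 : ℕ) : ℝ)⁻¹)

variable {D : ℝ} (hD : 0 ≤ D)
include hD

theorem capMean_nonneg (k : ℕ) (x : ι → E d) (z : E d) : 0 ≤ capMean D k x z :=
  mul_nonneg (by positivity) (Finset.sum_nonneg fun j _ => by positivity)

theorem capRadius_nonneg (k : ℕ) (x : ι → E d) (z : E d) : 0 ≤ capRadius D k x z :=
  Real.rpow_nonneg (capMean_nonneg hD k x z) _

theorem capRadius_pow (k : ℕ) (x : ι → E d) (z : E d) :
    capRadius D k x z ^ (d + 2) = capMean D k x z :=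
  Real.rpow_inv_natCast_pow (capMean_nonneg hD k x z) (by omega)

omit hD in
theorem measurable_capMean (k : ℕ) :
    Measurable fun w : (ι → E d) × E d => capMean D k w.1 w.2 :=
  (measurable_sum_lowRank Finset.univ (2 * k)
    (φ := fun z y => min ‖y - z‖ D ^ (d + 2)) (by fun_prop)).const_mul _

theorem abs_min_pow_le (y z : E d) : |min ‖y - z‖ D ^ (d + 2)| ≤ D ^ (d + 2) := by
  rw [abs_of_nonneg (by positivity)]
  gcongr
  exact min_le_right _ _

theorem capMean_le (k : ℕ) (x : ι → E d) (z : E d) :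
    capMean D k x z ≤ 2 * (Fintype.card ι * D ^ (d + 2)) := by
  have h := abs_mean_lowRank_le Finset.univ (2 * k)
    (φ := fun z y : E d => min ‖y - z‖ D ^ (d + 2)) (fun z y => abs_min_pow_le hD y z) x z
  have h1 : capMean D k x z = 2 * (((2 * k : ℕ) : ℝ)⁻¹ *
      ∑ j ∈ lowRank Finset.univ (2 * k) (fun j => ‖x j - z‖), min ‖x j - z‖ D ^ (d + 2)) := by
    rw [capMean]
    push_cast
    rw [mul_inv]
    ring
  rw [h1]
  have h2 := (abs_le.1 h).2
  rw [Finset.card_univ] at h2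
  linarith

theorem capRadius_le (k : ℕ) (x : ι → E d) (z : E d) :
    capRadius D k x z ≤ (2 * (Fintype.card ι * D ^ (d + 2))) ^ (((d + 2 : ℕ) : ℝ)⁻¹) :=
  Real.rpow_le_rpow (capMean_nonneg hD _ _ _) (capMean_le hD k x z) (by positivity)

omit hD in
theorem measurable_capMean_right (k : ℕ) (x : ι → E d) : Measurable fun z => capMean D k x z := by
  have h := (measurable_capMean (d := d) (ι := ι) (D := D) k).comp (measurable_prodMk_left (x := x))
  simpa only [Function.comp_def] using h

omit hD in
theorem measurable_capRadius_right (k : ℕ) (x : ι → E d) :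
    Measurable fun z => capRadius D k x z :=
  (measurable_capMean_right k x).pow_const _

theorem integrable_capRadius (Q : Measure (E d)) [IsFiniteMeasure Q] (k : ℕ) (x : ι → E d) :
    Integrable (fun z => capRadius D k x z) Q := by
  refine Integrable.of_bound (measurable_capRadius_right k x).aestronglyMeasurable
    ((2 * (Fintype.card ι * D ^ (d + 2))) ^ (((d + 2 : ℕ) : ℝ)⁻¹)) ?_
  refine Eventually.of_forall fun z => ?_
  rw [Real.norm_of_nonneg (capRadius_nonneg hD k x z)]
  exact capRadius_le hD k x z

theorem integrable_capMean (Q : Measure (E d)) [IsFiniteMeasure Q] (k : ℕ) (x : ι → E d) :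
    Integrable (fun z => capMean D k x z) Q := by
  refine Integrable.of_bound (measurable_capMean_right k x).aestronglyMeasurable
    (2 * (Fintype.card ι * D ^ (d + 2))) ?_
  refine Eventually.of_forall fun z => ?_
  rw [Real.norm_of_nonneg (capMean_nonneg hD k x z)]
  exact capMean_le hD k x z

/-- A distance of rank at most `k + 1` is dominated by the `k` distances of ranks `k + 1` to `2k`,
hence by their mean; this needs `2k` points. The average over nearest neighbours, unlike a single
order statistic, has an expectation given by `integral_sum_lowRank`. The cap at `D` is inactive for
points of `S` and makes the average bounded everywhere. -/
theorem norm_sub_le_capRadius [DecidableEq ι] {k : ℕ} (hk : 1 ≤ k) (hk2 : 2 * k ≤ Fintype.card ι)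
    {x : ι → E d} {z : E d} (hinj : Function.Injective fun j => ‖x j - z‖) {i : ι}
    (hi : i ∈ lowRank Finset.univ (k + 1) (fun j => ‖x j - z‖)) (hiD : ‖x i - z‖ ≤ D) :
    ‖x i - z‖ ≤ capRadius D k x z := by
  have h := mul_le_sum_lowRank_two_mul (hinj.injOn (s := (Finset.univ : Finset ι))) hk2 hi
    (φ := fun t => min t D ^ (d + 2)) (fun s hs t ht hst => by
      have hs : 0 ≤ s := hs
      simp only
      gcongr) (fun t ht => by positivity) (fun j => norm_nonneg _)
  refine le_of_pow_le_pow_left₀ (n := d + 2) (by omega) (capRadius_nonneg hD k x z) ?_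
  rw [capRadius_pow hD, capMean]
  rw [min_eq_left hiD] at h
  rw [inv_mul_eq_div, le_div_iff₀ (by positivity)]
  linarith

end CapRadius

/-- The points which have `x i` among their `k` nearest neighbours. -/
def nnCell {d : ℕ} {ι : Type*} [Fintype ι] (k : ℕ) (x : ι → E d) (i : ι) : Set (E d) :=
  {z | i ∈ lowRank Finset.univ k (fun j => ‖x j - z‖)}

theorem measurableSet_nnCell {d : ℕ} {ι : Type*} [Fintype ι] (k : ℕ) (x : ι → E d) (i : ι) :
    MeasurableSet (nnCell k x i) :=
  measurableSet_mem_lowRank _ k (r := fun z => fun j => ‖x j - z‖) (fun j => by fun_prop) i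

theorem measurableSet_injective {α ι : Type*} [MeasurableSpace α] [Countable ι]
    {r : α → ι → ℝ} (hr : ∀ j, Measurable fun a => r a j) :
    MeasurableSet {a | Function.Injective (r a)} := by
  have : {a | Function.Injective (r a)} =
      ⋂ (i : ι) (j : ι) (_ : i ≠ j), {a | r a i ≠ r a j} := by
    ext w
    simp only [Set.mem_iInter, Function.Injective]
    exact ⟨fun h i j hij he => hij (h he), fun h i j he => by
      by_contra hne; exact h i j hne he⟩
  rw [this]
  exact MeasurableSet.iInter fun i => MeasurableSet.iInter fun j => MeasurableSet.iInter
    fun _ => (measurableSet_eq_fun (hr i) (hr j)).compl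

namespace BiasSetting

variable {d : ℕ} {S : Set (E d)} {P Q : Measure (E d)} {p : E d → ℝ} {F φ : E d → E d → ℝ}
  {a b M D δ : ℝ} {Kp : ℝ≥0} [IsProbabilityMeasure P] [IsProbabilityMeasure Q]

omit [IsProbabilityMeasure P] [IsProbabilityMeasure Q] in
theorem measurable_mean_lowRank_right (H : BiasSetting S P Q p F φ a b M D δ Kp) {ι : Type*}
    [Fintype ι] (s : Finset ι) (k : ℕ) (x : ι → E d) :
    Measurable fun z => (k : ℝ)⁻¹ * ∑ i ∈ lowRank s k (fun j => ‖x j - z‖), φ z (x i) := by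
  have h := (measurable_sum_lowRank s k H.φ_meas).comp (measurable_prodMk_left (x := x))
  simp only [Function.comp_def] at h
  exact h.const_mul _

omit [IsProbabilityMeasure P] in
theorem integrable_mean_lowRank (H : BiasSetting S P Q p F φ a b M D δ Kp) {ι : Type*}
    [Fintype ι] (s : Finset ι) (k : ℕ) (x : ι → E d) :
    Integrable (fun z => (k : ℝ)⁻¹ * ∑ i ∈ lowRank s k (fun j => ‖x j - z‖), φ z (x i)) Q := by
  refine Integrable.of_bound (H.measurable_mean_lowRank_right s k x).aestronglyMeasurable
    (s.card * (M * D)) ?_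
  exact Eventually.of_forall fun z => abs_mean_lowRank_le s k H.φ_le x z

omit [IsProbabilityMeasure P] in
/-- The effect of deleting one sample point on the mean over the nearest neighbours. -/
theorem abs_mean_lowRank_sub_erase_le (H : BiasSetting S P Q p F φ a b M D δ Kp) {N k : ℕ}
    (hk : 1 ≤ k) (hk2 : 2 * k ≤ N + 1) {x : Fin (N + 1) → E d} (hx : ∀ i, x i ∈ S) {z : E d}
    (hzS : z ∈ S) (hz : Function.Injective fun j => ‖x j - z‖) (i : Fin (N + 1)) :
    |(k : ℝ)⁻¹ * (∑ l ∈ lowRank Finset.univ k (fun j => ‖x j - z‖), φ z (x l)) -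
      (k : ℝ)⁻¹ * ∑ l ∈ lowRank (Finset.univ.erase i) k (fun j => ‖x j - z‖), φ z (x l)| ≤
      2 * M / k * (nnCell k x i).indicator (capRadius D k x) z := by
  have hD := H.D_nonneg
  have hM := H.M_nonneg
  -- All indices of rank at most `k + 1` lie within `capRadius` of `z`, so the Lipschitz bound for
  -- `φ` controls both the deleted term and the one replacing it.
  have h := abs_sum_lowRank_sub_sum_erase_le (k := k) (hz.injOn (s := ((Finset.univ : Finset
    (Fin (N + 1))) : Set (Fin (N + 1))))) (by simp; omega) (Finset.mem_univ i)
    (fun l => φ z (x l)) (C := M * capRadius D k x z) fun l hl => by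
      refine (H.φ_lip z hzS _ (hx l)).trans ?_
      gcongr
      exact norm_sub_le_capRadius hD hk (by simpa using hk2) hz hl
        (H.norm_sub_le z hzS _ (hx l))
  have hk0 : (0 : ℝ) ≤ (k : ℝ)⁻¹ := by positivity
  rw [← mul_sub, abs_mul, abs_of_nonneg hk0]
  refine (mul_le_mul_of_nonneg_left h hk0).trans (le_of_eq ?_)
  by_cases hc : i ∈ lowRank Finset.univ k (fun j => ‖x j - z‖)
  · have hc' : z ∈ nnCell k x i := hc
    rw [if_pos hc, Set.indicator_of_mem hc']; ring
  · have hc' : z ∉ nnCell k x i := hc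
    rw [if_neg hc, Set.indicator_of_notMem hc']; ring

omit [IsProbabilityMeasure P] in
/-- The effect of deleting one sample point on the bias. -/
theorem abs_nnBias_sub_le (H : BiasSetting S P Q p F φ a b M D δ Kp) {N k : ℕ} (hk : 1 ≤ k)
    (hk2 : 2 * k ≤ N + 1) {x : Fin (N + 1) → E d} (hx : ∀ i, x i ∈ S)
    (hinj : ∀ᵐ z ∂Q, Function.Injective fun j => ‖x j - z‖) (i : Fin (N + 1)) :
    |nnBias Q φ Finset.univ k x - nnBias Q φ (Finset.univ.erase i) k x| ≤
      2 * M / k * ∫ z, (nnCell k x i).indicator (capRadius D k x) z ∂Q := by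
  have hT : Integrable (fun z => (nnCell k x i).indicator (capRadius D k x) z) Q :=
    (integrable_capRadius H.D_nonneg Q k x).indicator (measurableSet_nnCell k x i)
  have h1 := H.integrable_mean_lowRank Finset.univ k x
  have h2 := H.integrable_mean_lowRank (Finset.univ.erase i) k x
  have key : ∀ᵐ z ∂Q, |(k : ℝ)⁻¹ * (∑ l ∈ lowRank Finset.univ k (fun j => ‖x j - z‖), φ z (x l)) -
      (k : ℝ)⁻¹ * ∑ l ∈ lowRank (Finset.univ.erase i) k (fun j => ‖x j - z‖), φ z (x l)| ≤
      2 * M / k * (nnCell k x i).indicator (capRadius D k x) z := by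
    filter_upwards [hinj, H.ae_mem_interior] with z hz hzS
    exact H.abs_mean_lowRank_sub_erase_le hk hk2 hx (interior_subset hzS) hz i
  unfold nnBias
  rw [← integral_sub h1 h2, ← integral_const_mul]
  exact (abs_integral_le_integral_abs).trans
    (integral_mono_ae (h1.sub h2).abs (hT.const_mul _) key)

omit [IsProbabilityMeasure P] in
theorem Q_real_closedBall_le (H : BiasSetting S P Q p F φ a b M D δ Kp) (z : E d) {r : ℝ}
    (hr : 0 ≤ r) : Q.real {w | ‖z - w‖ ≤ r} ≤ b * (r ^ d * unitVol d) := by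
  have h1 : {w | ‖z - w‖ ≤ r} = Metric.closedBall z r := by
    ext w; simp [dist_eq_norm, norm_sub_rev]
  have := nontrivial_E H.one_le
  have h2 := ENNReal.toReal_mono (ENNReal.mul_ne_top ENNReal.ofReal_ne_top
    measure_closedBall_lt_top.ne) (H.Q_le (Metric.closedBall z r))
  rw [ENNReal.toReal_mul, ENNReal.toReal_ofReal H.b_nonneg,
    Measure.addHaar_closedBall_eq_addHaar_ball volume, ← measureReal_def volume,
    volumeReal_ball H.one_le z hr] at h2
  rw [h1]; exact h2

omit [IsProbabilityMeasure P] in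
/-- The total overlap of the nearest neighbour regions of the sample points. -/
theorem sum_sq_integral_capRadius_le (H : BiasSetting S P Q p F φ a b M D δ Kp) {N k : ℕ}
    (hk : 1 ≤ k) (hk2 : 2 * k ≤ N + 1) {x : Fin (N + 1) → E d} (hx : ∀ i, x i ∈ S)
    (hinj : ∀ᵐ z ∂Q, Function.Injective fun j => ‖x j - z‖) :
    ∑ i, (∫ z, (nnCell k x i).indicator (capRadius D k x) z ∂Q) ^ 2 ≤
      2 * k * (b * 2 ^ d * unitVol d) * ∫ z, capMean D k x z ∂Q := by
  have hD := H.D_nonneg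
  set T : E d → ℝ := fun z => capRadius D k x z with hTdef
  have hT0 : ∀ z, 0 ≤ T z := fun z => capRadius_nonneg hD _ _ _
  obtain ⟨R, hTR⟩ : ∃ R, ∀ z, T z ≤ R := ⟨_, capRadius_le hD k x⟩
  have hTm : Measurable T := measurable_capRadius_right k x
  have hR0 : 0 ≤ R := (hT0 0).trans (hTR 0)
  obtain ⟨u, hu⟩ : ∃ u : Fin (N + 1) → E d → ℝ, u = fun i => (nnCell k x i).indicator T :=
    ⟨_, rfl⟩
  have hum : ∀ i, Measurable (u i) := fun i => by
    rw [hu]; exact hTm.indicator (measurableSet_nnCell k x i)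
  have hu0 : ∀ i z, 0 ≤ u i z := fun i z => by
    rw [hu]; exact Set.indicator_nonneg (fun z _ => hT0 z) z
  have huT : ∀ i z, u i z ≤ T z := fun i z => by
    rw [hu]; exact Set.indicator_le_self' (fun z _ => hT0 z) z
  have huR : ∀ i z, |u i z| ≤ R := fun i z => by
    rw [abs_of_nonneg (hu0 i z)]
    exact (huT i z).trans (hTR z)
  -- If `z` and `w` have a common neighbour then `‖z - w‖ ≤ T z + T w`, at most twice the larger
  -- radius, and `T z * T w` is at most the square of the larger one. Hence the product is bounded
  -- by `G` at `(z, w)` or at the swapped pair.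
  set G : E d × E d → ℝ := fun w => if ‖w.1 - w.2‖ ≤ 2 * T w.1 then T w.1 ^ 2 else 0 with hG
  have hGm : Measurable G := Measurable.ite
    (measurableSet_le (by fun_prop) (by fun_prop)) (by fun_prop) measurable_const
  have hG0 : ∀ w, 0 ≤ G w := fun w => by simp only [hG]; split_ifs <;> positivity
  have hGR : ∀ w, |G w| ≤ R ^ 2 := fun w => by
    rw [abs_of_nonneg (hG0 w)]
    simp only [hG]; split_ifs
    · exact pow_le_pow_left₀ (hT0 _) (hTR _) 2
    · positivity
  have hGi : Integrable G (Q.prod Q) := integrable_of_bounded hGm hGR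
  have hui : ∀ i, Integrable (fun w : E d × E d => u i w.1 * u i w.2) (Q.prod Q) := fun i =>
    integrable_of_bounded (C := R * R)
      (((hum i).comp measurable_fst).mul ((hum i).comp measurable_snd)) fun w => by
        rw [abs_mul]
        exact mul_le_mul (huR i _) (huR i _) (abs_nonneg _) hR0
  have hGs : Integrable (fun w : E d × E d => G w.swap) (Q.prod Q) := hGi.swap
  have hgood : ∀ᵐ z ∂Q, (Function.Injective fun j => ‖x j - z‖) ∧ z ∈ S := by
    filter_upwards [hinj, H.ae_mem_interior] with z h1 h2 using ⟨h1, interior_subset h2⟩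
  have hle : ∀ᵐ w ∂(Q.prod Q), ∑ i, u i w.1 * u i w.2 ≤ k * (G w + G w.swap) := by
    have h1 : ∀ᵐ w ∂(Q.prod Q), (Function.Injective fun j => ‖x j - w.1‖) ∧ w.1 ∈ S :=
      Measure.quasiMeasurePreserving_fst.ae hgood
    have h2 : ∀ᵐ w ∂(Q.prod Q), (Function.Injective fun j => ‖x j - w.2‖) ∧ w.2 ∈ S :=
      Measure.quasiMeasurePreserving_snd.ae hgood
    filter_upwards [h1, h2] with w hw1 hw2
    have hG2 := add_nonneg (hG0 w) (hG0 w.swap)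
    have hterm : ∀ i, w.1 ∈ nnCell k x i → u i w.1 * u i w.2 ≤ G w + G w.swap := by
      intro i hi1
      by_cases hi2 : w.2 ∈ nnCell k x i
      · have hd1 : ‖x i - w.1‖ ≤ T w.1 := norm_sub_le_capRadius hD hk (by simpa using hk2) hw1.1
          (lowRank_mono _ (Nat.le_succ k) _ hi1) (H.norm_sub_le _ hw1.2 _ (hx i))
        have hd2 : ‖x i - w.2‖ ≤ T w.2 := norm_sub_le_capRadius hD hk (by simpa using hk2) hw2.1
          (lowRank_mono _ (Nat.le_succ k) _ hi2) (H.norm_sub_le _ hw2.2 _ (hx i))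
        have hd3 : ‖w.1 - w.2‖ ≤ T w.1 + T w.2 := by
          calc ‖w.1 - w.2‖ = ‖(x i - w.2) - (x i - w.1)‖ := by congr 1; abel
            _ ≤ ‖x i - w.2‖ + ‖x i - w.1‖ := _root_.norm_sub_le _ _
            _ ≤ _ := by linarith
        refine (mul_le_mul (huT i _) (huT i _) (hu0 _ _) (hT0 _)).trans ?_
        rcases le_total (T w.2) (T w.1) with h | h
        · have hGw : G w = T w.1 ^ 2 := by
            rw [hG]; exact if_pos (by linarith)
          have := hG0 w.swap
          nlinarith [hT0 w.1, hT0 w.2]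
        · have hGw : G w.swap = T w.2 ^ 2 := by
            rw [hG]; exact if_pos (by rw [Prod.fst_swap, Prod.snd_swap, norm_sub_rev]; linarith)
          have := hG0 w
          nlinarith [hT0 w.1, hT0 w.2]
      · have : u i w.2 = 0 := by rw [hu]; exact Set.indicator_of_notMem hi2 _
        rw [this, mul_zero]
        exact hG2
    -- Only the neighbours of the first point contribute, and without ties there are at most `k` of
    -- them.
    have hsub : ∑ i, u i w.1 * u i w.2 =
        ∑ i ∈ lowRank Finset.univ k (fun j => ‖x j - w.1‖), u i w.1 * u i w.2 := by
      refine (Finset.sum_subset (Finset.subset_univ _) fun i _ hi => ?_).symm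
      have hi' : w.1 ∉ nnCell k x i := hi
      have : u i w.1 = 0 := by rw [hu]; exact Set.indicator_of_notMem hi' _
      rw [this, zero_mul]
    rw [hsub]
    refine (Finset.sum_le_card_nsmul _ _ _ fun i hi => hterm i hi).trans ?_
    rw [nsmul_eq_mul]
    have hc : ((lowRank Finset.univ k (fun j => ‖x j - w.1‖)).card : ℝ) ≤ k := by
      exact_mod_cast card_lowRank_le hw1.1.injOn
    exact mul_le_mul_of_nonneg_right hc hG2
  -- The set of `w` within `2 T z` has `Q`-mass at most `b (2 T z)^d |V|`. Together with the factor
  -- `(T z)^2` this produces the exponent `d + 2` in `capMean`.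
  have hGint : ∫ w, G w ∂(Q.prod Q) ≤ (b * 2 ^ d * unitVol d) * ∫ z, capMean D k x z ∂Q := by
    rw [integral_prod _ hGi, ← integral_const_mul]
    refine integral_mono_of_nonneg (Eventually.of_forall fun z => integral_nonneg fun w => hG0 _)
      ((integrable_capMean hD Q k x).const_mul _) (Eventually.of_forall fun z => ?_)
    · have h1 : ∀ w, G (z, w) = {w | ‖z - w‖ ≤ 2 * T z}.indicator (fun _ => T z ^ 2) w := by
        intro w
        simp only [hG, Set.indicator_apply]; rfl
      simp only [h1]
      rw [integral_indicator_const _ (measurableSet_le (by fun_prop) measurable_const), smul_eq_mul]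
      have h2 := H.Q_real_closedBall_le z (r := 2 * T z) (by linarith [hT0 z])
      calc _ ≤ b * ((2 * T z) ^ d * unitVol d) * T z ^ 2 := by gcongr
        _ = b * 2 ^ d * unitVol d * T z ^ (d + 2) := by rw [mul_pow, pow_add]; ring
        _ = _ := by rw [hTdef]; simp only; rw [capRadius_pow hD]
  calc ∑ i, (∫ z, (nnCell k x i).indicator (capRadius D k x) z ∂Q) ^ 2
      = ∑ i, (∫ z, u i z ∂Q) ^ 2 := by rw [hu]
    _ = ∑ i, ∫ w, u i w.1 * u i w.2 ∂(Q.prod Q) := by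
        refine Finset.sum_congr rfl fun i _ => ?_
        rw [integral_prod_mul, sq]
    _ = ∫ w, ∑ i, u i w.1 * u i w.2 ∂(Q.prod Q) := (integral_finsetSum _ fun i _ => hui i).symm
    _ ≤ ∫ w, k * (G w + G w.swap) ∂(Q.prod Q) :=
        integral_mono_ae (integrable_finsetSum _ fun i _ => hui i)
          ((hGi.add hGs).const_mul _) hle
    _ = 2 * k * ∫ w, G w ∂(Q.prod Q) := by
        rw [integral_const_mul, integral_add hGi hGs, integral_prod_swap]
        ring
    _ ≤ 2 * k * ((b * 2 ^ d * unitVol d) * ∫ z, capMean D k x z ∂Q) := by gcongr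
    _ = _ := by ring

omit [IsProbabilityMeasure Q] in
-- The lower bound on the density is available only inside the ball of radius `δ`. For `δ ≤ r ≤ D`
-- one uses `r ≤ (D/δ) δ`, so `r ≤ max 1 (D/δ) * min r δ` in all cases. The exponent comes from
-- `r^(d+2) = (r^d)^(1+2/d)`.
theorem pow_le_mul_ballMass_rpow (H : BiasSetting S P Q p F φ a b M D δ Kp) {z : E d}
    (hz : Metric.ball z δ ⊆ S) {r : ℝ} (hr : 0 ≤ r) (hrD : r ≤ D) :
    r ^ (d + 2) ≤ (max 1 (D / δ) ^ d / (a * unitVol d)) ^ (1 + 2 / (d : ℝ)) *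
      ballMass P z r ^ (1 + 2 / (d : ℝ)) := by
  have hV := unitVol_pos d
  have ha := H.a_pos
  have hδ := H.δ_pos
  have hd0 : (0 : ℝ) < d := by exact_mod_cast H.one_le
  set A := max 1 (D / δ) with hA
  have hA1 : 1 ≤ A := le_max_left _ _
  have h1 : r ≤ A * min r δ := by
    rcases le_total r δ with h | h
    · rw [min_eq_left h]; exact le_mul_of_one_le_left hr hA1
    · rw [min_eq_right h]
      calc r ≤ D / δ * δ := by rw [div_mul_cancel₀ _ hδ.ne']; exact hrD
        _ ≤ _ := by gcongr; exact le_max_right _ _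
  have h2 := mul_pow_le_ballMass H.one_le H.density ha.le (z := z) (r := min r δ)
    (le_min hr hδ.le) fun y hy => H.le_p y (hz (Metric.ball_subset_ball (min_le_right _ _) hy))
  have h3 := h2.trans (ballMass_mono (P := P) z (min_le_left r δ))
  have h4 : r ^ d ≤ A ^ d / (a * unitVol d) * ballMass P z r := by
    rw [div_mul_eq_mul_div, le_div_iff₀ (by positivity)]
    calc r ^ d * (a * unitVol d) ≤ (A * min r δ) ^ d * (a * unitVol d) := by gcongr
      _ = A ^ d * (a * unitVol d * min r δ ^ d) := by rw [mul_pow]; ring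
      _ ≤ _ := by gcongr
  rw [← Real.mul_rpow (by positivity) (ballMass_nonneg _ _ _)]
  calc r ^ (d + 2) = (r ^ d) ^ (1 + 2 / (d : ℝ)) := by
        rw [← Real.rpow_natCast r d, ← Real.rpow_mul hr, mul_add, mul_div_cancel₀ _ hd0.ne',
          ← Real.rpow_natCast r (d + 2)]
        congr 1; push_cast; ring
    _ ≤ _ := Real.rpow_le_rpow (by positivity) h4 (by positivity)

/-- After exchanging the integrals, `capMean` is twice the mean over the `2k` nearest neighbours,
and its expectation is bounded by a ball mass moment of order `1 + 2/d ≤ 3`. -/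
theorem exists_integral_capMean_le (H : BiasSetting S P Q p F φ a b M D δ Kp) :
    ∃ C, 0 ≤ C ∧ ∀ N k : ℕ, 1 ≤ k → 2 * k ≤ N + 1 →
      ∫ x, ∫ z, capMean D k x z ∂Q ∂(Measure.pi fun _ : Fin (N + 1) => P) ≤
        C * ((k : ℝ) / (N + 1 : ℕ)) ^ (1 + 2 / (d : ℝ)) := by
  have hD := H.D_nonneg
  have hV := unitVol_pos d
  have ha := H.a_pos
  have hδ := H.δ_pos
  have hs := H.two_div_pos
  have hs2 := H.two_div_le
  set A := (max 1 (D / δ) ^ d / (a * unitVol d)) ^ (1 + 2 / (d : ℝ)) with hA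
  have hA0 : 0 ≤ A := by positivity
  refine ⟨2 * (A * (7 * 2 ^ (1 + 2 / (d : ℝ)))), by positivity, fun N k hk hk2 => ?_⟩
  rw [integral_integral_swap]
  swap
  · refine integrable_of_bounded (measurable_capMean k)
      (C := 2 * (Fintype.card (Fin (N + 1)) * D ^ (d + 2))) fun w => ?_
    simp only [Function.uncurry]
    rw [abs_of_nonneg (capMean_nonneg hD _ _ _)]
    exact capMean_le hD k _ _
  set t : ℝ := (k : ℝ) / (N + 1 : ℕ) with ht
  have hbound : ∀ᵐ z ∂Q, ∫ x, capMean D k x z ∂(Measure.pi fun _ : Fin (N + 1) => P) ≤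
      2 * (A * (7 * 2 ^ (1 + 2 / (d : ℝ)))) * t ^ (1 + 2 / (d : ℝ)) := by
    filter_upwards [H.ball_subset] with z hz
    have hzS : z ∈ S := hz (Metric.mem_ball_self hδ)
    have hm : Measurable fun y : E d => min ‖y - z‖ D ^ (d + 2) := by fun_prop
    have h1 : ∀ x : Fin (N + 1) → E d, capMean D k x z = 2 * (((2 * k : ℕ) : ℝ)⁻¹ *
        ∑ j ∈ lowRank Finset.univ (2 * k) (fun j => ‖x j - z‖),
          min ‖x j - z‖ D ^ (d + 2)) := by
      intro x
      rw [capMean]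
      push_cast
      rw [mul_inv]
      ring
    simp_rw [h1]
    rw [integral_const_mul, integral_sum_lowRank (by omega) z
      (fun y => min ‖y - z‖ D ^ (d + 2)) (integrable_of_bounded hm fun y => abs_min_pow_le hD y z)]
    obtain ⟨W, hW⟩ := exists_nnWeight_le P N (2 * k)
    have hwm := measurable_nnWeight (P := P) N (2 * k) z
    have hwW : ∀ y, |nnWeight P N (2 * k) z y| ≤ W := fun y => by
      rw [abs_of_nonneg (nnWeight_nonneg _ _ _ _)]; exact hW z y
    have h2 : ∫ y, min ‖y - z‖ D ^ (d + 2) * nnWeight P N (2 * k) z y ∂P ≤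
        ∫ y, A * (ballMass P z ‖y - z‖ ^ (1 + 2 / (d : ℝ)) * nnWeight P N (2 * k) z y) ∂P := by
      refine integral_mono_ae ?_ (Integrable.const_mul ?_ A) ?_
      · refine integrable_of_bounded (hm.mul hwm) (C := D ^ (d + 2) * W) fun y => ?_
        rw [abs_mul]
        exact mul_le_mul (abs_min_pow_le hD y z) (hwW y) (abs_nonneg _) (by positivity)
      · refine integrable_of_bounded (((measurable_ballMass_norm_sub z).pow_const _).mul hwm)
          (C := 1 * W) fun y => ?_
        rw [abs_mul, abs_of_nonneg (Real.rpow_nonneg (ballMass_nonneg _ _ _) _)]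
        exact mul_le_mul (Real.rpow_le_one (ballMass_nonneg _ _ _) (ballMass_le_one _ _)
          (by positivity)) (hwW y) (abs_nonneg _) zero_le_one
      · filter_upwards [H.density.ae_mem] with y hy
        have hyD := H.norm_sub_le z hzS y hy
        rw [min_eq_left hyD, ← mul_assoc]
        exact mul_le_mul_of_nonneg_right
          (H.pow_le_mul_ballMass_rpow hz (norm_nonneg _) hyD) (nnWeight_nonneg _ _ _ _)
    rw [integral_const_mul, integral_rpow_ballMass_mul_nnWeight H.one_le
      H.density.absolutelyContinuous N (2 * k) z (by positivity)] at h2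
    have h3 := tailMoment_le (N := N) (k := 2 * k) (by omega) hk2 (s := 1 + 2 / (d : ℝ))
      (by positivity) (by linarith)
    have h4 : ((2 * k : ℕ) : ℝ) / (N + 1 : ℕ) = 2 * t := by rw [ht]; push_cast; ring
    rw [h4, Real.mul_rpow (by norm_num) (by positivity)] at h3
    calc _ ≤ 2 * (A * tailMoment N (2 * k) (1 + 2 / (d : ℝ))) := by gcongr
      _ ≤ 2 * (A * (7 * (2 ^ (1 + 2 / (d : ℝ)) * t ^ (1 + 2 / (d : ℝ))))) := by gcongr
      _ = _ := by ring
  have := integral_mono_of_nonneg (μ := Q) (Eventually.of_forall fun z =>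
    integral_nonneg fun x => capMean_nonneg hD k x z) (integrable_const _) hbound
  simpa using this

/-- Ties are null for each fixed `z`; Fubini turns this into a statement for almost every sample and
then almost every `z`. -/
theorem ae_sample (H : BiasSetting S P Q p F φ a b M D δ Kp) (n : ℕ) :
    ∀ᵐ x ∂(Measure.pi fun _ : Fin n => P), (∀ i, x i ∈ S) ∧
      ∀ᵐ z ∂Q, Function.Injective fun j => ‖x j - z‖ := by
  have h1 : ∀ᵐ x ∂(Measure.pi fun _ : Fin n => P), ∀ i, x i ∈ S := by
    rw [ae_all_iff]
    intro i
    exact (measurePreserving_eval (fun _ : Fin n => P) i).quasiMeasurePreserving.ae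
      H.density.ae_mem
  have hm : MeasurableSet {w : E d × (Fin n → E d) |
      Function.Injective fun j => ‖w.2 j - w.1‖} :=
    measurableSet_injective (r := fun (w : E d × (Fin n → E d)) j => ‖w.2 j - w.1‖)
      fun j => by fun_prop
  have h2 : ∀ᵐ w ∂(Q.prod (Measure.pi fun _ : Fin n => P)),
      Function.Injective fun j => ‖w.2 j - w.1‖ := by
    rw [Measure.ae_prod_iff_ae_ae hm]
    exact Eventually.of_forall fun z =>
      ae_injective_norm_sub H.one_le H.density.absolutelyContinuous n z
  have h3 := Measure.ae_ae_comm (p := fun z (x : Fin n → E d) =>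
    Function.Injective fun j => ‖x j - z‖) hm |>.1 (Measure.ae_ae_of_ae_prod h2)
  filter_upwards [h1, h3] with x hx hx' using ⟨hx, hx'⟩

/-- The bias concentrates around its mean. -/
theorem exists_variance_nnBias_le (H : BiasSetting S P Q p F φ a b M D δ Kp) :
    ∃ C, ∀ N k : ℕ, 1 ≤ k → 2 * k ≤ N + 1 →
      (∫ x, nnBias Q φ Finset.univ k x ^ 2 ∂(Measure.pi fun _ : Fin (N + 1) => P)) -
          (∫ x, nnBias Q φ Finset.univ k x ∂(Measure.pi fun _ : Fin (N + 1) => P)) ^ 2 ≤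
        C * (((N + 1 : ℕ) : ℝ)⁻¹ * ((k : ℝ) / (N + 1 : ℕ)) ^ (2 / (d : ℝ))) := by
  have hD := H.D_nonneg
  have hM := H.M_nonneg
  have hb := H.b_nonneg
  have hV := unitVol_pos d
  obtain ⟨C, hC0, hC⟩ := H.exists_integral_capMean_le
  refine ⟨8 * M ^ 2 * (b * 2 ^ d * unitVol d) * C, fun N k hk hk2 => ?_⟩
  set μn := Measure.pi fun _ : Fin (N + 1) => P with hμn
  have hB : 0 ≤ M * D := by positivity
  -- The comparison function for the `i`-th variable is the bias with the `i`-th point deleted.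
  have hes := variance_pi_le_sum P (nnBias Q φ Finset.univ k)
    (fun i : Fin (N + 1) => nnBias Q φ (Finset.univ.erase i) k)
    (measurable_nnBias Q _ k H.φ_meas) (fun i => measurable_nnBias Q _ k H.φ_meas)
    (C := (N + 1 : ℕ) * (M * D))
    (fun x => by simpa using abs_nnBias_le Q Finset.univ k H.φ_le x)
    (fun i x => (abs_nnBias_le Q (Finset.univ.erase i) k H.φ_le x).trans (by
      gcongr
      exact (Finset.card_le_univ _).trans (by simp)))
    (fun i x y hxy => by
      unfold nnBias
      congr 1; ext z
      have h1 : lowRank (Finset.univ.erase i) k (fun j => ‖x j - z‖) =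
          lowRank (Finset.univ.erase i) k (fun j => ‖y j - z‖) :=
        lowRank_congr fun j hj => by rw [hxy j (Finset.ne_of_mem_erase hj)]
      rw [h1]
      congr 1
      refine Finset.sum_congr rfl fun j hj => ?_
      rw [hxy j (Finset.ne_of_mem_erase (lowRank_subset _ _ _ hj))])
  refine hes.trans ?_
  have hm : ∀ s : Finset (Fin (N + 1)), Measurable (nnBias Q φ s k) := fun s =>
    measurable_nnBias Q s k H.φ_meas
  have hint : ∀ i : Fin (N + 1), Integrable (fun x => (nnBias Q φ Finset.univ k x -
      nnBias Q φ (Finset.univ.erase i) k x) ^ 2) μn := fun i => by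
    refine integrable_of_bounded (((hm _).sub (hm _)).pow_const 2)
      (C := (2 * ((N + 1 : ℕ) * (M * D))) ^ 2) fun x => ?_
    rw [abs_pow]
    refine pow_le_pow_left₀ (abs_nonneg _) ?_ 2
    refine (abs_sub _ _).trans ?_
    have h1 := abs_nnBias_le Q Finset.univ k H.φ_le x
    have h2 := (abs_nnBias_le Q (Finset.univ.erase i) k H.φ_le x).trans (by
      gcongr
      exact Finset.card_le_univ _ : _ ≤ ((Fintype.card (Fin (N + 1)) : ℕ) : ℝ) * (M * D))
    simp only [Finset.card_univ, Fintype.card_fin] at h1 h2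
    linarith
  have hcap : Integrable (fun x => ∫ z, capMean D k x z ∂Q) μn := by
    refine integrable_of_bounded
      (((measurable_capMean k).stronglyMeasurable.integral_prod_right' (ν := Q)).measurable)
      (C := 2 * (Fintype.card (Fin (N + 1)) * D ^ (d + 2))) fun x => ?_
    rw [abs_of_nonneg (integral_nonneg fun z => capMean_nonneg hD _ _ _)]
    have := integral_mono_of_nonneg (μ := Q) (Eventually.of_forall fun z =>
      capMean_nonneg hD k x z) (integrable_const _) (Eventually.of_forall fun z =>
      capMean_le hD k x z)
    simpa using this
  rw [← integral_finsetSum _ fun i _ => hint i]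
  calc ∫ x, ∑ i, (nnBias Q φ Finset.univ k x - nnBias Q φ (Finset.univ.erase i) k x) ^ 2 ∂μn
      ≤ ∫ x, (2 * M / k) ^ 2 * (2 * k * (b * 2 ^ d * unitVol d) *
          ∫ z, capMean D k x z ∂Q) ∂μn := by
        refine integral_mono_ae (integrable_finsetSum _ fun i _ => hint i)
          ((hcap.const_mul _).const_mul _) ?_
        filter_upwards [H.ae_sample (N + 1)] with x hx
        refine le_trans ?_ (mul_le_mul_of_nonneg_left
          (H.sum_sq_integral_capRadius_le hk hk2 hx.1 hx.2) (sq_nonneg _))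
        rw [Finset.mul_sum]
        refine Finset.sum_le_sum fun i _ => ?_
        rw [← mul_pow, ← sq_abs]
        exact pow_le_pow_left₀ (abs_nonneg _) (H.abs_nnBias_sub_le hk hk2 hx.1 hx.2 i) 2
    _ = (2 * M / k) ^ 2 * (2 * k * (b * 2 ^ d * unitVol d)) *
          ∫ x, ∫ z, capMean D k x z ∂Q ∂μn := by
        rw [integral_const_mul, integral_const_mul]; ring
    _ ≤ (2 * M / k) ^ 2 * (2 * k * (b * 2 ^ d * unitVol d)) *
          (C * ((k : ℝ) / (N + 1 : ℕ)) ^ (1 + 2 / (d : ℝ))) := by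
        gcongr; exact hC N k hk hk2
    _ = _ := by
        -- Orders of magnitude: `k⁻² · k · (k/n)^(1+2/d) = n⁻¹ (k/n)^(2/d)`.
        have hk0 : (0 : ℝ) < k := by exact_mod_cast hk
        rw [Real.rpow_add (by positivity), Real.rpow_one]
        field_simp
        ring

end BiasSetting

/-! ### Integrability of sums over independent variables -/

section IndependentSums

/-- For almost every choice of the other coordinates the sum, as a function of the `i`-th one, is
integrable and equals `u i` up to a constant. -/
theorem integrable_of_integrable_sum_pi {n : ℕ} {α : Type*} [MeasurableSpace α]
    (ν : Fin n → Measure α) [∀ i, IsProbabilityMeasure (ν i)] {u : Fin n → α → ℝ}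
    (h : Integrable (fun y => ∑ i, u i (y i)) (Measure.pi ν)) (i : Fin n) :
    Integrable (u i) (ν i) := by
  cases n with
  | zero => exact i.elim0
  | succ N =>
    have hmp := (measurePreserving_piFinSuccAbove ν i).symm
    have h1 := hmp.integrable_comp_of_integrable h
    obtain ⟨y, hy⟩ := h1.prod_left_ae.exists
    have h2 : ∀ x, ((fun y : Fin (N + 1) → α => ∑ i, u i (y i)) ∘
        (MeasurableEquiv.piFinSuccAbove (fun _ => α) i).symm) (x, y) =
        u i x + ∑ j, u (i.succAbove j) (y j) := by
      intro x
      simp [MeasurableEquiv.piFinSuccAbove_symm_apply, Fin.insertNthEquiv,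
        Fin.sum_univ_succAbove _ i]
    simp_rw [h2] at hy
    refine (hy.sub (integrable_const (∑ j, u (i.succAbove j) (y j)))).congr
      (Eventually.of_forall fun x => ?_)
    simp

variable {α β : Type*} [MeasurableSpace α] [MeasurableSpace β]
  (ν : Measure α) (Q : Measure β) [IsProbabilityMeasure ν] [IsProbabilityMeasure Q]

/-- With all target coordinates but one frozen, the sum is `t w` plus a function of the first
component. Subtracting the section at a fixed `z` removes that unknown function. -/
theorem ae_integrable_sub_of_integrable_sum {M : ℕ} {t : α × β → ℝ}
    (h : Integrable (fun w : α × (Fin (M + 1) → β) => ∑ j, t (w.1, w.2 j))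
      (ν.prod (Measure.pi fun _ : Fin (M + 1) => Q))) :
    ∀ᵐ z ∂Q, Integrable (fun w : α × β => t w - t (w.1, z)) (ν.prod Q) := by
  have hmp : MeasurePreserving
      (fun w : (α × β) × (Fin M → β) => (w.1.1, (Fin.cons w.1.2 w.2 : Fin (M + 1) → β)))
      ((ν.prod Q).prod (Measure.pi fun _ : Fin M => Q))
      (ν.prod (Measure.pi fun _ : Fin (M + 1) => Q)) := by
    have h1 := (MeasurePreserving.id ν).prod
      ((measurePreserving_piFinSuccAbove (fun _ : Fin (M + 1) => Q) 0).symm)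
    have h2 := h1.comp (measurePreserving_prodAssoc ν Q (Measure.pi fun _ : Fin M => Q))
    convert! h2 using 1
    funext w
    simp [MeasurableEquiv.piFinSuccAbove_symm_apply, Fin.insertNthEquiv, MeasurableEquiv.prodAssoc]
  have h1 := hmp.integrable_comp_of_integrable h
  obtain ⟨y, hy⟩ := h1.prod_left_ae.exists
  have h2 : ∀ w : α × β, ((fun w : α × (Fin (M + 1) → β) => ∑ j, t (w.1, w.2 j)) ∘
      (fun w : (α × β) × (Fin M → β) => (w.1.1, (Fin.cons w.1.2 w.2 : Fin (M + 1) → β)))) (w, y) =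
      t w + ∑ j, t (w.1, y j) := by
    intro w
    simp [Fin.sum_univ_succ]
  simp_rw [h2] at hy
  filter_upwards [hy.prod_left_ae] with z hz
  have h3 := hy.sub (hz.comp_fst Q)
  refine h3.congr (Eventually.of_forall fun w => ?_)
  simp

/-- Add the differences `t w - t (w.1, zs j)` over `j`, for a typical `zs`. The subtracted sum is a
section of the given integrable sum, so adding it back leaves `(M + 1) t`. -/
theorem integrable_of_integrable_sum {m : ℕ} (hm : 1 ≤ m) {t : α × β → ℝ}
    (h : Integrable (fun w : α × (Fin m → β) => ∑ j, t (w.1, w.2 j))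
      (ν.prod (Measure.pi fun _ : Fin m => Q))) : Integrable t (ν.prod Q) := by
  obtain ⟨M, rfl⟩ : ∃ M, m = M + 1 := ⟨m - 1, by omega⟩
  have h1 := ae_integrable_sub_of_integrable_sum ν Q h
  have h2 : ∀ᵐ zs ∂(Measure.pi fun _ : Fin (M + 1) => Q), ∀ j,
      Integrable (fun w : α × β => t w - t (w.1, zs j)) (ν.prod Q) := by
    rw [ae_all_iff]
    exact fun j =>
      (measurePreserving_eval (fun _ : Fin (M + 1) => Q) j).quasiMeasurePreserving.ae h1
  obtain ⟨zs, hzs, hzs'⟩ := (h2.and h.prod_left_ae).exists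
  have h3 := ((integrable_finsetSum Finset.univ fun j _ => hzs j).add
    (hzs'.comp_fst Q)).const_mul (((M + 1 : ℕ) : ℝ)⁻¹)
  refine h3.congr (Eventually.of_forall fun w => ?_)
  simp only [Pi.add_apply, Finset.sum_sub_distrib, sub_add_cancel, Finset.sum_const,
    Finset.card_univ, Fintype.card_fin, nsmul_eq_mul]
  have : ((M + 1 : ℕ) : ℝ) ≠ 0 := by positivity
  field_simp

theorem integral_sum_prod_pi {m : ℕ} (hm : 1 ≤ m) {t : α × β → ℝ}
    (h : Integrable (fun w : α × (Fin m → β) => ∑ j, t (w.1, w.2 j))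
      (ν.prod (Measure.pi fun _ : Fin m => Q))) :
    ∫ w, ∑ j, t (w.1, w.2 j) ∂(ν.prod (Measure.pi fun _ : Fin m => Q)) =
      m * ∫ w, t w ∂(ν.prod Q) := by
  have ht := integrable_of_integrable_sum ν Q hm h
  have hmp : ∀ j : Fin m, MeasurePreserving (fun w : α × (Fin m → β) => (w.1, w.2 j))
      (ν.prod (Measure.pi fun _ : Fin m => Q)) (ν.prod Q) := fun j =>
    (MeasurePreserving.id ν).prod (measurePreserving_eval (fun _ : Fin m => Q) j)
  have hi : ∀ j : Fin m, Integrable (fun w : α × (Fin m → β) => t (w.1, w.2 j))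
      (ν.prod (Measure.pi fun _ : Fin m => Q)) := fun j =>
    (hmp j).integrable_comp_of_integrable ht
  rw [integral_finsetSum _ fun j _ => hi j]
  have h1 : ∀ j : Fin m, ∫ w, t (w.1, w.2 j) ∂(ν.prod (Measure.pi fun _ : Fin m => Q)) =
      ∫ w, t w ∂(ν.prod Q) := fun j => by
    have := integral_map (hmp j).measurable.aemeasurable (f := t)
      (by rw [(hmp j).map_eq]; exact ht.aestronglyMeasurable)
    rw [(hmp j).map_eq] at this
    exact this.symm
  simp [h1]

/-- The mean of a double sum of functions of independent variables; only the integrability of the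
whole sum is assumed. -/
theorem integral_sum_sum_pi_prod_pi {n m : ℕ} (hm : 1 ≤ m) {γ : Type*} [MeasurableSpace γ]
    (η : Fin n → Measure γ) [∀ i, IsProbabilityMeasure (η i)] {u : Fin n → β → γ → ℝ}
    (h : Integrable (fun w : (Fin n → γ) × (Fin m → β) => ∑ j, ∑ i, u i (w.2 j) (w.1 i))
      ((Measure.pi η).prod (Measure.pi fun _ : Fin m => Q))) :
    ∫ w, ∑ j, ∑ i, u i (w.2 j) (w.1 i)
        ∂((Measure.pi η).prod (Measure.pi fun _ : Fin m => Q)) =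
      m * ∫ z, ∑ i, ∫ y, u i z y ∂(η i) ∂Q := by
  have ht := integrable_of_integrable_sum (Measure.pi η) Q hm
    (t := fun w => ∑ i, u i w.2 (w.1 i)) h
  rw [integral_sum_prod_pi (Measure.pi η) Q hm (t := fun w => ∑ i, u i w.2 (w.1 i)) h,
    integral_prod_symm _ ht]
  congr 1
  refine integral_congr_ae ?_
  filter_upwards [ht.prod_left_ae] with z hz
  have hi := fun i => integrable_of_integrable_sum_pi η (u := fun i y => u i z y) hz i
  have hi' : ∀ i, Integrable (fun y : Fin n → γ => u i z (y i)) (Measure.pi η) := fun i =>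
    (measurePreserving_eval η i).integrable_comp_of_integrable (hi i)
  rw [integral_finsetSum _ fun i _ => hi' i]
  refine Finset.sum_congr rfl fun i _ => ?_
  exact integral_comp_eval (μ := η) (f := u i z) (hi i).aestronglyMeasurable

end IndependentSums

/-! ### The conditional law of the labels -/

section PiKernel

variable {α γ : Type*} [MeasurableSpace α] [MeasurableSpace γ] {n : ℕ}

theorem measurable_pi_kernel (κ : Kernel α γ) [IsMarkovKernel κ] :
    Measurable fun x : Fin n → α => Measure.pi fun i => κ (x i) := by
  refine Measurable.measure_of_isPiSystem_of_isProbabilityMeasure generateFrom_pi.symm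
    isPiSystem_pi ?_
  rintro _ ⟨s, hs, rfl⟩
  simp only [Measure.pi_pi]
  refine Finset.measurable_prod _ fun i _ => ?_
  exact (Kernel.measurable_coe κ (hs i (Set.mem_univ i))).comp (measurable_pi_apply i)

/-- The law of independent labels for the covariates `x`. -/
noncomputable def piKernel (κ : Kernel α γ) [IsMarkovKernel κ] (n : ℕ) :
    Kernel (Fin n → α) (Fin n → γ) where
  toFun x := Measure.pi fun i => κ (x i)
  measurable' := measurable_pi_kernel κ

instance (κ : Kernel α γ) [IsMarkovKernel κ] (n : ℕ) : IsMarkovKernel (piKernel κ n) :=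
  ⟨fun x => by change IsProbabilityMeasure (Measure.pi fun i => κ (x i)); infer_instance⟩

theorem lintegral_pi_prod (P : Measure α) [IsProbabilityMeasure P] (f : Fin n → α → ℝ≥0∞)
    (hf : ∀ i, Measurable (f i)) :
    ∫⁻ x, ∏ i, f i (x i) ∂(Measure.pi fun _ : Fin n => P) = ∏ i, ∫⁻ x, f i x ∂P := by
  rw [lintegral_prod_eq_prod_lintegral_of_indepFun Finset.univ
    (fun i (x : Fin n → α) => f i (x i)) (iIndepFun_pi fun i => (hf i).aemeasurable)
    fun i => (hf i).comp (measurable_pi_apply i)]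
  refine Finset.prod_congr rfl fun i _ => ?_
  have hmp := measurePreserving_eval (fun _ : Fin n => P) i
  exact hmp.lintegral_comp (hf i)

/-- It suffices to identify the product of the joint laws on boxes. There the label kernel
factorises over `i`, and the integral over the independent covariates factorises as well. -/
theorem map_unzip_pi (P : Measure α) [IsProbabilityMeasure P] (κ : Kernel α γ)
    [IsMarkovKernel κ] :
    (Measure.pi fun _ : Fin n => P ⊗ₘ κ).map (fun w => (fun i => (w i).1, fun i => (w i).2)) =
      (Measure.pi fun _ : Fin n => P) ⊗ₘ piKernel κ n := by
  have hz : Measurable fun w : (Fin n → α) × (Fin n → γ) => fun i => (w.1 i, w.2 i) := by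
    fun_prop
  have hu : Measurable fun w : Fin n → α × γ => (fun i => (w i).1, fun i => (w i).2) := by
    fun_prop
  have key : (Measure.pi fun _ : Fin n => P ⊗ₘ κ) =
      ((Measure.pi fun _ : Fin n => P) ⊗ₘ piKernel κ n).map (fun w i => (w.1 i, w.2 i)) := by
    refine Measure.pi_eq fun s hs => ?_
    rw [Measure.map_apply hz (MeasurableSet.univ_pi hs),
      Measure.compProd_apply (hz (MeasurableSet.univ_pi hs))]
    have h1 : ∀ x : Fin n → α, piKernel κ n x (Prod.mk x ⁻¹' ((fun w : (Fin n → α) × (Fin n → γ) =>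
        fun i => (w.1 i, w.2 i)) ⁻¹' Set.univ.pi s)) = ∏ i, κ (x i) (Prod.mk (x i) ⁻¹' s i) := by
      intro x
      have h2 : Prod.mk x ⁻¹' ((fun w : (Fin n → α) × (Fin n → γ) =>
          fun i => (w.1 i, w.2 i)) ⁻¹' Set.univ.pi s) =
          Set.univ.pi fun i => Prod.mk (x i) ⁻¹' s i := by
        ext y; simp
      rw [h2]
      exact Measure.pi_pi _ _
    simp_rw [h1]
    rw [lintegral_pi_prod P (fun i a => κ a (Prod.mk a ⁻¹' s i)) fun i =>
      Kernel.measurable_kernel_prodMk_left (hs i)]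
    exact Finset.prod_congr rfl fun i _ => (Measure.compProd_apply (hs i)).symm
  rw [key, Measure.map_map hu hz]
  exact Measure.map_id

end PiKernel

/-! ### Conditional expectations given the source covariates -/

theorem prod_compProd_map_prodAssoc {α β γ : Type*} [MeasurableSpace α] [MeasurableSpace β]
    [MeasurableSpace γ] (ν : Measure α) [IsProbabilityMeasure ν] (K : Kernel α β)
    [IsMarkovKernel K] (Q : Measure γ) [IsProbabilityMeasure Q] :
    ((ν ⊗ₘ K).prod Q).map MeasurableEquiv.prodAssoc = ν ⊗ₘ (K ×ₖ Kernel.const α Q) := by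
  have : IsFiniteMeasure (((ν ⊗ₘ K).prod Q).map MeasurableEquiv.prodAssoc) :=
    Measure.isFiniteMeasure_map _ _
  refine Measure.ext_prod₃ fun {s t u} hs ht hu => ?_
  rw [Measure.map_apply MeasurableEquiv.prodAssoc.measurable (hs.prod (ht.prod hu))]
  have h1 : MeasurableEquiv.prodAssoc ⁻¹' (s ×ˢ t ×ˢ u) = ((s ×ˢ t) ×ˢ u : Set ((α × β) × γ)) := by
    ext w; simp [MeasurableEquiv.prodAssoc, and_assoc]
  rw [h1, Measure.prod_prod, Measure.compProd_apply_prod hs ht,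
    Measure.compProd_apply_prod hs (ht.prod hu)]
  simp only [Kernel.prod_apply, Kernel.const_apply, Measure.prod_prod]
  rw [lintegral_mul_const _ (Kernel.measurable_coe K ht)]

section Sample

variable {d : ℕ} {Ω : Type*} [MeasurableSpace Ω] {μ : Measure Ω} [IsProbabilityMeasure μ]
  {P Q : Measure (E d)} [IsProbabilityMeasure P] [IsProbabilityMeasure Q]
  {κ : Kernel (E d) ℝ} [IsMarkovKernel κ] {X : ℕ → Ω → E d} {Y : ℕ → Ω → ℝ} {Xs : ℕ → Ω → E d}

/-- The law of the labels and the target covariates given the source covariates. -/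
noncomputable def dataKernel (κ : Kernel (E d) ℝ) [IsMarkovKernel κ] (Q : Measure (E d)) (n m : ℕ)
    : Kernel (Fin n → E d) ((Fin n → ℝ) × (Fin m → E d)) :=
  piKernel κ n ×ₖ Kernel.const _ (Measure.pi fun _ : Fin m => Q)

instance (n m : ℕ) : IsMarkovKernel (dataKernel κ Q n m) := by
  unfold dataKernel; infer_instance

theorem dataKernel_apply (n m : ℕ) (x : Fin n → E d) : dataKernel κ Q n m x =
    (Measure.pi fun i => κ (x i)).prod (Measure.pi fun _ : Fin m => Q) := by
  unfold dataKernel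
  rw [Kernel.prod_apply, Kernel.const_apply]
  rfl

namespace IsSample

omit [IsProbabilityMeasure P] [IsProbabilityMeasure Q] [IsMarkovKernel κ]
  [IsProbabilityMeasure μ] in
theorem measurable_data (hs : IsSample μ P Q κ X Y Xs) (n m : ℕ) :
    Measurable fun ω => ((fun i : Fin n => Y i ω), (fun j : Fin m => Xs j ω)) :=
  (measurable_pi_lambda _ fun i : Fin n => hs.measurable_Y i).prodMk
    (measurable_pi_lambda _ fun j : Fin m => hs.measurable_Xs j)

omit [IsProbabilityMeasure P] [IsProbabilityMeasure Q] [IsMarkovKernel κ]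
  [IsProbabilityMeasure μ] in
theorem measurable_covariates (hs : IsSample μ P Q κ X Y Xs) (n : ℕ) :
    Measurable fun ω (i : Fin n) => X i ω :=
  measurable_pi_lambda _ fun i => hs.measurable_X i

omit [IsProbabilityMeasure P] [IsProbabilityMeasure Q] [IsMarkovKernel κ] in
theorem map_sample (hs : IsSample μ P Q κ X Y Xs) (n m : ℕ) :
    μ.map (fun ω => ((fun i : Fin n => (X i ω, Y i ω)), (fun j : Fin m => Xs j ω))) =
      (Measure.pi fun _ : Fin n => P ⊗ₘ κ).prod (Measure.pi fun _ : Fin m => Q) := by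
  have hXY : ∀ i, Measurable fun ω => (X i ω, Y i ω) := fun i =>
    (hs.measurable_X i).prodMk (hs.measurable_Y i)
  have h1 : μ.map (fun ω (i : Fin n) => (X i ω, Y i ω)) = Measure.pi fun _ : Fin n => P ⊗ₘ κ := by
    have := hs.indep_XY.precomp (g := fun i : Fin n => (i : ℕ)) Fin.val_injective
    rw [(iIndepFun_iff_map_fun_eq_pi_map fun i => (hXY _).aemeasurable).1 this]
    congr 1; funext i; exact hs.law_XY i
  have h2 : μ.map (fun ω (j : Fin m) => Xs j ω) = Measure.pi fun _ : Fin m => Q := by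
    have := hs.indep_Xs.precomp (g := fun i : Fin m => (i : ℕ)) Fin.val_injective
    rw [(iIndepFun_iff_map_fun_eq_pi_map fun i => (hs.measurable_Xs _).aemeasurable).1 this]
    congr 1; funext i; exact hs.law_Xs i
  have h3 := hs.indep.comp (φ := fun x (i : Fin n) => x (i : ℕ))
    (ψ := fun x (j : Fin m) => x (j : ℕ)) (by fun_prop) (by fun_prop)
  rw [← h1, ← h2]
  exact (indepFun_iff_map_prod_eq_prod_map_map
    (measurable_pi_lambda _ fun i : Fin n => hXY i).aemeasurable
    (measurable_pi_lambda _ fun j : Fin m => hs.measurable_Xs j).aemeasurable).1 h3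

theorem map_data (hs : IsSample μ P Q κ X Y Xs) (n m : ℕ) :
    μ.map (fun ω => ((fun i : Fin n => X i ω),
      ((fun i : Fin n => Y i ω), (fun j : Fin m => Xs j ω)))) =
      (Measure.pi fun _ : Fin n => P) ⊗ₘ dataKernel κ Q n m := by
  have hu : Measurable fun w : Fin n → E d × ℝ => (fun i => (w i).1, fun i => (w i).2) := by
    fun_prop
  have hm : Measurable fun ω => ((fun i : Fin n => (X i ω, Y i ω)), (fun j : Fin m => Xs j ω)) :=
    (measurable_pi_lambda _ fun i : Fin n =>
      (hs.measurable_X i).prodMk (hs.measurable_Y i)).prodMk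
      (measurable_pi_lambda _ fun j : Fin m => hs.measurable_Xs j)
  have h1 := congrArg (Measure.map (Prod.map
    (fun w : Fin n → E d × ℝ => (fun i => (w i).1, fun i => (w i).2)) id)) (hs.map_sample n m)
  have h2 := (Measure.map_prod_map (Measure.pi fun _ : Fin n => P ⊗ₘ κ)
    (Measure.pi fun _ : Fin m => Q) hu measurable_id).symm
  rw [Measure.map_id, map_unzip_pi] at h2
  rw [h2, Measure.map_map (hu.prodMap measurable_id) hm] at h1
  have h3 := congrArg (Measure.map MeasurableEquiv.prodAssoc) h1
  rw [prod_compProd_map_prodAssoc, Measure.map_map MeasurableEquiv.prodAssoc.measurable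
    ((hu.prodMap measurable_id).comp hm)] at h3
  exact h3

theorem map_covariates (hs : IsSample μ P Q κ X Y Xs) (n : ℕ) :
    μ.map (fun ω (i : Fin n) => X i ω) = Measure.pi fun _ : Fin n => P := by
  have h := congrArg Measure.fst (hs.map_data n 0)
  rw [Measure.fst_compProd, Measure.fst_map_prodMk (hs.measurable_data n 0)] at h
  exact h

/-- Conditional expectations of functions of the data given the source covariates. -/
theorem condExp_data (hs : IsSample μ P Q κ X Y Xs) (n m : ℕ)
    {f : (Fin n → E d) × ((Fin n → ℝ) × (Fin m → E d)) → ℝ} (hf : Measurable f)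
    (hi : Integrable (fun ω => f ((fun i : Fin n => X i ω),
      ((fun i : Fin n => Y i ω), (fun j : Fin m => Xs j ω)))) μ) :
    ∀ᵐ ω ∂μ,
      Integrable (fun v => f ((fun i : Fin n => X i ω), v))
        (dataKernel κ Q n m fun i : Fin n => X i ω) ∧
      (μ[fun ω => f ((fun i : Fin n => X i ω),
        ((fun i : Fin n => Y i ω), (fun j : Fin m => Xs j ω))) | sigmaX n X]) ω =
        ∫ v, f ((fun i : Fin n => X i ω), v) ∂(dataKernel κ Q n m fun i : Fin n => X i ω) := by
  have hX := hs.measurable_covariates n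
  have hV := hs.measurable_data n m
  have hmap := hs.map_data n m
  have h1 := condExp_prod_ae_eq_integral_condDistrib hX hV.aemeasurable hf.stronglyMeasurable hi
  -- The joint law disintegrates as `P^n ⊗ₘ dataKernel`, and conditional distributions are almost
  -- everywhere unique.
  have h2 : condDistrib (fun ω => ((fun i : Fin n => Y i ω), (fun j : Fin m => Xs j ω)))
      (fun ω (i : Fin n) => X i ω) μ =ᵐ[μ.map fun ω (i : Fin n) => X i ω] dataKernel κ Q n m := by
    refine condDistrib_ae_eq_of_measure_eq_compProd _ hV.aemeasurable ?_
    rw [hs.map_covariates, hmap]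
  have h3 : Integrable f ((Measure.pi fun _ : Fin n => P) ⊗ₘ dataKernel κ Q n m) := by
    rw [← hmap, integrable_map_measure hf.aestronglyMeasurable (hX.prodMk hV).aemeasurable]
    exact hi
  have h4 := ((Measure.integrable_compProd_iff hf.aestronglyMeasurable).1 h3).1
  rw [← hs.map_covariates] at h4
  filter_upwards [h1, ae_of_ae_map hX.aemeasurable h2, ae_of_ae_map hX.aemeasurable h4]
    with ω h1 h2 h4
  refine ⟨h4, ?_⟩
  rw [h1, h2]

end IsSample

/-- The matching estimator for the summand `H z x y`, where `z` is a target covariate and `(x, y)`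
a matched source point. -/
noncomputable def matchSum {n m : ℕ} (k : ℕ) (H : E d → E d → ℝ → ℝ)
    (w : (Fin n → E d) × ((Fin n → ℝ) × (Fin m → E d))) : ℝ :=
  ((m : ℝ) * k)⁻¹ * ∑ j, ∑ i, (nnCell k w.1 i).indicator (fun z => H z (w.1 i) (w.2.1 i)) (w.2.2 j)

theorem measurable_matchSum {n m : ℕ} (k : ℕ) {H : E d → E d → ℝ → ℝ}
    (hH : Measurable fun q : E d × E d × ℝ => H q.1 q.2.1 q.2.2) :
    Measurable (matchSum (n := n) (m := m) k H) := by
  refine Measurable.const_mul (Finset.measurable_sum _ fun j _ => Finset.measurable_sum _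
    fun i _ => ?_) _
  have h1 : MeasurableSet {w : (Fin n → E d) × ((Fin n → ℝ) × (Fin m → E d)) |
      i ∈ lowRank Finset.univ k (fun l => ‖w.1 l - w.2.2 j‖)} :=
    measurableSet_mem_lowRank _ k
      (r := fun w : (Fin n → E d) × ((Fin n → ℝ) × (Fin m → E d)) => fun l => ‖w.1 l - w.2.2 j‖)
      (fun l => by fun_prop) i
  have h2 : Measurable fun w : (Fin n → E d) × ((Fin n → ℝ) × (Fin m → E d)) =>
      H (w.2.2 j) (w.1 i) (w.2.1 i) :=
    hH.comp (f := fun w : (Fin n → E d) × ((Fin n → ℝ) × (Fin m → E d)) =>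
      (w.2.2 j, w.1 i, w.2.1 i)) (by fun_prop)
  exact h2.indicator h1

/-- Given the covariates, labels and targets are independent, so each of the `m` targets contributes
the same integral and `m` cancels. Only the whole sum is assumed integrable; the individual terms
inherit integrability from independence, for almost every value of the covariates. -/
theorem IsSample.condExp_matchSum (hs : IsSample μ P Q κ X Y Xs) {n m k : ℕ} (hm : 1 ≤ m)
    {H : E d → E d → ℝ → ℝ} (hH : Measurable fun q : E d × E d × ℝ => H q.1 q.2.1 q.2.2)
    (hi : Integrable (fun ω => matchSum k H ((fun i : Fin n => X i ω),
      ((fun i : Fin n => Y i ω), (fun j : Fin m => Xs j ω)))) μ) :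
    ∀ᵐ ω ∂μ, (μ[fun ω => matchSum k H ((fun i : Fin n => X i ω),
        ((fun i : Fin n => Y i ω), (fun j : Fin m => Xs j ω))) | sigmaX n X]) ω =
      ∫ z, (k : ℝ)⁻¹ * ∑ i ∈ lowRank Finset.univ k (fun i : Fin n => ‖X i ω - z‖),
        ∫ y, H z (X i ω) y ∂(κ (X i ω)) ∂Q := by
  filter_upwards [hs.condExp_data n m (measurable_matchSum k hH) hi] with ω hω
  obtain ⟨h1, h2⟩ := hω
  rw [h2]
  generalize hx : (fun i : Fin n => X i ω) = x at h1 h2 ⊢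
  have hx' : ∀ i : Fin n, X i ω = x i := fun i => congrFun hx i
  simp only [hx']
  rw [dataKernel_apply] at h1 ⊢
  rcases Nat.eq_zero_or_pos k with rfl | hk
  -- For `k = 0` both sides vanish, as the inverse of zero is zero.
  · simp [matchSum]
  have hmk : ((m : ℝ) * k) ≠ 0 := by positivity
  have hu : Integrable (fun w : (Fin n → ℝ) × (Fin m → E d) =>
      ∑ j, ∑ i, (nnCell k x i).indicator (fun z => H z (x i) (w.1 i)) (w.2 j))
      ((Measure.pi fun i => κ (x i)).prod (Measure.pi fun _ : Fin m => Q)) := by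
    refine (h1.const_mul ((m : ℝ) * k)).congr (Eventually.of_forall fun w => ?_)
    simp only [matchSum]
    rw [mul_inv_cancel_left₀ hmk]
  have h3 := integral_sum_sum_pi_prod_pi Q hm (fun i => κ (x i))
    (u := fun i z y => (nnCell k x i).indicator (fun z => H z (x i) y) z) hu
  simp only [matchSum]
  rw [integral_const_mul, h3, integral_const_mul]
  have h4 : ∀ z, ∑ i, ∫ y, (nnCell k x i).indicator (fun z => H z (x i) y) z ∂(κ (x i)) =
      ∑ i ∈ lowRank Finset.univ k (fun i => ‖x i - z‖), ∫ y, H z (x i) y ∂(κ (x i)) := by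
    intro z
    rw [← Finset.sum_subset (Finset.subset_univ (lowRank Finset.univ k (fun i => ‖x i - z‖)))
      fun i _ hi' => ?_]
    · refine Finset.sum_congr rfl fun i hi' => ?_
      have hz : z ∈ nnCell k x i := hi'
      simp only [Set.indicator_of_mem hz]
    · have hz : z ∉ nnCell k x i := hi'
      simp only [Set.indicator_of_notMem hz, integral_zero]
  simp_rw [h4]
  have hm0 : (m : ℝ) ≠ 0 := by positivity
  field_simp

end Sample

/-! ### The estimators as matching sums -/

/-- Without ties there are exactly `k` neighbours, so the average of the constant `F z z` over them
is `F z z`, and subtracting the target produces the increments `φ`. -/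
theorem BiasSetting.ae_integral_mean_lowRank_sub {d : ℕ} {S : Set (E d)} {P Q : Measure (E d)}
    {p : E d → ℝ} {F φ : E d → E d → ℝ} {a b M D δ : ℝ} {Kp : ℝ≥0} [IsProbabilityMeasure P]
    [IsProbabilityMeasure Q] (H : BiasSetting S P Q p F φ a b M D δ Kp) {n k : ℕ} (hk : 1 ≤ k)
    (hkn : k ≤ n) (hF : Integrable (fun z => F z z) Q) :
    ∀ᵐ x ∂(Measure.pi fun _ : Fin n => P),
      (∫ z, (k : ℝ)⁻¹ * ∑ i ∈ lowRank Finset.univ k (fun i => ‖x i - z‖), F z (x i) ∂Q) -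
        ∫ z, F z z ∂Q = nnBias Q φ Finset.univ k x := by
  filter_upwards [H.ae_sample n] with x hx
  have hk0 : (k : ℝ) ≠ 0 := by positivity
  have h1 : ∀ᵐ z ∂Q, (k : ℝ)⁻¹ * ∑ i ∈ lowRank Finset.univ k (fun i => ‖x i - z‖), F z (x i) =
      (k : ℝ)⁻¹ * (∑ i ∈ lowRank Finset.univ k (fun i => ‖x i - z‖), φ z (x i)) + F z z := by
    filter_upwards [hx.2, H.ae_mem_interior] with z hz hzS
    have hc : (lowRank Finset.univ k (fun i => ‖x i - z‖)).card = k :=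
      card_lowRank hz.injOn (by simpa using hkn)
    have h2 : ∀ i, F z (x i) = φ z (x i) + F z z := fun i => by
      rw [H.φ_eq z (interior_subset hzS) _ (hx.1 i)]; ring
    simp_rw [h2]
    rw [Finset.sum_add_distrib, Finset.sum_const, hc, nsmul_eq_mul]
    field_simp
  rw [integral_congr_ae h1, integral_add (H.integrable_mean_lowRank _ _ _) hF, add_sub_cancel_right]
  rfl

section Estimators

variable {d : ℕ} {Ω : Type*} [MeasurableSpace Ω] {μ : Measure Ω}
  {P Q : Measure (E d)} {κ : Kernel (E d) ℝ} {X : ℕ → Ω → E d} {Y : ℕ → Ω → ℝ} {Xs : ℕ → Ω → E d}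
  {h : E d × ℝ → ℝ} {n m k : ℕ}

theorem norm_sub_le_knnRadius_iff (hk : 1 ≤ k) (hkn : k ≤ n) (x : ℕ → E d) (z : E d) (i : Fin n) :
    ‖x i - z‖ ≤ knnRadius n k x z ↔ z ∈ nnCell k (fun l : Fin n => x l) i := by
  have hc : ∀ r : ℝ, ((Finset.range n).filter fun l => ‖x l - z‖ ≤ r).card =
      ((Finset.univ : Finset (Fin n)).filter fun l : Fin n => ‖x l - z‖ ≤ r).card := fun r => by
    rw [Finset.card_filter, Finset.card_filter, Finset.sum_range]
  simp only [knnRadius, hc]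
  exact le_sInf_iff_mem_lowRank (r := fun l : Fin n => ‖x l - z‖) hk (by simpa using hkn)
    (Finset.mem_univ i)

theorem knnLaw_eq (hk : 1 ≤ k) (hkn : k ≤ n) (x : ℕ → E d) (y : ℕ → ℝ) (z : E d) (A : Set ℝ) :
    knnLaw n k x y z A = (k : ℝ)⁻¹ * ∑ i : Fin n,
      (nnCell k (fun l : Fin n => x l) i).indicator (fun _ => A.indicator 1 (y i)) z := by
  rw [knnLaw, Finset.sum_range]
  congr 1
  refine Finset.sum_congr rfl fun i _ => ?_
  have := norm_sub_le_knnRadius_iff hk hkn x z i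
  by_cases hz : z ∈ nnCell k (fun l : Fin n => x l) i
  · rw [Set.indicator_of_mem hz, Set.indicator_of_mem (by exact this.2 hz)]
    simp
  · rw [Set.indicator_of_notMem hz, Set.indicator_of_notMem (by exact fun h => hz (this.1 h)),
      zero_mul]

omit [MeasurableSpace Ω] in
-- Counting the targets matched to each source point and counting the sources matched to each target
-- are the two orders of summation of one double sum.
theorem estimatorTwo_eq_matchSum (hk : 1 ≤ k) (hkn : k ≤ n) (ω : Ω) :
    estimatorTwo n k m h X Y Xs ω = matchSum k (fun _ x y => h (x, y))
      ((fun i : Fin n => X i ω), ((fun i : Fin n => Y i ω), (fun j : Fin m => Xs j ω))) := by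
  have hn : (n : ℝ) ≠ 0 := by
    have : 0 < n := by omega
    positivity
  rw [estimatorTwo, matchSum, Finset.sum_range, Finset.sum_comm, Finset.mul_sum, Finset.mul_sum]
  refine Finset.sum_congr rfl fun i _ => ?_
  have h1 : (matchCount n k m (fun a => X a ω) (fun j => Xs j ω) (X i ω) : ℝ) =
      ∑ j : Fin m, (nnCell k (fun l : Fin n => X l ω) i).indicator 1 (Xs j ω) := by
    rw [matchCount, Finset.card_filter, Finset.sum_range]
    push_cast
    refine Finset.sum_congr rfl fun j _ => ?_
    have h3 := norm_sub_le_knnRadius_iff hk hkn (fun a => X a ω) (Xs j ω) i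
    by_cases hz : Xs j ω ∈ nnCell k (fun l : Fin n => X l ω) i
    · rw [Set.indicator_of_mem hz, if_pos (h3.2 hz)]; rfl
    · rw [Set.indicator_of_notMem hz, if_neg fun h => hz (h3.1 h)]
  have h2 : ∀ j : Fin m, (nnCell k (fun l : Fin n => X l ω) i).indicator
      (fun _ => h (X i ω, Y i ω)) (Xs j ω) =
      (nnCell k (fun l : Fin n => X l ω) i).indicator 1 (Xs j ω) * h (X i ω, Y i ω) := fun j => by
    by_cases hz : Xs j ω ∈ nnCell k (fun l : Fin n => X l ω) i
    · simp [Set.indicator_of_mem hz]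
    · simp [Set.indicator_of_notMem hz]
  simp only [h2]
  rw [← Finset.sum_mul, h1]
  field_simp

theorem IsSample.integrable_comp (hs : IsSample μ P Q κ X Y Xs) (hhP : Integrable h (P ⊗ₘ κ))
    (i : ℕ) : Integrable (fun ω => h (X i ω, Y i ω)) μ := by
  have hm : Measurable fun ω => (X i ω, Y i ω) := (hs.measurable_X i).prodMk (hs.measurable_Y i)
  rw [← hs.law_XY i] at hhP
  exact hhP.comp_measurable hm

theorem IsSample.measurable_pairs (hs : IsSample μ P Q κ X Y Xs) (n m : ℕ) : Measurable fun ω =>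
    ((fun i : Fin n => (X i ω, Y i ω)), (fun j : Fin m => Xs j ω)) :=
  (measurable_pi_lambda _ fun i : Fin n => (hs.measurable_X i).prodMk (hs.measurable_Y i)).prodMk
    (measurable_pi_lambda _ fun j : Fin m => hs.measurable_Xs j)

theorem IsSample.integrable_matchSum (hs : IsSample μ P Q κ X Y Xs)
    (hhP : Integrable h (P ⊗ₘ κ)) (n m k : ℕ) :
    Integrable (fun ω => matchSum k (fun _ x y => h (x, y)) ((fun i : Fin n => X i ω),
      ((fun i : Fin n => Y i ω), (fun j : Fin m => Xs j ω)))) μ := by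
  refine Integrable.const_mul (integrable_finsetSum _ fun j _ => integrable_finsetSum _
    fun i _ => ?_) _
  have h1 : MeasurableSet {ω | i ∈ lowRank Finset.univ k (fun l : Fin n => ‖X l ω - Xs j ω‖)} :=
    measurableSet_mem_lowRank _ k
      (fun l => ((hs.measurable_X _).sub (hs.measurable_Xs _)).norm) i
  exact (hs.integrable_comp hhP i).indicator h1

end Estimators

/-! ### The conditional mean of the first estimator given all data -/

section Imputation

variable {d : ℕ} {Ω : Type*} [MeasurableSpace Ω] {μ : Measure Ω} [IsProbabilityMeasure μ]
  {P Q : Measure (E d)} {κ : Kernel (E d) ℝ} {X : ℕ → Ω → E d} {Y : ℕ → Ω → ℝ} {Xs : ℕ → Ω → E d}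
  {h : E d × ℝ → ℝ} {n m k : ℕ} {Yhat : Fin m → Ω → ℝ}

/-- The event that the `i`-th source point is matched to the `j`-th target covariate. -/
def matchEvent (n k : ℕ) (X Xs : ℕ → Ω → E d) (i : Fin n) (j : ℕ) : Set Ω :=
  {ω | Xs j ω ∈ nnCell k (fun l : Fin n => X l ω) i}

omit [IsProbabilityMeasure μ] in
theorem IsSample.measurableSet_matchEvent (hs : IsSample μ P Q κ X Y Xs) (k : ℕ) (i : Fin n)
    (j : ℕ) : MeasurableSet (matchEvent n k X Xs i j) :=
  measurableSet_mem_lowRank Finset.univ k (r := fun ω => fun l : Fin n => ‖X l ω - Xs j ω‖)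
    (fun _ => ((hs.measurable_X _).sub (hs.measurable_Xs _)).norm) i

omit [MeasurableSpace Ω] in
theorem knnLaw_univ (hk : 1 ≤ k) (hkn : k ≤ n) {x : ℕ → E d} (y : ℕ → ℝ) {z : E d}
    (hinj : Function.Injective fun l : Fin n => ‖x l - z‖) : knnLaw n k x y z Set.univ = 1 := by
  rw [knnLaw_eq hk hkn]
  have hc : (lowRank Finset.univ k (fun l : Fin n => ‖x l - z‖)).card = k :=
    card_lowRank hinj.injOn (by simpa using hkn)
  have h1 : ∑ i : Fin n, (nnCell k (fun l : Fin n => x l) i).indicator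
      (fun _ => Set.univ.indicator (1 : ℝ → ℝ) (y i)) z = k := by
    rw [← Finset.sum_subset (Finset.subset_univ
      (lowRank Finset.univ k (fun l : Fin n => ‖x l - z‖))) fun i _ hi => ?_]
    · rw [Finset.sum_congr rfl (g := fun _ => (1 : ℝ)) fun i hi => ?_]
      · simp [hc]
      · have hz : z ∈ nnCell k (fun l : Fin n => x l) i := hi
        rw [Set.indicator_of_mem hz]; simp
    · have hz : z ∉ nnCell k (fun l : Fin n => x l) i := hi
      rw [Set.indicator_of_notMem hz]
  rw [h1]
  exact inv_mul_cancel₀ (by positivity)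

/-- Test the conditional law on product sets that are trivial except in the `j`-th coordinate.
Without ties the other factors have total mass one, and only the law of the `j`-th label remains. -/
theorem IsImputation.measureReal_inter (hI : IsImputation μ n k m X Y Xs Yhat)
    (hs : IsSample μ P Q κ X Y Xs) (hk : 1 ≤ k) (hkn : k ≤ n)
    (hinj : ∀ᵐ ω ∂μ, ∀ j : Fin m, Function.Injective fun l : Fin n => ‖X l ω - Xs j ω‖)
    (j : Fin m) {s : Set Ω} (hsm : MeasurableSet[sigmaAll n m X Y Xs] s) {t : Set ℝ}
    (ht : MeasurableSet t) :
    μ.real (s ∩ Yhat j ⁻¹' t) =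
      ∑ i : Fin n, (k : ℝ)⁻¹ * μ.real (s ∩ (matchEvent n k X Xs i j ∩ Y i ⁻¹' t)) := by
  classical
  have hle : sigmaAll n m X Y Xs ≤ ‹MeasurableSpace Ω› := (hs.measurable_pairs n m).comap_le
  have hA : ∀ l : Fin m, MeasurableSet (if l = j then t else Set.univ) := fun l => by
    split_ifs
    exacts [ht, MeasurableSet.univ]
  have hc := hI.cond_law (fun l => if l = j then t else Set.univ) hA
  have h1 : ⋂ l, Yhat l ⁻¹' (if l = j then t else Set.univ) = Yhat j ⁻¹' t := by
    ext ω
    simp only [Set.mem_iInter, Set.mem_preimage]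
    refine ⟨fun hω => by simpa using hω j, fun hω l => ?_⟩
    split_ifs with hl
    · rwa [hl]
    · trivial
  rw [h1] at hc
  have hYt : MeasurableSet (Yhat j ⁻¹' t) := hI.measurable j ht
  have hint := setIntegral_condExp (μ := μ) hle
    ((integrable_const (1 : ℝ)).indicator hYt) hsm
  have hB : ∀ i : Fin n, MeasurableSet (matchEvent n k X Xs i j ∩ Y i ⁻¹' t) := fun i =>
    (hs.measurableSet_matchEvent k i j).inter (hs.measurable_Y i ht)
  have h2 : ∀ᵐ ω ∂μ, (μ[(Yhat j ⁻¹' t).indicator (fun _ => (1 : ℝ)) | sigmaAll n m X Y Xs]) ω =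
      ∑ i : Fin n, (k : ℝ)⁻¹ *
        (matchEvent n k X Xs i j ∩ Y i ⁻¹' t).indicator (fun _ => (1 : ℝ)) ω := by
    filter_upwards [hc, hinj] with ω hω hωi
    rw [hω, Finset.prod_eq_single j (fun l _ hl => by
      rw [if_neg hl]; exact knnLaw_univ hk hkn _ (hωi l)) (by simp), if_pos rfl,
      knnLaw_eq hk hkn, Finset.mul_sum]
    refine Finset.sum_congr rfl fun i _ => ?_
    congr 1
    simp only [Set.indicator_apply, Set.mem_inter_iff, Set.mem_preimage, matchEvent,
      Set.mem_ofPred_eq, Pi.one_apply]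
    split_ifs <;> simp_all
  rw [setIntegral_congr_ae (g := fun ω => ∑ i : Fin n, (k : ℝ)⁻¹ *
    (matchEvent n k X Xs i j ∩ Y i ⁻¹' t).indicator (fun _ => (1 : ℝ)) ω) (hle s hsm)
    (h2.mono fun ω hω _ => hω), integral_finsetSum _ fun i _ =>
      (((integrable_const (1 : ℝ)).indicator (hB i)).integrableOn.const_mul _)] at hint
  have h3 : ∀ B : Set Ω, MeasurableSet B →
      ∫ ω in s, B.indicator (fun _ => (1 : ℝ)) ω ∂μ = μ.real (s ∩ B) := fun B hB => by
    rw [integral_indicator_const _ hB, smul_eq_mul, mul_one, measureReal_restrict_apply hB,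
      Set.inter_comm]
  rw [h3 _ hYt] at hint
  rw [← hint]
  refine Finset.sum_congr rfl fun i _ => ?_
  rw [integral_const_mul, h3 _ (hB i)]

/-- The joint law of the data and an imputed label. -/
theorem IsImputation.map_eq (hI : IsImputation μ n k m X Y Xs Yhat)
    (hs : IsSample μ P Q κ X Y Xs) (hk : 1 ≤ k) (hkn : k ≤ n)
    (hinj : ∀ᵐ ω ∂μ, ∀ j : Fin m, Function.Injective fun l : Fin n => ‖X l ω - Xs j ω‖)
    (j : Fin m) :
    μ.map (fun ω => (((fun i : Fin n => (X i ω, Y i ω)), (fun j : Fin m => Xs j ω)), Yhat j ω)) =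
      ∑ i : Fin n, (k : ℝ≥0∞)⁻¹ • (μ.restrict (matchEvent n k X Xs i j)).map
        (fun ω => (((fun i : Fin n => (X i ω, Y i ω)), (fun j : Fin m => Xs j ω)), Y i ω)) := by
  have hD := hs.measurable_pairs n m
  have hk0 : (k : ℝ≥0∞) ≠ 0 := by exact_mod_cast (by omega : k ≠ 0)
  have h1 := hD.prodMk (hI.measurable j)
  have h2 := fun i : Fin n => hD.prodMk (hs.measurable_Y i)
  have : IsFiniteMeasure (μ.map (fun ω => (((fun i : Fin n => (X i ω, Y i ω)),
    (fun j : Fin m => Xs j ω)), Yhat j ω))) := Measure.isFiniteMeasure_map _ _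
  refine Measure.ext_prod fun {s t} hsm ht => ?_
  rw [Measure.map_apply h1 (hsm.prod ht), Measure.finsetSum_apply]
  simp only [Measure.smul_apply, smul_eq_mul]
  have h3 := hI.measureReal_inter hs hk hkn hinj j (s := (fun ω => ((fun i : Fin n =>
    (X i ω, Y i ω)), (fun j : Fin m => Xs j ω))) ⁻¹' s) ⟨s, hsm, rfl⟩ ht
  have h4 : ∀ i : Fin n, (μ.restrict (matchEvent n k X Xs i j)).map (fun ω =>
      (((fun i : Fin n => (X i ω, Y i ω)), (fun j : Fin m => Xs j ω)), Y i ω)) (s ×ˢ t) =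
      μ ((fun ω => ((fun i : Fin n => (X i ω, Y i ω)), (fun j : Fin m => Xs j ω))) ⁻¹' s ∩
        (matchEvent n k X Xs i j ∩ Y i ⁻¹' t)) := fun i => by
    rw [Measure.map_apply (h2 i) (hsm.prod ht), Measure.restrict_apply (h2 i (hsm.prod ht))]
    congr 1
    ext ω
    simp only [Set.mem_inter_iff, Set.mem_preimage, Set.mem_prod]
    tauto
  simp only [h4]
  rw [← ENNReal.toReal_eq_toReal_iff' (measure_ne_top _ _)
    (ENNReal.sum_ne_top.2 fun i _ => ENNReal.mul_ne_top (ENNReal.inv_ne_top.2 hk0)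
      (measure_ne_top _ _)), ENNReal.toReal_sum fun i _ =>
      ENNReal.mul_ne_top (ENNReal.inv_ne_top.2 hk0) (measure_ne_top _ _)]
  simp only [ENNReal.toReal_mul, ENNReal.toReal_inv, ENNReal.toReal_natCast]
  exact h3

/-- Integrals of functions of the data and an imputed label. -/
theorem IsImputation.integral_eq (hI : IsImputation μ n k m X Y Xs Yhat)
    (hs : IsSample μ P Q κ X Y Xs) (hk : 1 ≤ k) (hkn : k ≤ n)
    (hinj : ∀ᵐ ω ∂μ, ∀ j : Fin m, Function.Injective fun l : Fin n => ‖X l ω - Xs j ω‖)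
    (j : Fin m) {f : ((Fin n → E d × ℝ) × (Fin m → E d)) × ℝ → ℝ} (hf : Measurable f)
    (hi : ∀ i : Fin n, Integrable (fun ω => f (((fun i : Fin n => (X i ω, Y i ω)),
      (fun j : Fin m => Xs j ω)), Y i ω)) μ) :
    Integrable (fun ω => f (((fun i : Fin n => (X i ω, Y i ω)),
      (fun j : Fin m => Xs j ω)), Yhat j ω)) μ ∧
    ∫ ω, f (((fun i : Fin n => (X i ω, Y i ω)), (fun j : Fin m => Xs j ω)), Yhat j ω) ∂μ =
      ∑ i : Fin n, (k : ℝ)⁻¹ * ∫ ω, (matchEvent n k X Xs i j).indicator (fun ω =>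
        f (((fun i : Fin n => (X i ω, Y i ω)), (fun j : Fin m => Xs j ω)), Y i ω)) ω ∂μ := by
  have hD := hs.measurable_pairs n m
  have hk0 : (k : ℝ≥0∞) ≠ 0 := by exact_mod_cast (by omega : k ≠ 0)
  have h1 := hD.prodMk (hI.measurable j)
  have h2 := fun i : Fin n => hD.prodMk (hs.measurable_Y i)
  have h3 : ∀ i ∈ (Finset.univ : Finset (Fin n)), Integrable f ((k : ℝ≥0∞)⁻¹ •
      (μ.restrict (matchEvent n k X Xs i j)).map (fun ω => (((fun i : Fin n => (X i ω, Y i ω)),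
        (fun j : Fin m => Xs j ω)), Y i ω))) := fun i _ => by
    refine Integrable.smul_measure ?_ (ENNReal.inv_ne_top.2 hk0)
    rw [integrable_map_measure hf.aestronglyMeasurable (h2 i).aemeasurable]
    exact (hi i).integrableOn
  have h4 := integrable_finsetSum_measure.2 h3
  rw [← hI.map_eq hs hk hkn hinj j] at h4
  constructor
  · exact (integrable_map_measure hf.aestronglyMeasurable h1.aemeasurable).1 h4
  · rw [← integral_map h1.aemeasurable hf.aestronglyMeasurable, hI.map_eq hs hk hkn hinj j,
      integral_finsetSum_measure h3]
    refine Finset.sum_congr rfl fun i _ => ?_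
    rw [integral_smul_measure, integral_map (h2 i).aemeasurable hf.aestronglyMeasurable,
      integral_indicator (hs.measurableSet_matchEvent k i j), ENNReal.toReal_inv,
      ENNReal.toReal_natCast, smul_eq_mul]

omit [MeasurableSpace Ω] in
theorem matchSum_eq_sum_indicator (H : E d → E d → ℝ → ℝ) (ω : Ω) :
    matchSum k H ((fun i : Fin n => X i ω), ((fun i : Fin n => Y i ω),
      (fun j : Fin m => Xs j ω))) =
      (m : ℝ)⁻¹ * ∑ j : Fin m, ∑ i : Fin n, (k : ℝ)⁻¹ *
        (matchEvent n k X Xs i j).indicator (fun ω => H (Xs j ω) (X i ω) (Y i ω)) ω := by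
  simp only [matchSum, ← Finset.mul_sum]
  rw [mul_inv, mul_assoc]
  rfl

/-- On an event of the data where every `h(Xs j, Y i)` is bounded by `R`, each term is integrable,
and the imputed label may be averaged out term by term. -/
theorem IsImputation.setIntegral_estimatorOne (hI : IsImputation μ n k m X Y Xs Yhat)
    (hs : IsSample μ P Q κ X Y Xs) (hh : Measurable h) (hk : 1 ≤ k) (hkn : k ≤ n)
    (hinj : ∀ᵐ ω ∂μ, ∀ j : Fin m, Function.Injective fun l : Fin n => ‖X l ω - Xs j ω‖)
    {A : Set ((Fin n → E d × ℝ) × (Fin m → E d))} (hA : MeasurableSet A) {R : ℝ} (hR : 0 ≤ R)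
    (hAR : ∀ w ∈ A, ∀ i j, |h (w.2 j, (w.1 i).2)| ≤ R) :
    Integrable (((fun ω => ((fun i : Fin n => (X i ω, Y i ω)), (fun j : Fin m => Xs j ω))) ⁻¹'
      A).indicator fun ω => matchSum k (fun z _ y => h (z, y)) ((fun i : Fin n => X i ω),
        ((fun i : Fin n => Y i ω), (fun j : Fin m => Xs j ω)))) μ ∧
    ∫ ω, (((fun ω => ((fun i : Fin n => (X i ω, Y i ω)), (fun j : Fin m => Xs j ω))) ⁻¹'
      A).indicator fun ω => matchSum k (fun z _ y => h (z, y)) ((fun i : Fin n => X i ω),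
        ((fun i : Fin n => Y i ω), (fun j : Fin m => Xs j ω)))) ω ∂μ =
      ∫ ω, (((fun ω => ((fun i : Fin n => (X i ω, Y i ω)), (fun j : Fin m => Xs j ω))) ⁻¹'
        A).indicator (estimatorOne m h Xs Yhat)) ω ∂μ := by
  have hDm := hs.measurable_pairs n m
  set D : Ω → (Fin n → E d × ℝ) × (Fin m → E d) := fun ω =>
    ((fun i : Fin n => (X i ω, Y i ω)), (fun j : Fin m => Xs j ω)) with hD
  have hbound : ∀ (i : Fin n) (j : Fin m) ω,
      |(D ⁻¹' A).indicator (fun ω => h (Xs j ω, Y i ω)) ω| ≤ R := fun i j ω => by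
    by_cases hω : ω ∈ D ⁻¹' A
    · rw [Set.indicator_of_mem hω]; exact hAR _ hω i j
    · rw [Set.indicator_of_notMem hω, abs_zero]; exact hR
  have hint : ∀ (i : Fin n) (j : Fin m),
      Integrable ((D ⁻¹' A).indicator (fun ω => h (Xs j ω, Y i ω))) μ := fun i j =>
    integrable_of_bounded ((hh.comp ((hs.measurable_Xs j).prodMk (hs.measurable_Y i))).indicator
      (hDm hA)) (hbound i j)
  have hone : ∀ j : Fin m, Integrable ((D ⁻¹' A).indicator (fun ω => h (Xs j ω, Yhat j ω))) μ ∧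
      ∫ ω, (D ⁻¹' A).indicator (fun ω => h (Xs j ω, Yhat j ω)) ω ∂μ =
      ∑ i : Fin n, (k : ℝ)⁻¹ * ∫ ω, (matchEvent n k X Xs i j).indicator
        ((D ⁻¹' A).indicator fun ω => h (Xs j ω, Y i ω)) ω ∂μ := fun j =>
    hI.integral_eq hs hk hkn hinj j
      (f := (Prod.fst ⁻¹' A).indicator fun v => h (v.1.2 j, v.2))
      ((hh.comp (f := fun v : ((Fin n → E d × ℝ) × (Fin m → E d)) × ℝ => (v.1.2 j, v.2))
        (by fun_prop)).indicator (measurable_fst hA)) fun i => hint i j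
  have hmi : ∀ (i : Fin n) (j : Fin m), Integrable (fun ω => (k : ℝ)⁻¹ *
      (matchEvent n k X Xs i j).indicator
        ((D ⁻¹' A).indicator fun ω => h (Xs j ω, Y i ω)) ω) μ := fun i j =>
    ((hint i j).indicator (hs.measurableSet_matchEvent k i j)).const_mul _
  have hT : ∀ ω, (D ⁻¹' A).indicator (fun ω => matchSum k (fun z _ y => h (z, y))
      ((fun i : Fin n => X i ω), ((fun i : Fin n => Y i ω), (fun j : Fin m => Xs j ω)))) ω =
      (m : ℝ)⁻¹ * ∑ j : Fin m, ∑ i : Fin n, (k : ℝ)⁻¹ * (matchEvent n k X Xs i j).indicator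
        ((D ⁻¹' A).indicator fun ω => h (Xs j ω, Y i ω)) ω := fun ω => by
    by_cases hω : ω ∈ D ⁻¹' A
    · rw [Set.indicator_of_mem hω, matchSum_eq_sum_indicator]
      congr 1
      refine Finset.sum_congr rfl fun j _ => Finset.sum_congr rfl fun i _ => ?_
      congr 1
      by_cases hz : ω ∈ matchEvent n k X Xs i j
      · rw [Set.indicator_of_mem hz, Set.indicator_of_mem hz, Set.indicator_of_mem hω]
      · rw [Set.indicator_of_notMem hz, Set.indicator_of_notMem hz]
    · rw [Set.indicator_of_notMem hω]
      symm
      refine mul_eq_zero_of_right _ (Finset.sum_eq_zero fun j _ => Finset.sum_eq_zero fun i _ => ?_)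
      rw [Set.indicator_apply_eq_zero.2 fun _ => Set.indicator_of_notMem hω _, mul_zero]
  have hE : ∀ ω, (D ⁻¹' A).indicator (estimatorOne m h Xs Yhat) ω =
      (m : ℝ)⁻¹ * ∑ j : Fin m, (D ⁻¹' A).indicator (fun ω => h (Xs j ω, Yhat j ω)) ω := fun ω => by
    by_cases hω : ω ∈ D ⁻¹' A
    · simp only [Set.indicator_of_mem hω]; rfl
    · simp only [Set.indicator_of_notMem hω]; simp
  constructor
  · refine Integrable.congr ((integrable_finsetSum Finset.univ fun j _ => integrable_finsetSum
      Finset.univ fun i _ => hmi i j).const_mul ((m : ℝ)⁻¹)) (Eventually.of_forall fun ω => ?_)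
    exact (hT ω).symm
  · simp_rw [hT, hE]
    rw [integral_const_mul, integral_const_mul, integral_finsetSum _ fun j _ => (hone j).1,
      integral_finsetSum _ fun j _ => integrable_finsetSum _ fun i _ => hmi i j]
    congr 1
    refine Finset.sum_congr rfl fun j _ => ?_
    rw [(hone j).2, integral_finsetSum _ fun i _ => hmi i j]
    exact Finset.sum_congr rfl fun i _ => integral_const_mul _ _

omit [MeasurableSpace Ω] in
theorem measurable_matchSum_sigmaAll (k : ℕ) {H : E d → E d → ℝ → ℝ}
    (hH : Measurable fun q : E d × E d × ℝ => H q.1 q.2.1 q.2.2) :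
    Measurable[sigmaAll n m X Y Xs] fun ω => matchSum k H ((fun i : Fin n => X i ω),
      ((fun i : Fin n => Y i ω), (fun j : Fin m => Xs j ω))) := by
  have h1 : Measurable fun w : (Fin n → E d × ℝ) × (Fin m → E d) =>
      ((fun i => (w.1 i).1), ((fun i => (w.1 i).2), w.2)) := by fun_prop
  obtain ⟨f, hf⟩ : ∃ f, f = matchSum (n := n) (m := m) k H := ⟨_, rfl⟩
  have h2 : Measurable f := by rw [hf]; exact measurable_matchSum k hH
  rw [← hf]
  have h3 : Measurable fun w : (Fin n → E d × ℝ) × (Fin m → E d) =>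
      f ((fun i => (w.1 i).1), ((fun i => (w.1 i).2), w.2)) := h2.comp h1
  exact @Measurable.comp _ _ _ (sigmaAll n m X Y Xs) _ _ _
    (fun ω => ((fun i : Fin n => (X i ω, Y i ω)), (fun j : Fin m => Xs j ω))) h3
    (comap_measurable _)

/-- The conditional mean of the first estimator given all data is a matching sum. -/
theorem IsImputation.condExp_estimatorOne (hI : IsImputation μ n k m X Y Xs Yhat)
    (hs : IsSample μ P Q κ X Y Xs) (hh : Measurable h) (hk : 1 ≤ k) (hkn : k ≤ n)
    (hinj : ∀ᵐ ω ∂μ, ∀ j : Fin m, Function.Injective fun l : Fin n => ‖X l ω - Xs j ω‖)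
    (hint : Integrable (estimatorOne m h Xs Yhat) μ) :
    μ[estimatorOne m h Xs Yhat | sigmaAll n m X Y Xs] =ᵐ[μ]
      fun ω => matchSum k (fun z _ y => h (z, y)) ((fun i : Fin n => X i ω),
        ((fun i : Fin n => Y i ω), (fun j : Fin m => Xs j ω))) := by
  have hDm := hs.measurable_pairs n m
  have hle : sigmaAll n m X Y Xs ≤ ‹MeasurableSpace Ω› := hDm.comap_le
  set D : Ω → (Fin n → E d × ℝ) × (Fin m → E d) := fun ω =>
    ((fun i : Fin n => (X i ω, Y i ω)), (fun j : Fin m => Xs j ω)) with hD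
  set T : Ω → ℝ := fun ω => matchSum k (fun z _ y => h (z, y)) ((fun i : Fin n => X i ω),
        ((fun i : Fin n => Y i ω), (fun j : Fin m => Xs j ω))) with hT
  have hTm : Measurable[sigmaAll n m X Y Xs] T := measurable_matchSum_sigmaAll k
    (H := fun z _ y => h (z, y))
    (hh.comp (f := fun q : E d × E d × ℝ => (q.1, q.2.2)) (by fun_prop))
  -- The matching sum is not yet known to be integrable, so its conditional expectation property is
  -- tested after truncation to events on which all possible matched values are at most `R`. These
  -- events belong to the conditioning σ-algebra.
  let A : ℕ → Set ((Fin n → E d × ℝ) × (Fin m → E d)) := fun R =>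
    {w | ∀ i j, |h (w.2 j, (w.1 i).2)| ≤ R}
  have hA : ∀ R, MeasurableSet (A R) := fun R => by
    have : A R = ⋂ (i : Fin n) (j : Fin m), {w | |h (w.2 j, (w.1 i).2)| ≤ R} := by
      ext w; simp [A]
    rw [this]
    refine MeasurableSet.iInter fun i => MeasurableSet.iInter fun j => ?_
    exact measurableSet_le (hh.comp (f := fun w : (Fin n → E d × ℝ) × (Fin m → E d) =>
      (w.2 j, (w.1 i).2)) (by fun_prop)).abs measurable_const
  have key : ∀ R : ℕ, (D ⁻¹' A R).indicator T =ᵐ[μ]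
      μ[(D ⁻¹' A R).indicator (estimatorOne m h Xs Yhat) | sigmaAll n m X Y Xs] := fun R => by
    refine ae_eq_condExp_of_forall_setIntegral_eq hle (hint.indicator (hDm (hA R)))
      (fun s _ _ => ?_) (fun s hsm _ => ?_) ?_
    · exact (hI.setIntegral_estimatorOne hs hh hk hkn hinj (hA R) (Nat.cast_nonneg R)
        fun w hw => hw).1.integrableOn
    · obtain ⟨B, hB, rfl⟩ := hsm
      have h2 := (hI.setIntegral_estimatorOne hs hh hk hkn hinj (hB.inter (hA R))
        (Nat.cast_nonneg R) fun w hw => hw.2).2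
      rw [← integral_indicator (hDm hB), ← integral_indicator (hDm hB), Set.indicator_indicator,
        Set.indicator_indicator]
      exact h2
    · exact (hTm.indicator ⟨_, hA R, rfl⟩).aestronglyMeasurable
  have key2 : ∀ᵐ ω ∂μ, ∀ R : ℕ, (D ⁻¹' A R).indicator T ω = (D ⁻¹' A R).indicator
      (μ[estimatorOne m h Xs Yhat | sigmaAll n m X Y Xs]) ω := by
    rw [ae_all_iff]
    intro R
    exact (key R).trans (condExp_indicator hint ⟨_, hA R, rfl⟩)
  filter_upwards [key2] with ω hω
  -- Every `ω` belongs to the truncation event for all large `R`, since only finitely many values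
  -- occur; the truncations therefore determine the conditional expectation.
  obtain ⟨R, hR⟩ := exists_nat_ge (∑ i : Fin n, ∑ j : Fin m, |h (Xs j ω, Y i ω)|)
  have hmem : ω ∈ D ⁻¹' A R := fun i j => by
    refine le_trans ?_ hR
    refine le_trans ?_ (Finset.single_le_sum (f := fun i : Fin n => ∑ j : Fin m,
      |h (Xs j ω, Y i ω)|) (fun i _ => Finset.sum_nonneg fun j _ => abs_nonneg _)
      (Finset.mem_univ i))
    exact Finset.single_le_sum (f := fun j : Fin m => |h (Xs j ω, Y i ω)|)
      (fun j _ => abs_nonneg _) (Finset.mem_univ j)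
  have h3 := hω R
  rw [Set.indicator_of_mem hmem, Set.indicator_of_mem hmem] at h3
  exact h3.symm

end Imputation

/-! ### The expansions of the bias and of its second moment -/

section Expansion

variable {d : ℕ} {Ω : Type*} [MeasurableSpace Ω] {μ : Measure Ω} [IsProbabilityMeasure μ]
  {P Q : Measure (E d)} [IsProbabilityMeasure P] [IsProbabilityMeasure Q]
  {κ : Kernel (E d) ℝ} [IsMarkovKernel κ] {X : ℕ → Ω → E d} {Y : ℕ → Ω → ℝ} {Xs : ℕ → Ω → E d}
  {h : E d × ℝ → ℝ} {S : Set (E d)} {p : E d → ℝ} {F φ : E d → E d → ℝ} {a b M D δ : ℝ} {Kp : ℝ≥0}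

theorem target_eq (hhQ : Integrable h (Q ⊗ₘ κ)) : target Q κ h = ∫ z, regression κ h z ∂Q :=
  Measure.integral_compProd hhQ

theorem integrable_regression (hhQ : Integrable h (Q ⊗ₘ κ)) : Integrable (regression κ h) Q :=
  (MeasureTheory.Integrable.integral_compProd (κ := Kernel.const Unit Q)
    (η := Kernel.prodMkLeft Unit κ) (a := ()) hhQ :)

theorem BiasSetting.ae_injective_sample (H : BiasSetting S P Q p F φ a b M D δ Kp)
    (hs : IsSample μ P Q κ X Y Xs) (n m : ℕ) :
    ∀ᵐ ω ∂μ, ∀ j : Fin m, Function.Injective fun l : Fin n => ‖X l ω - Xs j ω‖ := by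
  rw [ae_all_iff]
  intro j
  have h1 : MeasurePreserving (fun w : Fin n → E d × ℝ => fun i => (w i).1)
      (Measure.pi fun _ : Fin n => P ⊗ₘ κ) (Measure.pi fun _ : Fin n => P) :=
    measurePreserving_pi _ _ fun _ => ⟨measurable_fst, Measure.fst_compProd P κ⟩
  have h2 := h1.prod (measurePreserving_eval (fun _ : Fin m => Q) j)
  have h3 : ∀ᵐ w ∂((Measure.pi fun _ : Fin n => P).prod Q),
      Function.Injective fun l => ‖w.1 l - w.2‖ := by
    rw [Measure.ae_prod_iff_ae_ae (measurableSet_injective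
      (r := fun (w : (Fin n → E d) × E d) l => ‖w.1 l - w.2‖) fun l => by fun_prop)]
    filter_upwards [H.ae_sample n] with x hx using hx.2
  have h4 := h2.quasiMeasurePreserving.ae h3
  rw [← hs.map_sample n m] at h4
  exact ae_of_ae_map (hs.measurable_pairs n m).aemeasurable h4

theorem BiasSetting.ae_condExp_matchSum_sub (H : BiasSetting S P Q p F φ a b M D δ Kp)
    (hs : IsSample μ P Q κ X Y Xs) {n m k : ℕ} (hk : 1 ≤ k) (hkn : k ≤ n) (hm : 1 ≤ m)
    {G : E d → E d → ℝ → ℝ} (hG : Measurable fun q : E d × E d × ℝ => G q.1 q.2.1 q.2.2)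
    (hF : ∀ z x, F z x = ∫ y, G z x y ∂(κ x)) (hFi : Integrable (fun z => F z z) Q)
    (hi : Integrable (fun ω => matchSum k G ((fun i : Fin n => X i ω),
      ((fun i : Fin n => Y i ω), (fun j : Fin m => Xs j ω)))) μ) :
    ∀ᵐ ω ∂μ, (μ[fun ω => matchSum k G ((fun i : Fin n => X i ω),
        ((fun i : Fin n => Y i ω), (fun j : Fin m => Xs j ω))) | sigmaX n X]) ω -
      ∫ z, F z z ∂Q = nnBias Q φ Finset.univ k (fun i : Fin n => X i ω) := by
  have h1 := H.ae_integral_mean_lowRank_sub hk hkn hFi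
  rw [← hs.map_covariates] at h1
  filter_upwards [hs.condExp_matchSum hm hG hi,
    ae_of_ae_map (hs.measurable_covariates n).aemeasurable h1] with ω h2 h3
  rw [h2, ← h3]
  simp only [hF]

theorem BiasSetting.condBias_estimatorOne
    (H : BiasSetting S P Q p (crossRegression κ h) φ a b M D δ Kp)
    (hs : IsSample μ P Q κ X Y Xs) (hh : Measurable h) (hhQ : Integrable h (Q ⊗ₘ κ))
    {n m k : ℕ} (hk : 1 ≤ k) (hkn : k ≤ n) (hm : 1 ≤ m) {Yhat : Fin m → Ω → ℝ}
    (hI : IsImputation μ n k m X Y Xs Yhat) (hint : Integrable (estimatorOne m h Xs Yhat) μ) :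
    condBias μ n X (estimatorOne m h Xs Yhat) (target Q κ h) =ᵐ[μ]
      fun ω => nnBias Q φ Finset.univ k (fun i : Fin n => X i ω) := by
  have hle : sigmaAll n m X Y Xs ≤ ‹MeasurableSpace Ω› := (hs.measurable_pairs n m).comap_le
  have hX : sigmaX n X ≤ sigmaAll n m X Y Xs := by
    have h1 : Measurable fun w : (Fin n → E d × ℝ) × (Fin m → E d) => fun i => (w.1 i).1 := by
      fun_prop
    rintro _ ⟨s, hs', rfl⟩
    exact ⟨_, h1 hs', rfl⟩
  have hc := hI.condExp_estimatorOne hs hh hk hkn (H.ae_injective_sample hs n m) hint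
  -- Tower property: first average over the imputation given all data, then over the data given the
  -- source covariates. The matching sum is integrable because it agrees with a conditional
  -- expectation.
  have h1 := (condExp_condExp_of_le (f := estimatorOne m h Xs Yhat) (μ := μ) hX hle).symm.trans
    (condExp_congr_ae hc)
  have hi := (integrable_condExp (m := sigmaAll n m X Y Xs) (μ := μ)
    (f := estimatorOne m h Xs Yhat)).congr hc
  have h2 := H.ae_condExp_matchSum_sub hs hk hkn hm (G := fun z _ y => h (z, y))
    (hh.comp (f := fun q : E d × E d × ℝ => (q.1, q.2.2)) (by fun_prop)) (fun _ _ => rfl)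
    (integrable_regression hhQ) hi
  filter_upwards [h1, h2] with ω h1 h2
  rw [condBias, target_eq hhQ, ← h2, h1]
  rfl

theorem BiasSetting.condBias_estimatorTwo
    (H : BiasSetting S P Q p (fun _ => regression κ h) φ a b M D δ Kp)
    (hs : IsSample μ P Q κ X Y Xs) (hh : Measurable h) (hhP : Integrable h (P ⊗ₘ κ))
    (hhQ : Integrable h (Q ⊗ₘ κ)) {n m k : ℕ} (hk : 1 ≤ k) (hkn : k ≤ n) (hm : 1 ≤ m) :
    condBias μ n X (estimatorTwo n k m h X Y Xs) (target Q κ h) =ᵐ[μ]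
      fun ω => nnBias Q φ Finset.univ k (fun i : Fin n => X i ω) := by
  have h1 : estimatorTwo n k m h X Y Xs = fun ω => matchSum k (fun _ x y => h (x, y))
      ((fun i : Fin n => X i ω), ((fun i : Fin n => Y i ω), (fun j : Fin m => Xs j ω))) :=
    funext fun ω => estimatorTwo_eq_matchSum hk hkn ω
  have h2 := H.ae_condExp_matchSum_sub hs hk hkn hm (G := fun _ x y => h (x, y))
    (hh.comp (f := fun q : E d × E d × ℝ => q.2) (by fun_prop)) (fun _ _ => rfl)
    (integrable_regression hhQ) (hs.integrable_matchSum hhP n m k)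
  filter_upwards [h2] with ω h2
  rw [condBias, target_eq hhQ, ← h2, h1]

omit [IsProbabilityMeasure P] [IsProbabilityMeasure Q] in
theorem BiasSetting.biasCoef_eq (H : BiasSetting S P Q p F φ a b M D δ Kp) (k : ℕ) :
    biasCoef k S p Q F = gammaMean k (2 / (d : ℝ)) * ∫ z, localCoef p (F z) z ∂Q := by
  have h1 : Q.restrict S = Q := Measure.restrict_eq_self_of_ae_mem
    (H.ae_mem_interior.mono fun z hz => interior_subset hz)
  rw [biasCoef, h1, gammaMean, mul_assoc, Finset.sum_mul]
  rfl

omit [IsProbabilityMeasure P] [IsProbabilityMeasure Q] in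
theorem BiasSetting.exists_abs_biasCoef_mul_rpow_le (H : BiasSetting S P Q p F φ a b M D δ Kp)
    [IsProbabilityMeasure P] {k : ℕ → ℕ} (hk : ∀ n, 1 ≤ n → 1 ≤ k n ∧ k n ≤ n) :
    ∃ C, ∀ n, 1 ≤ n → |biasCoef (k n) S p Q F * (n : ℝ) ^ (-(2 / (d : ℝ)))| ≤
      C * ((k n : ℝ) / n) ^ (2 / (d : ℝ)) := by
  have hs := H.two_div_pos
  refine ⟨|∫ z, localCoef p (F z) z ∂Q| * 7, fun n hn => ?_⟩
  have hg0 : 0 ≤ gammaMean (k n) (2 / (d : ℝ)) * (n : ℝ) ^ (-(2 / (d : ℝ))) :=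
    mul_nonneg (gammaMean_nonneg _ hs.le) (by positivity)
  rw [H.biasCoef_eq, mul_right_comm, abs_mul, abs_of_nonneg hg0, mul_comm, mul_assoc]
  exact mul_le_mul_of_nonneg_left
    (gammaMean_mul_rpow_le hk hs (by linarith [H.two_div_le]) hn) (abs_nonneg _)

theorem BiasSetting.integral_nnBias_sub_isLittleO (H : BiasSetting S P Q p F φ a b M D δ Kp)
    {k : ℕ → ℕ} (hk : ∀ n, 1 ≤ n → 1 ≤ k n ∧ k n ≤ n)
    (hkn : Tendsto (fun n => (k n : ℝ) / n) atTop (𝓝 0)) :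
    (fun n : ℕ => (∫ x, nnBias Q φ Finset.univ (k n) x ∂(Measure.pi fun _ : Fin n => P)) -
        biasCoef (k n) S p Q F * (n : ℝ) ^ (-(2 / (d : ℝ))))
      =o[atTop] (fun n : ℕ => ((k n : ℝ) / n) ^ (2 / (d : ℝ))) := by
  refine (H.integral_nnMean_sub_isLittleO hk hkn).congr' ?_ EventuallyEq.rfl
  filter_upwards [eventually_ge_atTop 1] with n hn
  rw [H.biasCoef_eq]
  congr 1
  obtain ⟨N, rfl⟩ : ∃ N, n = N + 1 := ⟨n - 1, by omega⟩
  exact (integral_nnBias P Q (hk _ hn).1 H.φ_meas H.φ_le).symm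

theorem BiasSetting.variance_nnBias_isLittleO (H : BiasSetting S P Q p F φ a b M D δ Kp)
    (hd : 2 < d) {k : ℕ → ℕ} (hk : ∀ n, 1 ≤ n → 1 ≤ k n ∧ k n ≤ n)
    (hkn : Tendsto (fun n => (k n : ℝ) / n) atTop (𝓝 0)) :
    (fun n : ℕ => (∫ x, nnBias Q φ Finset.univ (k n) x ^ 2 ∂(Measure.pi fun _ : Fin n => P)) -
        (∫ x, nnBias Q φ Finset.univ (k n) x ∂(Measure.pi fun _ : Fin n => P)) ^ 2)
      =o[atTop] (fun n : ℕ => ((k n : ℝ) / n) ^ (4 / (d : ℝ))) := by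
  obtain ⟨C, hC⟩ := H.exists_variance_nnBias_le
  have hs := H.two_div_pos
  have hs1 : 2 / (d : ℝ) < 1 := by
    rw [div_lt_one (by positivity)]; exact_mod_cast hd
  have h1 : (fun n : ℕ => (∫ x, nnBias Q φ Finset.univ (k n) x ^ 2
        ∂(Measure.pi fun _ : Fin n => P)) -
        (∫ x, nnBias Q φ Finset.univ (k n) x ∂(Measure.pi fun _ : Fin n => P)) ^ 2)
      =O[atTop] (fun n : ℕ => (n : ℝ)⁻¹ * ((k n : ℝ) / n) ^ (2 / (d : ℝ))) := by
    refine IsBigO.of_bound C ?_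
    have h2 := hkn.eventually_lt_const (by norm_num : (0 : ℝ) < 1 / 2)
    filter_upwards [eventually_ge_atTop 1, h2] with n hn h2
    have hn0 : (0 : ℝ) < n := by exact_mod_cast hn
    rw [div_lt_iff₀ hn0] at h2
    have h3 : 2 * k n ≤ n := by
      have : (2 : ℝ) * k n ≤ n := by linarith
      exact_mod_cast this
    obtain ⟨N, rfl⟩ : ∃ N, n = N + 1 := ⟨n - 1, by omega⟩
    have h4 : 0 ≤ (∫ x, nnBias Q φ Finset.univ (k (N + 1)) x ^ 2
        ∂(Measure.pi fun _ : Fin (N + 1) => P)) -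
        (∫ x, nnBias Q φ Finset.univ (k (N + 1)) x ∂(Measure.pi fun _ : Fin (N + 1) => P)) ^ 2 :=
      sub_nonneg.2 (sq_integral_le (measurable_nnBias Q _ _ H.φ_meas)
        (abs_nnBias_le Q _ _ H.φ_le))
    rw [Real.norm_of_nonneg h4, Real.norm_of_nonneg (by positivity)]
    exact hC N _ (hk _ hn).1 h3
  -- Here `d > 2` enters: `n⁻¹ = o(n^(-2/d))`, and `n^(-2/d) ≤ (k/n)^(2/d)` because `k ≥ 1`.
  have h5 : (fun n : ℕ => (n : ℝ)⁻¹) =o[atTop] (fun n : ℕ => ((k n : ℝ) / n) ^ (2 / (d : ℝ))) := by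
    have h6 : (fun n : ℕ => (n : ℝ)⁻¹) =o[atTop] (fun n : ℕ => (n : ℝ) ^ (-(2 / (d : ℝ)))) := by
      refine (isLittleO_iff_tendsto' ?_).2 ?_
      · filter_upwards [eventually_ge_atTop 1] with n hn h0
        have hn0 : (0 : ℝ) < n := by exact_mod_cast hn
        exact absurd h0 (by positivity)
      · refine ((tendsto_rpow_neg_atTop (by linarith : 0 < 1 - 2 / (d : ℝ))).comp
          tendsto_natCast_atTop_atTop).congr' ?_
        filter_upwards [eventually_ge_atTop 1] with n hn
        have hn0 : (0 : ℝ) < n := by exact_mod_cast hn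
        rw [Function.comp_apply, ← Real.rpow_neg_one, ← Real.rpow_sub hn0]
        congr 1; ring
    refine h6.trans_isBigO (IsBigO.of_bound 1 ?_)
    filter_upwards [eventually_ge_atTop 1] with n hn
    have hn0 : (0 : ℝ) < n := by exact_mod_cast hn
    have hk1 : (1 : ℝ) ≤ k n := by exact_mod_cast (hk n hn).1
    rw [Real.norm_of_nonneg (by positivity), Real.norm_of_nonneg (by positivity), one_mul,
      Real.rpow_neg hn0.le, ← Real.inv_rpow hn0.le]
    refine Real.rpow_le_rpow (by positivity) ?_ hs.le
    rw [inv_eq_one_div]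
    gcongr
  have h6 := h1.trans_isLittleO (h5.mul_isBigO
    (isBigO_refl (fun n : ℕ => ((k n : ℝ) / n) ^ (2 / (d : ℝ))) atTop))
  refine h6.congr' EventuallyEq.rfl ?_
  filter_upwards [eventually_ge_atTop 1] with n hn
  have hn0 : (0 : ℝ) < n := by exact_mod_cast hn
  have hk1 : (0 : ℝ) < k n := by exact_mod_cast (hk n hn).1
  rw [← Real.rpow_add (by positivity)]
  congr 1; ring

/-- The second moment is the variance plus the squared mean. The squared mean differs from the
squared leading term by the product of their difference, which is little-o of the scale, and their
sum, which is big-O of it. -/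
theorem BiasSetting.hasBiasExpansion (H : BiasSetting S P Q p F φ a b M D δ Kp)
    (hs : IsSample μ P Q κ X Y Xs) {k : ℕ → ℕ} (hk : ∀ n, 1 ≤ n → 1 ≤ k n ∧ k n ≤ n)
    (hkn : Tendsto (fun n => (k n : ℝ) / n) atTop (𝓝 0)) {B : ℕ → Ω → ℝ}
    (hB : ∀ n, 1 ≤ n → B n =ᵐ[μ] fun ω => nnBias Q φ Finset.univ (k n) (fun i : Fin n => X i ω)) :
    HasBiasExpansion d μ k B (fun n => biasCoef (k n) S p Q F) := by
  have hm : ∀ n, Measurable fun x : Fin n → E d => nnBias Q φ Finset.univ (k n) x := fun n =>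
    measurable_nnBias Q _ _ H.φ_meas
  have hB1 : ∀ n, 1 ≤ n → ∫ ω, B n ω ∂μ =
      ∫ x, nnBias Q φ Finset.univ (k n) x ∂(Measure.pi fun _ : Fin n => P) := fun n hn => by
    rw [integral_congr_ae (hB n hn), ← hs.map_covariates n,
      integral_map (hs.measurable_covariates n).aemeasurable (hm n).aestronglyMeasurable]
  have hB2 : ∀ n, 1 ≤ n → ∫ ω, B n ω ^ 2 ∂μ =
      ∫ x, nnBias Q φ Finset.univ (k n) x ^ 2 ∂(Measure.pi fun _ : Fin n => P) := fun n hn => by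
    rw [integral_congr_ae ((hB n hn).mono fun ω hω => congrArg (· ^ 2) hω),
      ← hs.map_covariates n, integral_map (hs.measurable_covariates n).aemeasurable
        ((hm n).pow_const 2).aestronglyMeasurable]
  have hE := H.integral_nnBias_sub_isLittleO hk hkn
  refine ⟨fun n hn => ?_, ?_, fun hd => ?_⟩
  · refine (memLp_congr_ae (hB n hn)).2 ?_
    refine MemLp.of_bound ((hm n).comp (hs.measurable_covariates n)).aestronglyMeasurable
      ((Finset.univ : Finset (Fin n)).card * (M * D)) (Eventually.of_forall fun ω => ?_)
    exact abs_nnBias_le Q _ _ H.φ_le _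
  · refine hE.congr' ?_ EventuallyEq.rfl
    filter_upwards [eventually_ge_atTop 1] with n hn
    rw [hB1 n hn]
  · obtain ⟨C, hC⟩ := H.exists_abs_biasCoef_mul_rpow_le hk
    have hV := H.variance_nnBias_isLittleO hd hk hkn
    have hlead : (fun n : ℕ => biasCoef (k n) S p Q F * (n : ℝ) ^ (-(2 / (d : ℝ)))) =O[atTop]
        (fun n : ℕ => ((k n : ℝ) / n) ^ (2 / (d : ℝ))) := by
      refine IsBigO.of_bound C ?_
      filter_upwards [eventually_ge_atTop 1] with n hn
      rw [Real.norm_of_nonneg (by positivity : 0 ≤ ((k n : ℝ) / n) ^ (2 / (d : ℝ)))]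
      exact hC n hn
    have hsum : (fun n : ℕ => (∫ x, nnBias Q φ Finset.univ (k n) x
        ∂(Measure.pi fun _ : Fin n => P)) +
        biasCoef (k n) S p Q F * (n : ℝ) ^ (-(2 / (d : ℝ)))) =O[atTop]
        (fun n : ℕ => ((k n : ℝ) / n) ^ (2 / (d : ℝ))) := by
      refine (hE.isBigO.add (hlead.const_mul_left 2)).congr_left fun n => ?_
      ring
    have hprod := hE.mul_isBigO hsum
    have hpow : ∀ᶠ n : ℕ in atTop, ((k n : ℝ) / n) ^ (2 / (d : ℝ)) *
        ((k n : ℝ) / n) ^ (2 / (d : ℝ)) = ((k n : ℝ) / n) ^ (4 / (d : ℝ)) := by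
      filter_upwards [eventually_ge_atTop 1] with n hn
      have hn0 : (0 : ℝ) < n := by exact_mod_cast hn
      have hk1 : (0 : ℝ) < k n := by exact_mod_cast (hk n hn).1
      rw [← Real.rpow_add (by positivity)]
      congr 1; ring
    refine ((hprod.congr' EventuallyEq.rfl hpow).add hV).congr' ?_ EventuallyEq.rfl
    filter_upwards [eventually_ge_atTop 1] with n hn
    have hn0 : (0 : ℝ) < n := by exact_mod_cast hn
    have h4 : (n : ℝ) ^ (-(4 / (d : ℝ))) = ((n : ℝ) ^ (-(2 / (d : ℝ)))) ^ 2 := by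
      rw [sq, ← Real.rpow_add hn0]
      congr 1; ring
    rw [hB2 n hn, h4]
    ring

end Expansion

/-! ### Verification of the standing assumptions -/

section Setting

variable {d : ℕ} {S U : Set (E d)} {P Q : Measure (E d)} {p q : E d → ℝ}

theorem measurable_crossRegression {κ : Kernel (E d) ℝ} [IsMarkovKernel κ] {h : E d × ℝ → ℝ}
    (hh : Measurable h) : Measurable fun w : E d × E d => crossRegression κ h w.1 w.2 := by
  have h1 : StronglyMeasurable fun v : (E d × E d) × ℝ => h (v.1.1, v.2) :=
    (hh.comp (f := fun v : (E d × E d) × ℝ => (v.1.1, v.2)) (by fun_prop)).stronglyMeasurable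
  exact (h1.integral_kernel_prod_right' (κ := κ.comap Prod.snd measurable_snd)).measurable

theorem measurable_regression {κ : Kernel (E d) ℝ} [IsMarkovKernel κ] {h : E d × ℝ → ℝ}
    (hh : Measurable h) : Measurable (regression κ h) :=
  (measurable_crossRegression (κ := κ) hh).comp (f := fun x : E d => (x, x)) (by fun_prop)

/-- Cover `S` by the interiors of finitely many polytopes contained in `U` and take the hull of all
their vertices. The resulting polytope is a compact convex set between `S` and `U`, on which
continuous derivatives are bounded. -/
theorem exists_finset_subset_convexHull (hS : IsCompact S) (hUo : IsOpen U) (hUc : Convex ℝ U)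
    (hSU : S ⊆ U) : ∃ t : Finset (E d), S ⊆ convexHull ℝ (t : Set (E d)) ∧
      convexHull ℝ (t : Set (E d)) ⊆ U := by
  classical
  have h : ∀ x : E d, ∃ u : Finset (E d), x ∈ U →
      x ∈ interior (convexHull ℝ (u : Set (E d))) ∧ convexHull ℝ (u : Set (E d)) ⊆ U := fun x => by
    by_cases hx : x ∈ U
    · obtain ⟨u, hu1, hu2⟩ := (convex_singleton x).exists_subset_interior_convexHull_finset_of_isCompact
        isCompact_singleton (t := U) (by rw [nhdsSet_singleton]; exact hUo.mem_nhds hx)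
      exact ⟨u, fun _ => ⟨hu1 rfl, hu2⟩⟩
    · exact ⟨∅, fun h => absurd h hx⟩
  choose u hu using h
  obtain ⟨s, hs, hcov⟩ := hS.elim_nhds_subcover (fun x => convexHull ℝ (u x : Set (E d)))
    fun x hx => mem_interior_iff_mem_nhds.1 (hu x (hSU hx)).1
  refine ⟨s.biUnion u, fun y hy => ?_, convexHull_min (fun y hy => ?_) hUc⟩
  · obtain ⟨x, hx, hyx⟩ := Set.mem_iUnion₂.1 (hcov hy)
    exact convexHull_mono (by exact_mod_cast Finset.subset_biUnion_of_mem u hx) hyx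
  · obtain ⟨x, hx, hyx⟩ := Finset.mem_biUnion.1 (Finset.mem_coe.1 hy)
    exact (hu x (hSU (hs x hx))).2 (subset_convexHull ℝ _ hyx)

/-- A single smooth regression function is a smooth family. -/
theorem RegressionSmooth.crossRegressionSmooth {g : E d → ℝ} (hg : RegressionSmooth S U g)
    (hS : IsCompact S) (hUo : IsOpen U) (hUc : Convex ℝ U) (hSU : S ⊆ U) :
    CrossRegressionSmooth S U fun _ => g := by
  obtain ⟨gbar, hEq, hC, β, hβ0, hβ1, L, hL⟩ := hg
  obtain ⟨t, htS, htU⟩ : ∃ t : Finset (E d), S ⊆ convexHull ℝ (t : Set (E d)) ∧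
      convexHull ℝ (t : Set (E d)) ⊆ U :=
    exists_finset_subset_convexHull hS hUo hUc hSU
  have hK : IsCompact (convexHull ℝ (t : Set (E d))) := t.finite_toSet.isCompact_convexHull ℝ
  have hle : convexHull ℝ S ⊆ convexHull ℝ (t : Set (E d)) :=
    convexHull_min htS (convex_convexHull ℝ _)
  have h1 : ContDiffOn ℝ 1 (fderiv ℝ gbar) U := hC.fderiv_of_isOpen hUo (by norm_num)
  have h2 : ContinuousOn (hess gbar) U := h1.continuousOn_fderiv_of_isOpen hUo le_rfl
  obtain ⟨M1, hM1⟩ := hK.bddAbove_image (h1.continuousOn.mono htU).norm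
  obtain ⟨M2, hM2⟩ := hK.bddAbove_image (f := fun y => ‖hess gbar y‖)
    ((continuous_norm (E := E d →L[ℝ] E d →L[ℝ] ℝ)).comp_continuousOn (h2.mono htU))
  exact ⟨fun _ => gbar, fun _ _ => hEq, fun _ _ => hC,
    ⟨M1 + M2, fun _ _ y hy => add_le_add
      (hM1 (Set.mem_image_of_mem _ (hle hy))) (hM2 (Set.mem_image_of_mem _ (hle hy)))⟩, β, hβ0, hβ1, L, fun _ _ => hL⟩

theorem HasDensityOn.measure_le (hQ : HasDensityOn S Q q) {b : ℝ} (hb : ∀ x ∈ S, q x ≤ b)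
    (hSm : MeasurableSet S) (A : Set (E d)) : Q A ≤ ENNReal.ofReal b * volume A := by
  have h : Q ≤ ENNReal.ofReal b • (volume : Measure (E d)) := by
    refine Measure.le_iff.2 fun B hB => ?_
    have h1 : Q B = Q (B ∩ S) := (measure_inter_conull hQ.compl_null).symm
    rw [h1, hQ.eq_withDensity, withDensity_apply _ (hB.inter hSm), Measure.smul_apply, smul_eq_mul]
    calc ∫⁻ x in B ∩ S, ENNReal.ofReal (q x) ≤ ∫⁻ _ in B ∩ S, ENNReal.ofReal b :=
          setLIntegral_mono measurable_const fun x hx => ENNReal.ofReal_le_ofReal (hb x hx.2)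
      _ = ENNReal.ofReal b * volume (B ∩ S) := by simp
      _ ≤ ENNReal.ofReal b * volume B := by gcongr; exact Set.inter_subset_left
  exact h A

/-- The increments `F z y - F z z`, truncated to `S`. -/
noncomputable def truncIncrement (S : Set (E d)) (F : E d → E d → ℝ) (z y : E d) : ℝ :=
  (S ×ˢ S).indicator (fun w => F w.1 w.2 - F w.1 w.1) (z, y)

theorem exists_biasSetting (hd : 1 ≤ d) (hS : IsCompact S) (hUo : IsOpen U) (hUc : Convex ℝ U)
    (hSU : S ⊆ U) (hP : HasDensityOn S P p) (hQ : HasDensityOn S Q q)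
    (hpinf : ∃ a : ℝ, 0 < a ∧ ∀ x ∈ S, a ≤ p x) (hqsup : ∃ b : ℝ, 0 < b ∧ ∀ x ∈ S, q x ≤ b)
    (hpLip : ∃ K : ℝ≥0, LipschitzOnWith K p S) (hpC : DensitySmooth S U p)
    (hQsupp : Q.support ⊆ interior S) {F : E d → E d → ℝ}
    (hF : Measurable fun w : E d × E d => F w.1 w.2) (hFs : CrossRegressionSmooth S U F) :
    ∃ a b M D δ Kp, BiasSetting S P Q p F (truncIncrement S F) a b M D δ Kp := by
  obtain ⟨a, ha, hap⟩ := hpinf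
  obtain ⟨b, -, hb⟩ := hqsup
  obtain ⟨Kp, hKp⟩ := hpLip
  obtain ⟨pbar, hpbar, hpbarC, -⟩ := hpC
  obtain ⟨Fbar, hFbar, hFC, ⟨M, hM⟩, -⟩ := hFs
  obtain ⟨b', hb'⟩ := hS.exists_bound_of_continuousOn hKp.continuousOn
  have hKc : Convex ℝ (convexHull ℝ S) := convex_convexHull ℝ S
  have hKU : convexHull ℝ S ⊆ U := convexHull_min hSU hUc
  have hSK : S ⊆ convexHull ℝ S := subset_convexHull ℝ S
  have hM1 : ∀ z ∈ S, ∀ y ∈ convexHull ℝ S, ‖fderiv ℝ (Fbar z) y‖ ≤ max M 0 := fun z hz y hy =>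
    (le_add_of_nonneg_right (norm_nonneg (hess (Fbar z) y))).trans
      ((hM z hz y hy).trans (le_max_left _ _))
  have hM2 : ∀ z ∈ S, ∀ y ∈ convexHull ℝ S, ‖hess (Fbar z) y‖ ≤ max M 0 := fun z hz y hy =>
    (le_add_of_nonneg_left (norm_nonneg _)).trans ((hM z hz y hy).trans (le_max_left _ _))
  have hdist : ∀ z ∈ S, ∀ y ∈ S, ‖y - z‖ ≤ Metric.diam S := fun z hz y hy => by
    rw [← dist_eq_norm]; exact Metric.dist_le_diam_of_mem hS.isBounded hy hz
  have hφeq : ∀ z ∈ S, ∀ y ∈ S, truncIncrement S F z y = F z y - F z z := fun z hz y hy =>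
    Set.indicator_of_mem (s := S ×ˢ S) (a := (z, y)) ⟨hz, hy⟩ _
  have hφlip : ∀ z ∈ S, ∀ y ∈ S, |truncIncrement S F z y| ≤ max M 0 * ‖y - z‖ :=
    fun z hz y hy => by
      rw [hφeq z hz y hy, hFbar z hz hy, hFbar z hz hz]
      exact abs_sub_le_of_norm_fderiv_le hUo hKc hKU (hFC z hz) (hM1 z hz) (hSK hy) (hSK hz)
  have hnhds : ∀ z ∈ interior S, S ∈ 𝓝 z := fun z hz => mem_interior_iff_mem_nhds.1 hz
  have hUn : ∀ z ∈ interior S, U ∈ 𝓝 z := fun z hz => mem_of_superset (hnhds z hz) hSU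
  have hcomp : IsCompact Q.support :=
    hS.of_isClosed_subset Measure.isClosed_support (hQsupp.trans interior_subset)
  -- The support of `Q` is compact and contained in the open set `interior S`, so a whole thickening
  -- of it is; this yields one `δ` for almost all targets.
  obtain ⟨δ, hδ, hsub⟩ := hcomp.exists_thickening_subset_open isOpen_interior hQsupp
  refine ⟨a, max b b', max M 0, Metric.diam S, δ, Kp, ?_⟩
  exact
    { one_le := hd
      density := hP
      a_pos := ha
      le_p := hap
      p_le := fun y hy => (le_abs_self _).trans ((hb' y hy).trans (le_max_right _ _))
      p_lip := hKp
      -- On the interior of `S` a function agrees with its smooth extension in a neighbourhood, so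
      -- differentiability transfers, as do the derivatives entering the leading constant.
      p_diff := fun z hz => ((hpbarC.contDiffAt (hUn z hz)).differentiableAt
        one_ne_zero).congr_of_eventuallyEq
          (eventually_of_mem (hnhds z hz) fun y hy => hpbar hy)
      δ_pos := hδ
      ball_subset := by
        filter_upwards [Measure.support_mem_ae (μ := Q)] with z hz
        exact (Metric.ball_subset_thickening hz δ).trans (hsub.trans interior_subset)
      F_meas := fun z => hF.comp measurable_prodMk_left
      φ_meas := by
        have h1 : Measurable fun w : E d × E d => F w.1 w.2 - F w.1 w.1 :=
          hF.sub (hF.comp (f := fun w : E d × E d => (w.1, w.1)) (by fun_prop))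
        exact h1.indicator (hS.measurableSet.prod hS.measurableSet)
      φ_eq := hφeq
      contDiffAt := fun z hz => ((hFC z (interior_subset hz)).contDiffAt
        (hUn z hz)).congr_of_eventuallyEq
          (eventually_of_mem (hnhds z hz) fun y hy => hFbar z (interior_subset hz) hy)
      taylor := fun z hz => ⟨fderiv ℝ (Fbar z) z, hM1 z hz z (hSK hz), fun y hy => by
        rw [hFbar z hz hy, hFbar z hz hz]
        exact abs_sub_sub_fderiv_le hUo hKc hKU (hFC z hz) (hM2 z hz) (hSK hy) (hSK hz)⟩
      φ_lip := hφlip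
      φ_le := fun z y => by
        by_cases hzy : (z, y) ∈ S ×ˢ S
        · exact (hφlip z hzy.1 y hzy.2).trans (mul_le_mul_of_nonneg_left
            (hdist z hzy.1 y hzy.2) (le_max_right _ _))
        · rw [truncIncrement, Set.indicator_of_notMem hzy, abs_zero]
          exact mul_nonneg (le_max_right _ _) Metric.diam_nonneg
      norm_sub_le := hdist
      Q_le := hQ.measure_le (fun x hx => (hb x hx).trans (le_max_left _ _)) hS.measurableSet }

/-- The growth condition enters through `k ≤ k ^ (d + 1)`. -/
theorem tendsto_div_of_pow_isLittleO {d : ℕ} {k : ℕ → ℕ}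
    (hkn : (fun n : ℕ => (k n : ℝ) ^ (d + 1)) =o[atTop] (fun n : ℕ => (n : ℝ))) :
    Tendsto (fun n => (k n : ℝ) / n) atTop (𝓝 0) := by
  refine (IsBigO.trans_isLittleO (IsBigO.of_bound 1 (Eventually.of_forall fun n => ?_))
    hkn).tendsto_div_nhds_zero
  rw [one_mul, Real.norm_of_nonneg (by positivity), Real.norm_of_nonneg (by positivity)]
  exact_mod_cast Nat.le_self_pow (by omega) (k n)

end Setting

end KNNMatching

/-! ### The main theorem -/

theorem mainTheorem6 {d : ℕ} (hd : 1 ≤ d)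
    {Ω : Type*} [MeasurableSpace Ω] (μ : Measure Ω) [IsProbabilityMeasure μ]
    (S U : Set (KNNMatching.E d))
    (P Q : Measure (KNNMatching.E d)) [IsProbabilityMeasure P] [IsProbabilityMeasure Q]
    (p q : KNNMatching.E d → ℝ)
    (κ : Kernel (KNNMatching.E d) ℝ) [IsMarkovKernel κ]
    (h : KNNMatching.E d × ℝ → ℝ) (hh : Measurable h)
    (hhP : Integrable h (P ⊗ₘ κ)) (hhQ : Integrable h (Q ⊗ₘ κ))
    -- `S` is compact, `U` is an open bounded convex set containing it
    (hS : IsCompact S) (hUo : IsOpen U) (hUc : Convex ℝ U) (hUb : Bornology.IsBounded U)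
    (hSU : S ⊆ U)
    (hball : KNNMatching.BallProportion S)
    -- densities
    (hP : KNNMatching.HasDensityOn S P p) (hQ : KNNMatching.HasDensityOn S Q q)
    (hpinf : ∃ a : ℝ, 0 < a ∧ ∀ x ∈ S, a ≤ p x)
    (hqsup : ∃ b : ℝ, 0 < b ∧ ∀ x ∈ S, q x ≤ b)
    (hpLip : ∃ K : ℝ≥0, LipschitzOnWith K p S)
    (hpC : KNNMatching.DensitySmooth S U p)
    (hQsupp : Q.support ⊆ interior S)
    -- regression function
    (hgLip : ∃ K : ℝ≥0, LipschitzOnWith K (KNNMatching.regression κ h) S)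
    -- the data
    (X : ℕ → Ω → KNNMatching.E d) (Y : ℕ → Ω → ℝ) (Xs : ℕ → Ω → KNNMatching.E d)
    (hsample : KNNMatching.IsSample μ P Q κ X Y Xs)
    -- the number of neighbours and the size of the target sample, as functions of `n`
    (k m : ℕ → ℕ) (hk : ∀ n, 1 ≤ n → 1 ≤ k n ∧ k n ≤ n) (hm : ∀ n, 1 ≤ n → 1 ≤ m n)
    (hkn : (fun n : ℕ => (k n : ℝ) ^ (d + 1)) =o[atTop] (fun n : ℕ => (n : ℝ))) :
    -- first estimator
    (KNNMatching.CrossRegressionSmooth S U (KNNMatching.crossRegression κ h) →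
      ∀ Yhat : (n : ℕ) → Fin (m n) → Ω → ℝ,
      (∀ n, 1 ≤ n → KNNMatching.IsImputation μ n (k n) (m n) X Y Xs (Yhat n)) →
      (∀ n, 1 ≤ n → Integrable (KNNMatching.estimatorOne (m n) h Xs (Yhat n)) μ) →
      KNNMatching.HasBiasExpansion d μ k
        (fun n => KNNMatching.condBias μ n X (KNNMatching.estimatorOne (m n) h Xs (Yhat n))
          (KNNMatching.target Q κ h))
        (fun n => KNNMatching.biasCoef (k n) S p Q (KNNMatching.crossRegression κ h))) ∧
    -- second estimator
    (KNNMatching.RegressionSmooth S U (KNNMatching.regression κ h) →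
      KNNMatching.HasBiasExpansion d μ k
        (fun n => KNNMatching.condBias μ n X
          (KNNMatching.estimatorTwo n (k n) (m n) h X Y Xs) (KNNMatching.target Q κ h))
        (fun n => KNNMatching.biasCoef (k n) S p Q (fun _ => KNNMatching.regression κ h))) := by
  have hdiv := KNNMatching.tendsto_div_of_pow_isLittleO hkn
  constructor
  · intro hsmooth Yhat hI hint
    obtain ⟨a, b, M, D, δ, Kp, H⟩ := KNNMatching.exists_biasSetting hd hS hUo hUc hSU hP hQ hpinf
      hqsup hpLip hpC hQsupp (KNNMatching.measurable_crossRegression hh) hsmooth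
    exact H.hasBiasExpansion hsample hk hdiv fun n hn => H.condBias_estimatorOne hsample hh hhQ
      (hk n hn).1 (hk n hn).2 (hm n hn) (hI n hn) (hint n hn)
  · intro hsmooth
    -- For the second estimator the regression function does not depend on the target point: `F z y
    -- = g(y)`.
    obtain ⟨a, b, M, D, δ, Kp, H⟩ := KNNMatching.exists_biasSetting hd hS hUo hUc hSU hP hQ hpinf
      hqsup hpLip hpC hQsupp (F := fun _ => KNNMatching.regression κ h)
      ((KNNMatching.measurable_regression hh).comp measurable_snd)
      (hsmooth.crossRegressionSmooth hS hUo hUc hSU)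
    exact H.hasBiasExpansion hsample hk hdiv fun n hn => H.condBias_estimatorTwo hsample hh hhP hhQ
      (hk n hn).1 (hk n hn).2 (hm n hn)
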